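/- **Setting.** For each $n\ge 1$ let $X_1,\dots,X_n$ (depending on $n$) be i.i.d. real random variables, let $Z_{ij}=Z_{ji}$ ($1\le i\neq j\le n$) be $\mathrm{Ber}(p_n)$ random variables such that $(Z_{ij})_{1\le i<j\le n}$ are independent of each other and of $(X_i)_{1\le i\le n}$, and let $h_n:\mathbb R\times\mathbb R\to\mathbb R$ be a symmetric Borel function. Assume $np_n\to\infty$ and, for all $1\le i\neq j\le n$, $\mathbb E[h_n(X_i,X_j)]=0$ and $\mathbb E[h_n^2(X_i,X_j)]<\infty$. Write $p=p_n$, $h(i,j)=h_n(X_i,X_j)$ and, for $i\ne j$, $$\Phi(i,j)=Z_{ij}h(i,j),\qquad \Psi_j(i)=\mathbb E[\Phi(i,j)\mid X_i,Z_{ij}],\qquad \tilde\Phi(i,j)=\Phi(i,j)-\Psi_j(i)-\Psi_i(j),$$ $$\tilde h(i,j)=h(i,j)-\mathbb E[h(i,j)\mid X_i]-\mathbb E[h(i,j)\mid X_j],$$ $$\beta_n^2=\mathbb E[\Phi^2(1,2)],\qquad \gamma_n^2=\mathbb E[\Psi_2^2(1)],\qquad \theta_n=\sqrt{np_n\gamma_n^2+\beta_n^2/2},$$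 and assume that $\theta_n>0$ for all sufficiently large $n$. For $k\notin\{i,j\}$ put $$G_k(i,j)=\mathbb E[\Phi(i,k)\Phi(j,k)\mid X_i,X_j,Z_{ik},Z_{jk}],\qquad \tilde H(i,j)=\mathbb E[\tilde h(i,k)\tilde h(j,k)\mid X_i,X_j]$$ (almost surely, $\tilde H(i,j)$ does not depend on the choice of $k$). For $1\le i\le n$ let $$\xi_i=\frac1{n\theta_n}\sum_{\substack{1\le j\le n\\ j\ne i}}\Psi_j(i)+\frac1{n\theta_n}\sum_{j=1}^{i-1}\tilde\Phi(i,j),\qquad \mathcal F_i=\sigma\bigl(X_k\ (1\le k\le i),\ Z_{lm}\ (1\le l\le i,\ 1\le m\le n,\ m\ne l)\bigr),$$ and let $\mathcal F_0$ be the trivial $\sigma$-algebra. **Proposition 4.1.** Suppose that, as $n\to\infty$, for every $\varepsilon>0$, $$\frac1{n\theta_n^2}\,\mathbb E\Bigl[\Bigl(\sum_{j=2}^n\Psi_j(1)\Bigr)^2\mathbf 1_{\{|\sum_{j=2}^n\Psi_j(1)|\ge\varepsilon\theta_n n\}}\Bigr]\to0,\tag{C1}$$ $$\theta_n^{-2}\,\mathbb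 E\bigl[\tilde\Phi^2(1,2)\mathbf 1_{\{|\tilde\Phi(1,2)|\ge\varepsilon\theta_n n\}}\bigr]\to0,\tag{C2}$$ $$p\,\theta_n^{-2}\,\mathbb E\bigl[\tilde H(1,1)\mathbf 1_{\{|\tilde H(1,1)|\ge\varepsilon\theta_n^2n/p\}}\bigr]\to0,\tag{C3}$$ and $$\theta_n^{-4}\,\mathbb E\bigl[G_1^2(2,3)\bigr]\to0.\tag{C4}$$ Then, in probability as $n\to\infty$, $$\sum_{i=1}^n\mathbb E\bigl[\xi_i^2\mathbf 1_{\{|\xi_i|\ge\varepsilon\}}\mid\mathcal F_{i-1}\bigr]\to0\quad\text{for every }\varepsilon>0,\tag{B1}$$ $$\sum_{i=1}^n\mathbb E\bigl[\xi_i^2\mid\mathcal F_{i-1}\bigr]\to1.\tag{B2}$$ -/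

import Mathlib

open MeasureTheory ProbabilityTheory Filter Topology

/-- The data and standing assumptions of an incomplete U-statistic over a triangular array.
The `n`-th row consists of `X n 1, …, X n n`, of `Z n i j` for `1 ≤ i ≠ j ≤ n`, of the parameter
`p n` and of the kernel `h n`; values at indices outside `{1, …, n}` are irrelevant.  Nothing is
assumed on the joint law of different rows. -/
structure IncompleteUArray {Ω : Type*} [MeasurableSpace Ω] (P : Measure Ω) where
  X : ℕ → ℕ → Ω → ℝ
  Z : ℕ → ℕ → ℕ → Ω → ℝ
  p : ℕ → unitInterval
  h : ℕ → ℝ → ℝ → ℝ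
  measurable_X : ∀ n, ∀ i ∈ Finset.Icc 1 n, Measurable (X n i)
  identDistrib_X : ∀ n, ∀ i ∈ Finset.Icc 1 n, ∀ j ∈ Finset.Icc 1 n,
    IdentDistrib (X n i) (X n j) P P
  measurable_Z : ∀ n, ∀ i ∈ Finset.Icc 1 n, ∀ j ∈ Finset.Icc 1 n, i ≠ j → Measurable (Z n i j)
  symm_Z : ∀ n, ∀ i ∈ Finset.Icc 1 n, ∀ j ∈ Finset.Icc 1 n, i ≠ j → Z n i j = Z n j i
  law_Z : ∀ n, ∀ i ∈ Finset.Icc 1 n, ∀ j ∈ Finset.Icc 1 n, i ≠ j →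
    HasLaw (Z n i j) (bernoulliMeasure 1 0 (p n)) P
  /-- In each row, the variables `X i`, `1 ≤ i ≤ n`, and `Z i j`, `1 ≤ i < j ≤ n`, are jointly
  independent. -/
  indep : ∀ n, iIndepFun (β := fun _ => ℝ)
    (Sum.elim (fun i : {i : ℕ // i ∈ Finset.Icc 1 n} => X n i)
      (fun e : {e : ℕ × ℕ // 1 ≤ e.1 ∧ e.1 < e.2 ∧ e.2 ≤ n} => Z n e.1.1 e.1.2)) P
  tendsto_mul_p : Tendsto (fun n : ℕ => (n : ℝ) * (p n : ℝ)) atTop atTop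
  measurable_h : ∀ n, Measurable (Function.uncurry (h n))
  symm_h : ∀ n x y, h n x y = h n y x
  /-- `h n (X i) (X j)` is square integrable for `i ≠ j`. -/
  memLp_h : ∀ n, ∀ i ∈ Finset.Icc 1 n, ∀ j ∈ Finset.Icc 1 n, i ≠ j →
    MemLp (fun ω => h n (X n i ω) (X n j ω)) 2 P
  centered_h : ∀ n, ∀ i ∈ Finset.Icc 1 n, ∀ j ∈ Finset.Icc 1 n, i ≠ j →
    ∫ ω, h n (X n i ω) (X n j ω) ∂P = 0

namespace IncompleteUArray

variable {Ω : Type*} [MeasurableSpace Ω] {P : Measure Ω} (A : IncompleteUArray P)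

/-- The σ-algebra generated by `X i`. -/
@[reducible] def sigmaX (n i : ℕ) : MeasurableSpace Ω :=
  MeasurableSpace.comap (A.X n i) inferInstance

/-- The σ-algebra generated by `Z i j`. -/
@[reducible] def sigmaZ (n i j : ℕ) : MeasurableSpace Ω :=
  MeasurableSpace.comap (A.Z n i j) inferInstance

/-- `h(i,j) = h_n(X_i, X_j)`. -/
def hh (n i j : ℕ) (ω : Ω) : ℝ := A.h n (A.X n i ω) (A.X n j ω)

/-- `Φ(i,j) = Z_ij h(i,j)`. -/
def Phi (n i j : ℕ) (ω : Ω) : ℝ := A.Z n i j ω * A.hh n i j ω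

/-- `Ψ_j(i) = E[Φ(i,j) | X_i, Z_ij]`. -/
noncomputable def Psi (n j i : ℕ) : Ω → ℝ :=
  P[A.Phi n i j | A.sigmaX n i ⊔ A.sigmaZ n i j]

/-- `β_n² = E[Φ(1,2)²]`. -/
noncomputable def betaSq (n : ℕ) : ℝ := ∫ ω, A.Phi n 1 2 ω ^ 2 ∂P

/-- `γ_n² = E[Ψ_2(1)²]`. -/
noncomputable def gammaSq (n : ℕ) : ℝ := ∫ ω, A.Psi n 2 1 ω ^ 2 ∂P

/-- `θ_n`, the nonnegative root of `θ_n² = n p_n γ_n² + β_n² / 2`. -/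
noncomputable def theta (n : ℕ) : ℝ :=
  Real.sqrt (n * (A.p n : ℝ) * A.gammaSq n + A.betaSq n / 2)

/-- `Φ̃(i,j) = Φ(i,j) - Ψ_j(i) - Ψ_i(j)`. -/
noncomputable def PhiTilde (n i j : ℕ) (ω : Ω) : ℝ :=
  A.Phi n i j ω - A.Psi n j i ω - A.Psi n i j ω

/-- `h̃(i,j) = h(i,j) - E[h(i,j) | X_i] - E[h(i,j) | X_j]`. -/
noncomputable def hTilde (n i j : ℕ) (ω : Ω) : ℝ :=
  A.hh n i j ω - (P[A.hh n i j | A.sigmaX n i]) ω - (P[A.hh n i j | A.sigmaX n j]) ω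

/-- `G_k(i,j) = E[Φ(i,k) Φ(j,k) | X_i, X_j, Z_ik, Z_jk]`. -/
noncomputable def G (n k i j : ℕ) : Ω → ℝ :=
  P[fun ω => A.Phi n i k ω * A.Phi n j k ω |
    A.sigmaX n i ⊔ A.sigmaX n j ⊔ A.sigmaZ n i k ⊔ A.sigmaZ n j k]

/-- `H̃(i,j) = E[h̃(i,k) h̃(j,k) | X_i, X_j]`, for any auxiliary index `k` different from `i, j`.
It is the `X`-dependent factor in
`E[Φ̃(i,k) Φ̃(j,k) | X_i, X_j, Z_ik, Z_jk] = Z_ik Z_jk H̃(i,j)`. -/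
noncomputable def HTilde (n k i j : ℕ) : Ω → ℝ :=
  P[fun ω => A.hTilde n i k ω * A.hTilde n j k ω | A.sigmaX n i ⊔ A.sigmaX n j]

/-- `ξ_i = ξ_i⁽¹⁾ + ξ_i⁽²⁾`, where `ξ_i⁽¹⁾ = (n θ_n)⁻¹ ∑_{j ≠ i} Ψ_j(i)` and
`ξ_i⁽²⁾ = (n θ_n)⁻¹ ∑_{j < i} Φ̃(i,j)`. -/
noncomputable def xi (n i : ℕ) (ω : Ω) : ℝ :=
  1 / (n * A.theta n) * ∑ j ∈ (Finset.Icc 1 n).erase i, A.Psi n j i ω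
    + 1 / (n * A.theta n) * ∑ j ∈ Finset.Ico 1 i, A.PhiTilde n i j ω

/-- `ℱ_i = σ(X_k (1 ≤ k ≤ i), Z_lm (1 ≤ l ≤ i, 1 ≤ m ≤ n, m ≠ l))`. -/
@[reducible] def filt (n i : ℕ) : MeasurableSpace Ω :=
  (⨆ k ∈ Finset.Icc 1 i, A.sigmaX n k) ⊔
    ⨆ l ∈ Finset.Icc 1 i, ⨆ m ∈ (Finset.Icc 1 n).erase l, A.sigmaZ n l m

/-- `η₁ = ∑_{i=1}^n E[ξ_i² 1{|ξ_i| ≥ ε} | ℱ_{i-1}]`. -/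
noncomputable def eta1 (ε : ℝ) (n : ℕ) (ω : Ω) : ℝ :=
  ∑ i ∈ Finset.Icc 1 n,
    (P[{ω' | ε ≤ |A.xi n i ω'|}.indicator (fun ω' => A.xi n i ω' ^ 2) | A.filt n (i - 1)]) ω

/-- `η₂ = ∑_{i=1}^n E[ξ_i² | ℱ_{i-1}]`. -/
noncomputable def eta2 (n : ℕ) (ω : Ω) : ℝ :=
  ∑ i ∈ Finset.Icc 1 n, (P[fun ω' => A.xi n i ω' ^ 2 | A.filt n (i - 1)]) ω

end IncompleteUArray

/-!
# Conditional variance and Lindeberg condition for incomplete U-statistics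

Everything happens inside one row of the array, so fix `n` and write `μ` for the law of `X_1` and
`Λ = n p`.  With the Hoeffding decomposition `h(x, y) = g(x) + g(y) + t(x, y)`, where
`g(x) = E h(x, X)` and `t` is degenerate, one finds `Ψ_j(i) = Z_ij g(X_i)` and
`Φ̃(i, j) = Z_ij t(X_i, X_j)`.  Hence, with `S_i = ∑_{j ≠ i} Z_ij` the degree of the vertex `i`,

`n θ ξ_i = S_i g(X_i) + ∑_{j < i} Z_ij t(X_i, X_j)`,

and `θ² = n p² ‖g‖² + p ‖h‖² / 2`, while `‖h‖² = 2 ‖g‖² + ‖t‖²`.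

**Conditional variance.**  Given everything except `X_i`, the second moment of `n θ ξ_i` is

`S_i² ‖g‖² + 2 S_i ∑_{j < i} Z_ij (Tg)(X_j) + ∑_{j, l < i} Z_ij Z_il H(X_j, X_l)`,

up to a centring of `Tg`; here `T` is the integral operator of `h` and `H` is the iterated kernel
of `t`.  The main part of this is `E S_i² ‖g‖² + ∑_{j < i} Z_ij H(X_j, X_j)` (`condMain`).  The
remainder is small in `L¹` (`IsRow.integral_abs_condExp_increment_sub_le`): `S_i²` concentrates
because `Λ → ∞`, and the terms of the other two sums are orthogonal, with norms controlled by
`p² ‖T²‖² / θ⁴ = θ⁻⁴ E G²`, the Hilbert–Schmidt norm of `T²` dominating both `‖Tg‖²` and the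
Hilbert–Schmidt norm of `H` (`HoeffdingKernel.sq_integral_sq_cross_le`,
`HoeffdingKernel.kernelSq_gram_degen_le`).  A conditional expectation is an `L¹` contraction and
`ℱ_{i-1}` does not see `X_i`, while it does see the main part, so the same bound holds for the
conditional variance given `ℱ_{i-1}`.  Summed over `i`, the main part obeys a law of large numbers
(`IsRow.integral_abs_sum_edge_mul_sub_le`), by truncating `H(X_j, X_j)` at the level of the
condition on `H̃(1, 1)`.  Its mean is `n² θ²` up to a relative error of order `1 / n`.

**Lindeberg condition.**  The functional is nonnegative, so it suffices to bound its mean, a sum of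
unconditional truncated second moments.  The linear parts `S_i g(X_i)` all have the law of
`∑_j Ψ_j(1)`.  For the degenerate part, fix `X_i = x`: then `∑_{j < i} Z_ij t(x, X_j)` is a sum of
independent centred variables with variance at most `p H(x, x)`.  Truncating the summands at
`δ θ n` leaves a fourth moment to estimate, which is small unless `p H(x, x) ≥ δ θ² n`; both
exceptional contributions are those excluded by hypothesis
(`IsRow.integral_indicator_sum_edge_mul_degen_le`).

Two choices simplify the bookkeeping.  The kernel is changed on a null set so that all its sections
are square integrable (`exists_hoeffdingKernel_ae_eq`), and the edge variables are changed on a null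
set so as to take the values `0` and `1` only; since the latter may destroy measurability with
respect to other σ-algebras, the row structure `IsRow` keeps the original σ-algebras separately.
-/

/-! ### Second moments and orthogonal sums -/

section SecondMoment

variable {Ω : Type*} [MeasurableSpace Ω] {P : Measure Ω}

theorem sq_integral_abs_mul_le {f g : Ω → ℝ} (hf : MemLp f 2 P) (hg : MemLp g 2 P) :
    (∫ ω, |f ω * g ω| ∂P) ^ 2 ≤ (∫ ω, f ω ^ 2 ∂P) * ∫ ω, g ω ^ 2 ∂P := by
  have h := integral_mul_norm_le_Lp_mul_Lq (μ := P) (f := f) (g := g)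
    (p := 2) (q := 2) Real.HolderConjugate.two_two (by simpa using hf) (by simpa using hg)
  have hf0 : 0 ≤ ∫ ω, f ω ^ 2 ∂P := integral_nonneg fun _ => sq_nonneg _
  have hg0 : 0 ≤ ∫ ω, g ω ^ 2 ∂P := integral_nonneg fun _ => sq_nonneg _
  simp only [Real.norm_eq_abs, Real.rpow_two, sq_abs, ← Real.sqrt_eq_rpow, ← abs_mul] at h
  calc _ ≤ (√(∫ ω, f ω ^ 2 ∂P) * √(∫ ω, g ω ^ 2 ∂P)) ^ 2 :=
        pow_le_pow_left₀ (integral_nonneg fun _ => abs_nonneg _) h 2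
    _ = _ := by rw [mul_pow, Real.sq_sqrt hf0, Real.sq_sqrt hg0]

theorem integral_abs_mul_le_sqrt {f g : Ω → ℝ} (hf : MemLp f 2 P) (hg : MemLp g 2 P) :
    ∫ ω, |f ω * g ω| ∂P ≤ √((∫ ω, f ω ^ 2 ∂P) * ∫ ω, g ω ^ 2 ∂P) :=
  Real.le_sqrt_of_sq_le (sq_integral_abs_mul_le hf hg)

theorem integral_abs_le_sqrt [IsProbabilityMeasure P] {f : Ω → ℝ} (hf : MemLp f 2 P) :
    ∫ ω, |f ω| ∂P ≤ √(∫ ω, f ω ^ 2 ∂P) := by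
  simpa using integral_abs_mul_le_sqrt hf (memLp_const (1 : ℝ))

theorem sq_integral_le [IsProbabilityMeasure P] {f : Ω → ℝ} (hf : MemLp f 2 P) :
    (∫ ω, f ω ∂P) ^ 2 ≤ ∫ ω, f ω ^ 2 ∂P := by
  have h := sq_integral_abs_mul_le hf (memLp_const (1 : ℝ))
  simp only [mul_one, one_pow, integral_const, probReal_univ, smul_eq_mul] at h
  refine le_trans ?_ h
  rw [← sq_abs]
  gcongr
  exact abs_integral_le_integral_abs

theorem integral_sq_sum_of_orthogonal {ι : Type*} (s : Finset ι) {f : ι → Ω → ℝ}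
    (hf : ∀ i ∈ s, MemLp (f i) 2 P)
    (horth : ∀ i ∈ s, ∀ j ∈ s, i ≠ j → ∫ ω, f i ω * f j ω ∂P = 0) :
    ∫ ω, (∑ i ∈ s, f i ω) ^ 2 ∂P = ∑ i ∈ s, ∫ ω, f i ω ^ 2 ∂P := by
  have hint : ∀ i ∈ s, ∀ j ∈ s, Integrable (fun ω => f i ω * f j ω) P :=
    fun i hi j hj => (hf i hi).integrable_mul (hf j hj)
  simp_rw [sq, Finset.sum_mul_sum]
  rw [integral_finsetSum _ fun i hi => integrable_finsetSum _ fun j hj => hint i hi j hj]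
  refine Finset.sum_congr rfl fun i hi => ?_
  rw [integral_finsetSum _ fun j hj => hint i hi j hj,
    Finset.sum_eq_single_of_mem i hi fun j hj hji => horth i hi j hj hji.symm]

theorem memLp_two_of_sq_le {f : Ω → ℝ} (hf : AEStronglyMeasurable f P) {g : Ω → ℝ}
    (hg : Integrable g P) (h : ∀ᵐ ω ∂P, f ω ^ 2 ≤ g ω) : MemLp f 2 P := by
  rw [memLp_two_iff_integrable_sq hf]
  refine hg.mono' (hf.pow 2) ?_
  filter_upwards [h] with ω hω
  rwa [Real.norm_of_nonneg (sq_nonneg _)]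

end SecondMoment

/-! ### Fubini and conditioning for independent variables -/

section Independence

variable {Ω α β : Type*} {mΩ : MeasurableSpace Ω} [MeasurableSpace α] [MeasurableSpace β]
  {P : Measure Ω} [IsProbabilityMeasure P] {U : Ω → α} {V : Ω → β}

theorem ProbabilityTheory.IndepFun.integrable_map_prod (h : IndepFun U V P) (hU : Measurable U)
    (hV : Measurable V) {f : α × β → ℝ} (hf : Measurable f)
    (hint : Integrable (fun ω => f (U ω, V ω)) P) :
    Integrable f ((P.map U).prod (P.map V)) := by
  rw [← (indepFun_iff_map_prod_eq_prod_map_map hU.aemeasurable hV.aemeasurable).1 h]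
  exact (integrable_map_measure hf.aestronglyMeasurable (hU.prodMk hV).aemeasurable).2 hint

theorem ProbabilityTheory.IndepFun.integral_map_prod (h : IndepFun U V P) (hU : Measurable U)
    (hV : Measurable V) {f : α × β → ℝ} (hf : Measurable f) :
    ∫ ω, f (U ω, V ω) ∂P = ∫ z, f z ∂((P.map U).prod (P.map V)) := by
  rw [← (indepFun_iff_map_prod_eq_prod_map_map hU.aemeasurable hV.aemeasurable).1 h]
  exact (integral_map (hU.prodMk hV).aemeasurable hf.aestronglyMeasurable).symm

theorem ProbabilityTheory.IndepFun.integrable_integral_right (h : IndepFun U V P)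
    (hU : Measurable U) (hV : Measurable V) {f : α × β → ℝ} (hf : Measurable f)
    (hint : Integrable (fun ω => f (U ω, V ω)) P) :
    Integrable (fun ω => ∫ v, f (U ω, v) ∂(P.map V)) P := by
  have := Measure.isProbabilityMeasure_map (μ := P) hV.aemeasurable
  have := (h.integrable_map_prod hU hV hf hint).integral_prod_left
  exact (integrable_map_measure this.aestronglyMeasurable hU.aemeasurable).1 this

/-- Fubini for a function of two independent variables: integrate out the second one. -/
theorem ProbabilityTheory.IndepFun.integral_comp_prod (h : IndepFun U V P) (hU : Measurable U)
    (hV : Measurable V) {f : α × β → ℝ} (hf : Measurable f)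
    (hint : Integrable (fun ω => f (U ω, V ω)) P) :
    ∫ ω, f (U ω, V ω) ∂P = ∫ ω, ∫ v, f (U ω, v) ∂(P.map V) ∂P := by
  have := Measure.isProbabilityMeasure_map (μ := P) hU.aemeasurable
  have := Measure.isProbabilityMeasure_map (μ := P) hV.aemeasurable
  have hi := h.integrable_map_prod hU hV hf hint
  rw [h.integral_map_prod hU hV hf, integral_prod _ hi,
    integral_map hU.aemeasurable hi.integral_prod_left.aestronglyMeasurable]

theorem ProbabilityTheory.IndepFun.integral_comp_prod_symm (h : IndepFun U V P)
    (hU : Measurable U) (hV : Measurable V) {f : α × β → ℝ} (hf : Measurable f)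
    (hint : Integrable (fun ω => f (U ω, V ω)) P) :
    ∫ ω, f (U ω, V ω) ∂P = ∫ v, ∫ ω, f (U ω, v) ∂P ∂(P.map V) := by
  have := Measure.isProbabilityMeasure_map (μ := P) hU.aemeasurable
  have := Measure.isProbabilityMeasure_map (μ := P) hV.aemeasurable
  have hi := h.integrable_map_prod hU hV hf hint
  rw [h.integral_map_prod hU hV hf, integral_prod_symm _ hi]
  refine integral_congr_ae (Eventually.of_forall fun v => ?_)
  exact integral_map hU.aemeasurable (hf.comp measurable_prodMk_right).aestronglyMeasurable

/-- If `U` is `m`-measurable and `V` is independent of `m`, then `E[f(U, V) | m]` is obtained by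
integrating out `V`. -/
theorem condExp_comp_prod_of_indep {Ω α β : Type*} {m mΩ : MeasurableSpace Ω} [MeasurableSpace α]
    [MeasurableSpace β] {P : Measure Ω} [IsProbabilityMeasure P] {U : Ω → α} {V : Ω → β}
    (hm : m ≤ mΩ)
    (hU : Measurable[m] U) (hV : Measurable V)
    (hind : Indep m (MeasurableSpace.comap V inferInstance) P)
    {f : α × β → ℝ} (hf : Measurable f) (hint : Integrable (fun ω => f (U ω, V ω)) P) :
    P[fun ω => f (U ω, V ω) | m] =ᵐ[P] fun ω => ∫ v, f (U ω, v) ∂(P.map V) := by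
  have := Measure.isProbabilityMeasure_map (μ := P) hV.aemeasurable
  have hU' : Measurable U := hU.mono hm le_rfl
  have hUV : IndepFun U V P := indep_of_indep_of_le_left hind hU.comap_le
  have hsm : StronglyMeasurable fun a => ∫ v, f (a, v) ∂(P.map V) :=
    hf.stronglyMeasurable.integral_prod_right'
  symm
  refine ae_eq_condExp_of_forall_setIntegral_eq hm hint
    (fun s _ _ => (hUV.integrable_integral_right hU' hV hf hint).integrableOn) ?_
    (hsm.measurable.comp hU).stronglyMeasurable.aestronglyMeasurable
  intro s hs _
  have hs' := hm s hs
  have hU1 : Measurable[m] fun ω => (s.indicator (fun _ => (1 : ℝ)) ω, U ω) :=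
    (measurable_const.indicator hs).prodMk hU
  have hind1 : IndepFun (fun ω => (s.indicator (fun _ => (1 : ℝ)) ω, U ω)) V P :=
    indep_of_indep_of_le_left hind hU1.comap_le
  have key := hind1.integral_comp_prod (hU1.mono hm le_rfl) hV
    (f := fun z : (ℝ × α) × β => z.1.1 * f (z.1.2, z.2)) (by fun_prop) (by
      refine (hint.indicator hs').congr (Eventually.of_forall fun ω => ?_)
      by_cases h : ω ∈ s <;> simp [h])
  rw [← integral_indicator hs', ← integral_indicator hs']
  have e1 : ∀ ω, s.indicator (fun ω => ∫ v, f (U ω, v) ∂(P.map V)) ω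
      = ∫ v, s.indicator (fun _ => (1 : ℝ)) ω * f (U ω, v) ∂(P.map V) := by
    intro ω; by_cases h : ω ∈ s <;> simp [h]
  have e2 : ∀ ω, s.indicator (fun ω => f (U ω, V ω)) ω
      = s.indicator (fun _ => (1 : ℝ)) ω * f (U ω, V ω) := by
    intro ω; by_cases h : ω ∈ s <;> simp [h]
  simp only [e1, e2]
  exact key.symm

/-- Adding constants to an independent family keeps it independent. -/
theorem iIndepFun_of_const_off_range {ι κ : Type*} {e : ι → κ} (he : Function.Injective e)
    {f : κ → Ω → ℝ} (hind : iIndepFun (fun i => f (e i)) P)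
    (hconst : ∀ k ∉ Set.range e, ∃ c, ∀ ω, f k ω = c) : iIndepFun f P := by
  classical
  rw [iIndepFun_iff_measure_inter_preimage_eq_mul] at hind ⊢
  intro S sets hsets
  by_cases hbad : ∃ k ∈ S, k ∉ Set.range e ∧ f k ⁻¹' sets k = ∅
  · obtain ⟨k, hkS, -, hk⟩ := hbad
    have h0 : ⋂ i ∈ S, f i ⁻¹' sets i = ∅ := by
      refine Set.subset_empty_iff.1 ?_
      rw [← hk]
      exact Set.biInter_subset_of_mem (t := fun i => f i ⁻¹' sets i) hkS
    rw [h0, measure_empty, Finset.prod_eq_zero hkS (by rw [hk, measure_empty])]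
  · have huniv : ∀ k ∈ S, k ∉ Set.range e → f k ⁻¹' sets k = Set.univ := by
      intro k hk hke
      obtain ⟨c, hc⟩ := hconst k hke
      have hne : f k ⁻¹' sets k ≠ ∅ := fun h => hbad ⟨k, hk, hke, h⟩
      obtain ⟨ω, hω⟩ := Set.nonempty_iff_ne_empty.2 hne
      refine Set.eq_univ_of_forall fun ω' => ?_
      simp only [Set.mem_preimage, hc] at hω ⊢
      exact hω
    have h1 := hind (S.preimage e he.injOn) (sets := fun i => sets (e i))
      (fun i hi => hsets _ (Finset.mem_preimage.1 hi))
    have h2 : ⋂ i ∈ S, f i ⁻¹' sets i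
        = ⋂ i ∈ S.preimage e he.injOn, f (e i) ⁻¹' sets (e i) := by
      ext ω
      simp only [Set.mem_iInter, Finset.mem_preimage]
      refine ⟨fun h i hi => h _ hi, fun h k hk => ?_⟩
      by_cases hke : k ∈ Set.range e
      · obtain ⟨i, rfl⟩ := hke
        exact h i hk
      · rw [huniv k hk hke]; trivial
    rw [h2, h1, Finset.prod_preimage e S he.injOn (fun k => P (f k ⁻¹' sets k))]
    intro k hk hke
    rw [huniv k hk hke, measure_univ]

end Independence

/-! ### Truncated second moments of sums of independent variables -/

section FourthMoment

variable {Ω : Type*} [MeasurableSpace Ω] {P : Measure Ω} [IsProbabilityMeasure P]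

theorem integrable_of_abs_le {f : Ω → ℝ} (hf : Measurable f) {c : ℝ} (h : ∀ ω, |f ω| ≤ c) :
    Integrable f P :=
  (integrable_const c).mono' hf.aestronglyMeasurable (Eventually.of_forall h)

/-- Second and fourth moment of a sum of independent, centred, bounded variables. -/
theorem moments_sum_of_iIndepFun {ι : Type*} [DecidableEq ι] {Y : ι → Ω → ℝ} (hind : iIndepFun Y P)
    (hY : ∀ j, Measurable (Y j)) {c v : ℝ} (s : Finset ι) (hc : ∀ j ∈ s, ∀ ω, |Y j ω| ≤ c)
    (hv0 : 0 ≤ v) (hmean : ∀ j ∈ s, ∫ ω, Y j ω ∂P = 0) (hvar : ∀ j ∈ s, ∫ ω, Y j ω ^ 2 ∂P ≤ v) :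
    ∫ ω, (∑ j ∈ s, Y j ω) ∂P = 0 ∧ ∫ ω, (∑ j ∈ s, Y j ω) ^ 2 ∂P ≤ s.card * v ∧
      ∫ ω, (∑ j ∈ s, Y j ω) ^ 4 ∂P ≤ 3 * s.card ^ 2 * v ^ 2 + s.card * (c ^ 2 * v) := by
  induction s using Finset.induction_on with
  | empty => simp
  | insert a s ha ih =>
    obtain ⟨ih1, ih2, ih4⟩ := ih (fun j hj => hc j (Finset.mem_insert_of_mem hj))
      (fun j hj => hmean j (Finset.mem_insert_of_mem hj))
      (fun j hj => hvar j (Finset.mem_insert_of_mem hj))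
    set S : Ω → ℝ := fun ω => ∑ j ∈ s, Y j ω with hS
    have hSm : Measurable S := Finset.measurable_sum _ fun j _ => hY j
    have hSY : IndepFun S (Y a) P := by
      have := hind.indepFun_finsetSum_of_notMem hY ha
      convert this using 1
      ext ω; simp [hS]
    have hca := hc a (Finset.mem_insert_self a s)
    have hSb : ∀ ω, |S ω| ≤ s.card * c := fun ω => by
      refine (Finset.abs_sum_le_sum_abs _ _).trans ?_
      refine (Finset.sum_le_card_nsmul _ _ c fun j hj =>
        hc j (Finset.mem_insert_of_mem hj) ω).trans (by simp)
    -- mixed moments factorize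
    have hmix : ∀ k l : ℕ, ∫ ω, S ω ^ k * Y a ω ^ l ∂P
        = (∫ ω, S ω ^ k ∂P) * ∫ ω, Y a ω ^ l ∂P := fun k l =>
      (hSY.comp (measurable_id.pow_const k)
        (measurable_id.pow_const l)).integral_fun_mul_eq_mul_integral
        (hSm.pow_const k).aestronglyMeasurable ((hY a).pow_const l).aestronglyMeasurable
    have hint : ∀ k l : ℕ, Integrable (fun ω => S ω ^ k * Y a ω ^ l) P := fun k l => by
      refine integrable_of_abs_le ((hSm.pow_const k).mul ((hY a).pow_const l))
        (c := (s.card * c) ^ k * c ^ l) fun ω => ?_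
      rw [abs_mul, abs_pow, abs_pow]
      have := hSb ω
      have := hca ω
      have := (abs_nonneg _).trans (hSb ω)
      gcongr
    have hYm := hmean a (Finset.mem_insert_self a s)
    have hYv := hvar a (Finset.mem_insert_self a s)
    have hY0 : 0 ≤ ∫ ω, Y a ω ^ 2 ∂P := integral_nonneg fun _ => sq_nonneg _
    have hY4 : ∫ ω, Y a ω ^ 4 ∂P ≤ c ^ 2 * v := by
      calc ∫ ω, Y a ω ^ 4 ∂P ≤ ∫ ω, c ^ 2 * Y a ω ^ 2 ∂P := by
            refine integral_mono (by simpa using hint 0 4)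
              (by simpa using (hint 0 2).const_mul (c ^ 2)) fun ω => ?_
            have h1 : Y a ω ^ 2 ≤ c ^ 2 :=
              sq_le_sq' (neg_le_of_abs_le (hca ω)) (le_of_abs_le (hca ω))
            nlinarith [sq_nonneg (Y a ω)]
        _ ≤ c ^ 2 * v := by rw [integral_const_mul]; gcongr
    have hS0 : 0 ≤ ∫ ω, S ω ^ 2 ∂P := integral_nonneg fun _ => sq_nonneg _
    have hi := fun k => by simpa using hint k 0
    have hj := fun l => by simpa using hint 0 l
    simp only [Finset.sum_insert ha, Finset.card_insert_of_notMem ha]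
    refine ⟨?_, ?_, ?_⟩
    · rw [integral_add (by simpa using hj 1) (by simpa using hi 1), hYm, ih1, add_zero]
    · have e : ∀ ω, (Y a ω + S ω) ^ 2 = Y a ω ^ 2 + 2 * (S ω ^ 1 * Y a ω ^ 1) + S ω ^ 2 :=
        fun ω => by ring
      change ∫ ω, (Y a ω + S ω) ^ 2 ∂P ≤ _
      simp_rw [e]
      rw [integral_add (by fun_prop) (hi 2), integral_add (hj 2) (by fun_prop), integral_const_mul,
        hmix]
      simp only [pow_one, hYm, mul_zero, add_zero]
      push_cast
      linarith
    · have e : ∀ ω, (Y a ω + S ω) ^ 4 = S ω ^ 4 + 4 * (S ω ^ 3 * Y a ω ^ 1)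
          + 6 * (S ω ^ 2 * Y a ω ^ 2) + 4 * (S ω ^ 1 * Y a ω ^ 3) + Y a ω ^ 4 :=
        fun ω => by ring
      change ∫ ω, (Y a ω + S ω) ^ 4 ∂P ≤ _
      simp_rw [e]
      rw [integral_add (by fun_prop) (hj 4), integral_add (by fun_prop) (by fun_prop),
        integral_add (by fun_prop) (by fun_prop), integral_add (hi 4) (by fun_prop)]
      simp only [integral_const_mul, hmix]
      have ih1' : ∫ ω, S ω ∂P = 0 := ih1
      have ih2' : ∫ ω, S ω ^ 2 ∂P ≤ s.card * v := ih2
      have ih4' : ∫ ω, S ω ^ 4 ∂P ≤ 3 * s.card ^ 2 * v ^ 2 + s.card * (c ^ 2 * v) := ih4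
      simp only [pow_one, hYm, ih1', mul_zero, zero_mul, add_zero]
      have h6 : (∫ ω, S ω ^ 2 ∂P) * ∫ ω, Y a ω ^ 2 ∂P ≤ (s.card * v) * v := by gcongr
      push_cast
      nlinarith [sq_nonneg v]

theorem sq_indicator_add_le (a b c : ℝ) :
    (if 2 * c ≤ |a + b| then (a + b) ^ 2 else 0)
      ≤ 4 * (if c ≤ |a| then a ^ 2 else 0) + 4 * (if c ≤ |b| then b ^ 2 else 0) := by
  have hab := abs_add_le a b
  have ha : 0 ≤ (if c ≤ |a| then a ^ 2 else 0) := by positivity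
  have hb : 0 ≤ (if c ≤ |b| then b ^ 2 else 0) := by positivity
  by_cases h : 2 * c ≤ |a + b|
  · rw [if_pos h]
    rcases le_total |a| |b| with h' | h'
    · rw [if_pos (show c ≤ |b| by linarith)]
      nlinarith [sq_le_sq.2 h', sq_nonneg (a - b)]
    · rw [if_pos (show c ≤ |a| by linarith)]
      nlinarith [sq_le_sq.2 h', sq_nonneg (a - b)]
  · rw [if_neg h]
    linarith

theorem integral_sq_sub_le {f : Ω → ℝ} (hf : MemLp f 2 P) :
    ∫ ω, (f ω - ∫ ω', f ω' ∂P) ^ 2 ∂P ≤ ∫ ω, f ω ^ 2 ∂P := by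
  have h := variance_le_expectation_sq (X := f) (μ := P) hf.1
  rw [variance_eq_integral hf.1.aemeasurable] at h
  simpa using h

/-- Lindeberg functional of a sum of independent centred square integrable variables, bounded by
truncating at `τ`: the recentred small parts have a fourth moment, the large parts a small second
moment.  Above the level `σ` of the common variance bound `v`, the second moment is used for the
small parts as well. -/
theorem integral_sq_sum_indicator_le {ι : Type*} [DecidableEq ι] {y : ι → Ω → ℝ}
    (hind : iIndepFun y P)
    (hy : ∀ j, Measurable (y j)) (s : Finset ι) (hL2 : ∀ j ∈ s, MemLp (y j) 2 P)
    (hmean : ∀ j ∈ s, ∫ ω, y j ω ∂P = 0) {v r τ σ c N : ℝ} (hτ : 0 ≤ τ) (hc : 0 < c)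
    (hN : (s.card : ℝ) ≤ N) (hvar : ∀ j ∈ s, ∫ ω, y j ω ^ 2 ∂P ≤ v) (hv0 : 0 ≤ v)
    (hr0 : 0 ≤ r) (hσ : 0 ≤ σ)
    (hr : ∀ j ∈ s, ∫ ω, (if τ ≤ |y j ω| then y j ω ^ 2 else 0) ∂P ≤ r) :
    ∫ ω, (if 2 * c ≤ |∑ j ∈ s, y j ω| then (∑ j ∈ s, y j ω) ^ 2 else 0) ∂P
      ≤ 4 * ((4 * τ ^ 2 + 3 * N * σ) / c ^ 2 * (N * v) + N * (if σ ≤ v then v else 0) + N * r) := by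
  have hN0 : 0 ≤ N := (Nat.cast_nonneg _).trans hN
  -- truncations as functions on the line
  let φ : ℝ → ℝ := fun x => if τ ≤ |x| then 0 else x
  let ψ : ℝ → ℝ := fun x => if τ ≤ |x| then x else 0
  have hmset : MeasurableSet {x : ℝ | τ ≤ |x|} :=
    measurableSet_le measurable_const measurable_id.abs
  have hφm : Measurable φ := Measurable.ite hmset measurable_const measurable_id
  have hψm : Measurable ψ := Measurable.ite hmset measurable_id measurable_const
  have hφψ : ∀ x, φ x + ψ x = x := fun x => by by_cases h : τ ≤ |x| <;> simp [φ, ψ, h]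
  have hφb : ∀ x, |φ x| ≤ τ := fun x => by
    by_cases h : τ ≤ |x|
    · simpa [φ, h] using hτ
    · simpa [φ, h] using (not_le.1 h).le
  have hφsq : ∀ x, φ x ^ 2 ≤ x ^ 2 := fun x => by
    by_cases h : τ ≤ |x| <;> simp [φ, h, sq_nonneg]
  have hψsq : ∀ x, ψ x ^ 2 = if τ ≤ |x| then x ^ 2 else 0 := fun x => by
    by_cases h : τ ≤ |x| <;> simp [ψ, h]
  have hψsq' : ∀ x, ψ x ^ 2 ≤ x ^ 2 := fun x => by
    by_cases h : τ ≤ |x| <;> simp [ψ, h, sq_nonneg]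
  have hφL : ∀ j ∈ s, MemLp (fun ω => φ (y j ω)) 2 P := fun j hj =>
    memLp_two_of_sq_le (hφm.comp (hy j)).aestronglyMeasurable (hL2 j hj).integrable_sq
      (Eventually.of_forall fun ω => hφsq _)
  have hψL : ∀ j ∈ s, MemLp (fun ω => ψ (y j ω)) 2 P := fun j hj =>
    memLp_two_of_sq_le (hψm.comp (hy j)).aestronglyMeasurable (hL2 j hj).integrable_sq
      (Eventually.of_forall fun ω => hψsq' _)
  let m : ι → ℝ := fun j => ∫ ω, φ (y j ω) ∂P
  have hm' : ∀ j ∈ s, ∫ ω, ψ (y j ω) ∂P = - m j := fun j hj => by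
    have h1 := integral_add ((hφL j hj).integrable one_le_two) ((hψL j hj).integrable one_le_two)
    simp only [hφψ, hmean j hj] at h1
    simp only [m]; linarith
  have hmb : ∀ j, |m j| ≤ τ := fun j => by
    have := norm_integral_le_of_norm_le_const (μ := P) (f := fun ω => φ (y j ω)) (C := τ)
      (Eventually.of_forall fun ω => hφb _)
    simpa using this
  let Y : ι → Ω → ℝ := fun j ω => φ (y j ω) - m j
  let Y' : ι → Ω → ℝ := fun j ω => ψ (y j ω) + m j
  have hYind : iIndepFun Y P := hind.comp (fun j x => φ x - m j) fun j => hφm.sub_const _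
  have hY'ind : iIndepFun Y' P := hind.comp (fun j x => ψ x + m j) fun j => hψm.add_const _
  have hYm : ∀ j, Measurable (Y j) := fun j => (hφm.comp (hy j)).sub_const _
  have hY'L : ∀ j ∈ s, MemLp (Y' j) 2 P := fun j hj => (hψL j hj).add (memLp_const _)
  have hYb : ∀ j ∈ s, ∀ ω, |Y j ω| ≤ 2 * τ := fun j _ ω => by
    have := abs_sub (φ (y j ω)) (m j)
    have := hφb (y j ω)
    have := hmb j
    simp only [Y]; linarith
  have hYmean : ∀ j ∈ s, ∫ ω, Y j ω ∂P = 0 := fun j hj => by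
    simp only [Y]
    rw [integral_sub ((hφL j hj).integrable one_le_two) (integrable_const _)]
    simp [m]
  have hY'mean : ∀ j ∈ s, ∫ ω, Y' j ω ∂P = 0 := fun j hj => by
    simp only [Y']
    rw [integral_add ((hψL j hj).integrable one_le_two) (integrable_const _), hm' j hj]
    simp
  have hYvar : ∀ j ∈ s, ∫ ω, Y j ω ^ 2 ∂P ≤ v := fun j hj =>
    (integral_sq_sub_le (hφL j hj)).trans ((integral_mono (hφL j hj).integrable_sq
      (hL2 j hj).integrable_sq fun ω => hφsq _).trans (hvar j hj))
  have hY'var : ∀ j ∈ s, ∫ ω, Y' j ω ^ 2 ∂P ≤ r := fun j hj => by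
    have h1 := integral_sq_sub_le (hψL j hj)
    rw [hm' j hj] at h1
    simp only [sub_neg_eq_add, hψsq] at h1
    exact h1.trans (hr j hj)
  obtain ⟨-, h2, h4⟩ := moments_sum_of_iIndepFun hYind hYm s hYb hv0 hYmean hYvar
  set S : Ω → ℝ := fun ω => ∑ j ∈ s, Y j ω with hS
  set S' : Ω → ℝ := fun ω => ∑ j ∈ s, Y' j ω with hS'
  have hSS' : ∀ ω, ∑ j ∈ s, y j ω = S ω + S' ω := fun ω => by
    simp only [hS, hS', ← Finset.sum_add_distrib]
    refine Finset.sum_congr rfl fun j _ => ?_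
    simp only [Y, Y']
    linarith [hφψ (y j ω)]
  have hSm : Measurable S := Finset.measurable_sum _ fun j _ => hYm j
  have hSb : ∀ ω, |S ω| ≤ s.card * (2 * τ) := fun ω =>
    (Finset.abs_sum_le_sum_abs _ _).trans
      ((Finset.sum_le_card_nsmul _ _ _ fun j hj => hYb j hj ω).trans (by simp))
  have hSi : ∀ k : ℕ, Integrable (fun ω => S ω ^ k) P := fun k =>
    integrable_of_abs_le (hSm.pow_const k) (c := (s.card * (2 * τ)) ^ k) fun ω => by
      rw [abs_pow]; exact pow_le_pow_left₀ (abs_nonneg _) (hSb ω) k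
  have hS'2 : ∫ ω, S' ω ^ 2 ∂P ≤ N * r := by
    have horth : ∀ i ∈ s, ∀ j ∈ s, i ≠ j → ∫ ω, Y' i ω * Y' j ω ∂P = 0 := fun i hi j hj hij => by
      rw [(hY'ind.indepFun hij).integral_fun_mul_eq_mul_integral (hY'L i hi).1 (hY'L j hj).1,
        hY'mean i hi, zero_mul]
    rw [integral_sq_sum_of_orthogonal s hY'L horth]
    refine (Finset.sum_le_card_nsmul _ _ _ hY'var).trans ?_
    rw [nsmul_eq_mul]; gcongr
  have hS'i : Integrable (fun ω => S' ω ^ 2) P := (memLp_finsetSum s hY'L).integrable_sq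
  have hSiI : Integrable (fun ω => if c ≤ |S ω| then S ω ^ 2 else 0) P := by
    refine (hSi 2).mono' (Measurable.ite (measurableSet_le measurable_const hSm.abs)
      (hSm.pow_const 2) measurable_const).aestronglyMeasurable (Eventually.of_forall fun ω => ?_)
    rw [Real.norm_eq_abs]
    split_ifs
    · rw [abs_of_nonneg (sq_nonneg _)]
    · simpa using sq_nonneg _
  have hmain : ∫ ω, (if c ≤ |S ω| then S ω ^ 2 else 0) ∂P
      ≤ (4 * τ ^ 2 + 3 * N * σ) / c ^ 2 * (N * v) + N * (if σ ≤ v then v else 0) := by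
    by_cases hσv : σ ≤ v
    · rw [if_pos hσv]
      have : ∫ ω, (if c ≤ |S ω| then S ω ^ 2 else 0) ∂P ≤ ∫ ω, S ω ^ 2 ∂P :=
        integral_mono hSiI (hSi 2) fun ω => by dsimp only; split_ifs <;> simp [sq_nonneg]
      have h5 : (s.card : ℝ) * v ≤ N * v := by gcongr
      have h6 : 0 ≤ (4 * τ ^ 2 + 3 * N * σ) / c ^ 2 * (N * v) := by positivity
      linarith
    · rw [if_neg hσv, mul_zero, add_zero]
      calc ∫ ω, (if c ≤ |S ω| then S ω ^ 2 else 0) ∂P ≤ ∫ ω, S ω ^ 4 / c ^ 2 ∂P := by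
            refine integral_mono hSiI ((hSi 4).div_const _) fun ω => ?_
            dsimp only
            split_ifs with h
            · rw [le_div_iff₀ (by positivity)]
              have : c ^ 2 ≤ S ω ^ 2 := by
                rw [← sq_abs (S ω)]; exact pow_le_pow_left₀ hc.le h 2
              nlinarith [sq_nonneg (S ω)]
            · positivity
        _ = (∫ ω, S ω ^ 4 ∂P) / c ^ 2 := integral_div _ _
        _ ≤ ((4 * τ ^ 2 + 3 * N * σ) * (N * v)) / c ^ 2 := by
            gcongr
            refine h4.trans ?_
            have hvσ : v ≤ σ := (not_le.1 hσv).le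
            have a1 : 3 * (s.card : ℝ) ^ 2 * v ^ 2 ≤ 3 * N ^ 2 * (σ * v) := by
              rw [sq v]; gcongr
            have a2 : (s.card : ℝ) * ((2 * τ) ^ 2 * v) ≤ N * ((2 * τ) ^ 2 * v) := by gcongr
            nlinarith
        _ = _ := by ring
  calc ∫ ω, (if 2 * c ≤ |∑ j ∈ s, y j ω| then (∑ j ∈ s, y j ω) ^ 2 else 0) ∂P
      ≤ ∫ ω, (4 * (if c ≤ |S ω| then S ω ^ 2 else 0) + 4 * S' ω ^ 2) ∂P := by
        have hi := (hSiI.const_mul 4).add (hS'i.const_mul 4)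
        refine integral_mono_of_nonneg (Eventually.of_forall fun ω => ?_) hi
          (Eventually.of_forall fun ω => ?_)
        · dsimp only; split_ifs <;> simp [sq_nonneg]
        · dsimp only
          rw [hSS' ω]
          refine (sq_indicator_add_le _ _ c).trans (add_le_add le_rfl ?_)
          split_ifs <;> simp [sq_nonneg]
    _ = 4 * (∫ ω, (if c ≤ |S ω| then S ω ^ 2 else 0) ∂P) + 4 * ∫ ω, S' ω ^ 2 ∂P := by
        rw [integral_add (hSiI.const_mul 4) (hS'i.const_mul 4), integral_const_mul,
          integral_const_mul]
    _ ≤ _ := by linarith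

end FourthMoment

/-! ### The Hoeffding decomposition of a kernel -/

section Kernels

set_option linter.unusedSectionVars false

variable {α : Type*} [MeasurableSpace α]

/-- A symmetric centred kernel, square integrable for `μ ⊗ μ`, all of whose sections are square
integrable.  Demanding the latter for every section rather than almost every one makes the
projections of the kernel honest integrals at every point. -/
structure HoeffdingKernel (μ : Measure α) (k : α → α → ℝ) : Prop where
  measurable : Measurable (Function.uncurry k)
  symm : ∀ x y, k x y = k y x
  memLp_section : ∀ x, MemLp (k x) 2 μ
  memLp : MemLp (Function.uncurry k) 2 (μ.prod μ)
  centered : ∫ x, ∫ y, k x y ∂μ ∂μ = 0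

/-- The integral operator with kernel `k`. -/
noncomputable def kernelOp (μ : Measure α) (k : α → α → ℝ) (f : α → ℝ) (x : α) : ℝ :=
  ∫ y, k x y * f y ∂μ

/-- The first-order projection `x ↦ ∫ k(x, y) dμ(y)`. -/
noncomputable def proj (μ : Measure α) (k : α → α → ℝ) (x : α) : ℝ := ∫ y, k x y ∂μ

/-- The degenerate part `k(x, y) - proj k x - proj k y` of a centred kernel. -/
noncomputable def degen (μ : Measure α) (k : α → α → ℝ) (x y : α) : ℝ :=
  k x y - proj μ k x - proj μ k y

/-- The iterated kernel `(y, z) ↦ ∫ k(x, y) k(x, z) dμ(x)`. -/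
noncomputable def gram (μ : Measure α) (k : α → α → ℝ) (y z : α) : ℝ := ∫ x, k x y * k x z ∂μ

/-- The interaction `y ↦ ∫ proj k x · degen k (x, y) dμ(x)` between the two projections. -/
noncomputable def cross (μ : Measure α) (k : α → α → ℝ) (y : α) : ℝ :=
  ∫ x, proj μ k x * degen μ k x y ∂μ

/-- The squared norm of the first-order projection. -/
noncomputable def projSq (μ : Measure α) (k : α → α → ℝ) : ℝ := ∫ x, proj μ k x ^ 2 ∂μ

/-- The squared norm of a kernel in `L²(μ ⊗ μ)`. -/
noncomputable def kernelSq (μ : Measure α) (k : α → α → ℝ) : ℝ := ∫ z, k z.1 z.2 ^ 2 ∂(μ.prod μ)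

theorem kernelSq_nonneg (μ : Measure α) (k : α → α → ℝ) : 0 ≤ kernelSq μ k :=
  integral_nonneg fun _ => sq_nonneg _

theorem projSq_nonneg (μ : Measure α) (k : α → α → ℝ) : 0 ≤ projSq μ k :=
  integral_nonneg fun _ => sq_nonneg _

theorem gram_self_nonneg (μ : Measure α) (k : α → α → ℝ) (y : α) : 0 ≤ gram μ k y y :=
  integral_nonneg fun _ => mul_self_nonneg _

theorem gram_symm (μ : Measure α) (k : α → α → ℝ) (y z : α) : gram μ k y z = gram μ k z y := by
  simp only [gram, mul_comm]

theorem degen_symm {μ : Measure α} {k : α → α → ℝ} (h : ∀ x y, k x y = k y x) (x y : α) :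
    degen μ k x y = degen μ k y x := by
  simp only [degen, h x y]; ring

variable {μ : Measure α} [IsProbabilityMeasure μ]

/-- A symmetric square integrable centred kernel is almost everywhere equal to one with square
integrable sections: set it to zero on the null set of bad rows and columns. -/
theorem exists_hoeffdingKernel_ae_eq {h : α → α → ℝ} (hm : Measurable (Function.uncurry h))
    (hs : ∀ x y, h x y = h y x) (hL : MemLp (Function.uncurry h) 2 (μ.prod μ))
    (hc : ∫ z, Function.uncurry h z ∂(μ.prod μ) = 0) :
    ∃ k, HoeffdingKernel μ k ∧ Function.uncurry k =ᵐ[μ.prod μ] Function.uncurry h := by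
  classical
  set N : Set α := {x | ∫⁻ y, ‖h x y ^ 2‖ₑ ∂μ = ⊤} with hN
  have hmN : MeasurableSet N := by
    refine measurableSet_eq_fun (Measurable.lintegral_prod_right' (f := fun z : α × α =>
      ‖Function.uncurry h z ^ 2‖ₑ) (hm.pow_const 2).enorm) measurable_const
  have hsec : ∀ x, Measurable (h x) := fun x => hm.comp measurable_prodMk_left
  have hsq : Integrable (fun z : α × α => h z.1 z.2 ^ 2) (μ.prod μ) := hL.integrable_sq
  have hgood : ∀ x ∉ N, MemLp (h x) 2 μ := fun x hx => by
    rw [memLp_two_iff_integrable_sq (hsec x).aestronglyMeasurable]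
    exact ⟨((hsec x).pow_const 2).aestronglyMeasurable, lt_top_iff_ne_top.2 hx⟩
  have hN0 : ∀ᵐ x ∂μ, x ∉ N := by
    filter_upwards [hsq.prod_right_ae] with x hx
    exact hx.2.ne
  let k : α → α → ℝ := fun x y => if x ∈ N ∨ y ∈ N then 0 else h x y
  have hkm : Measurable (Function.uncurry k) :=
    Measurable.ite ((hmN.preimage measurable_fst).union (hmN.preimage measurable_snd))
      measurable_const hm
  have hkh : Function.uncurry k =ᵐ[μ.prod μ] Function.uncurry h := by
    have h1 : ∀ᵐ z ∂(μ.prod μ), z.1 ∉ N := Measure.quasiMeasurePreserving_fst.ae hN0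
    have h2 : ∀ᵐ z ∂(μ.prod μ), z.2 ∉ N := Measure.quasiMeasurePreserving_snd.ae hN0
    filter_upwards [h1, h2] with z hz1 hz2
    simp [Function.uncurry, k, hz1, hz2]
  have hkL : MemLp (Function.uncurry k) 2 (μ.prod μ) := (memLp_congr_ae hkh).2 hL
  refine ⟨k, ⟨hkm, fun x y => ?_, fun x => ?_, hkL, ?_⟩, hkh⟩
  · simp only [k, or_comm, hs x y]
  · by_cases hx : x ∈ N
    · have : k x = fun _ => 0 := by ext y; simp [k, hx]
      rw [this]; exact memLp_const 0
    · refine (hgood x hx).mono (hkm.comp measurable_prodMk_left).aestronglyMeasurable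
        (Eventually.of_forall fun y => ?_)
      by_cases hy : y ∈ N <;> simp [k, hx, hy]
  · have := integral_prod _ (hkL.integrable one_le_two)
    rw [integral_congr_ae hkh, hc] at this
    exact this.symm

namespace HoeffdingKernel

variable {k : α → α → ℝ}

theorem measurable_section (hk : HoeffdingKernel μ k) (x : α) : Measurable (k x) :=
  hk.measurable.comp measurable_prodMk_left

theorem memLp_section' (hk : HoeffdingKernel μ k) (y : α) : MemLp (fun x => k x y) 2 μ := by
  simpa only [hk.symm] using hk.memLp_section y

theorem integrable_sq (hk : HoeffdingKernel μ k) :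
    Integrable (fun z : α × α => k z.1 z.2 ^ 2) (μ.prod μ) := hk.memLp.integrable_sq

theorem measurable_kernelOp (hk : HoeffdingKernel μ k) {f : α → ℝ} (hf : Measurable f) :
    Measurable (kernelOp μ k f) := by
  have : Measurable fun z : α × α => k z.1 z.2 * f z.2 :=
    hk.measurable.mul (hf.comp measurable_snd)
  exact (this.stronglyMeasurable.integral_prod_right').measurable

theorem kernelOp_sq_le (hk : HoeffdingKernel μ k) {f : α → ℝ} (hf : MemLp f 2 μ) (x : α) :
    kernelOp μ k f x ^ 2 ≤ (∫ y, k x y ^ 2 ∂μ) * ∫ y, f y ^ 2 ∂μ := by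
  refine le_trans ?_ (sq_integral_abs_mul_le (hk.memLp_section x) hf)
  rw [← sq_abs]
  exact pow_le_pow_left₀ (abs_nonneg _) abs_integral_le_integral_abs 2

theorem memLp_kernelOp (hk : HoeffdingKernel μ k) {f : α → ℝ} (hfm : Measurable f)
    (hf : MemLp f 2 μ) : MemLp (kernelOp μ k f) 2 μ :=
  memLp_two_of_sq_le (hk.measurable_kernelOp hfm).aestronglyMeasurable
    (hk.integrable_sq.integral_prod_left.mul_const (∫ y, f y ^ 2 ∂μ))
    (Eventually.of_forall fun x => hk.kernelOp_sq_le hf x)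

theorem memLp_mul_prod {f g : α → ℝ} (hf : MemLp f 2 μ) (hg : MemLp g 2 μ) :
    MemLp (fun z : α × α => f z.1 * g z.2) 2 (μ.prod μ) := by
  refine (memLp_two_iff_integrable_sq ((hf.comp_fst μ).1.mul (hg.comp_snd μ).1)).2 ?_
  simpa only [Pi.mul_apply, mul_pow] using hf.integrable_sq.mul_prod hg.integrable_sq

/-- The integral operator of a symmetric kernel is self-adjoint. -/
theorem integral_mul_kernelOp (hk : HoeffdingKernel μ k) {f g : α → ℝ}
    (hf : MemLp f 2 μ) (hg : MemLp g 2 μ) :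
    ∫ x, f x * kernelOp μ k g x ∂μ = ∫ x, g x * kernelOp μ k f x ∂μ := by
  have hint : Integrable (Function.uncurry fun x y => f x * (k x y * g y)) (μ.prod μ) := by
    refine ((memLp_mul_prod hf hg).integrable_mul hk.memLp).congr (Eventually.of_forall fun z => ?_)
    simp only [Pi.mul_apply, Function.uncurry]; ring
  simp only [kernelOp, ← integral_const_mul]
  rw [integral_integral_swap hint]
  refine integral_congr_ae (Eventually.of_forall fun y =>
    integral_congr_ae (Eventually.of_forall fun x => ?_))
  simp only [hk.symm x y]; ring

theorem proj_eq_kernelOp (k : α → α → ℝ) : proj μ k = kernelOp μ k fun _ => 1 := by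
  ext x; simp [proj, kernelOp]

theorem measurable_proj (hk : HoeffdingKernel μ k) : Measurable (proj μ k) := by
  rw [proj_eq_kernelOp]; exact hk.measurable_kernelOp measurable_const

theorem memLp_proj (hk : HoeffdingKernel μ k) : MemLp (proj μ k) 2 μ := by
  rw [proj_eq_kernelOp]; exact hk.memLp_kernelOp measurable_const (memLp_const 1)

theorem integral_proj (hk : HoeffdingKernel μ k) : ∫ x, proj μ k x ∂μ = 0 := hk.centered

theorem measurable_degen (hk : HoeffdingKernel μ k) :
    Measurable (Function.uncurry (degen μ k)) :=
  (hk.measurable.sub (hk.measurable_proj.comp measurable_fst)).sub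
    (hk.measurable_proj.comp measurable_snd)

theorem integral_degen (hk : HoeffdingKernel μ k) (x : α) : ∫ y, degen μ k x y ∂μ = 0 := by
  have h1 := (hk.memLp_section x).integrable one_le_two
  have h2 := hk.memLp_proj.integrable one_le_two
  simp only [degen]
  rw [integral_sub (by fun_prop) h2, integral_sub h1 (integrable_const _),
    hk.integral_proj]
  simp [proj]

theorem integral_degen' (hk : HoeffdingKernel μ k) (y : α) : ∫ x, degen μ k x y ∂μ = 0 := by
  rw [← hk.integral_degen y]
  exact integral_congr_ae (Eventually.of_forall fun x => degen_symm hk.symm x y)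

theorem degenerate (hk : HoeffdingKernel μ k) : HoeffdingKernel μ (degen μ k) where
  measurable := hk.measurable_degen
  symm := degen_symm hk.symm
  memLp_section x := ((hk.memLp_section x).sub (memLp_const _)).sub hk.memLp_proj
  memLp := (hk.memLp.sub (hk.memLp_proj.comp_fst μ)).sub (hk.memLp_proj.comp_snd μ)
  centered := by simp [hk.integral_degen]

/-- Pythagoras for the Hoeffding decomposition. -/
theorem kernelSq_degen (hk : HoeffdingKernel μ k) :
    kernelSq μ (degen μ k) = kernelSq μ k - 2 * projSq μ k := by
  have hg1 : MemLp (fun z : α × α => proj μ k z.1) 2 (μ.prod μ) := hk.memLp_proj.comp_fst μ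
  have hg2 : MemLp (fun z : α × α => proj μ k z.2) 2 (μ.prod μ) := hk.memLp_proj.comp_snd μ
  have hd : MemLp (fun z : α × α => degen μ k z.1 z.2) 2 (μ.prod μ) := hk.degenerate.memLp
  have e : ∀ z : α × α, k z.1 z.2 ^ 2 = degen μ k z.1 z.2 ^ 2
      + (proj μ k z.1 ^ 2 + proj μ k z.2 ^ 2)
      + 2 * (degen μ k z.1 z.2 * proj μ k z.1 + degen μ k z.1 z.2 * proj μ k z.2
        + proj μ k z.1 * proj μ k z.2) := fun z => by simp only [degen]; ring
  have i1 := hd.integrable_sq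
  have i2 := hg1.integrable_sq
  have i3 := hg2.integrable_sq
  have j1 : Integrable (fun z : α × α => degen μ k z.1 z.2 * proj μ k z.1) (μ.prod μ) :=
    hd.integrable_mul hg1
  have j2 : Integrable (fun z : α × α => degen μ k z.1 z.2 * proj μ k z.2) (μ.prod μ) :=
    hd.integrable_mul hg2
  have j3 : Integrable (fun z : α × α => proj μ k z.1 * proj μ k z.2) (μ.prod μ) :=
    hg1.integrable_mul hg2
  have z1 : ∫ z, degen μ k z.1 z.2 * proj μ k z.1 ∂(μ.prod μ) = 0 := by
    rw [integral_prod _ j1]; simp [integral_mul_const, hk.integral_degen]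
  have z2 : ∫ z, degen μ k z.1 z.2 * proj μ k z.2 ∂(μ.prod μ) = 0 := by
    rw [integral_prod_symm _ j2]; simp [integral_mul_const, hk.integral_degen']
  have z3 : ∫ z, proj μ k z.1 * proj μ k z.2 ∂(μ.prod μ) = 0 := by
    rw [integral_prod_mul, hk.integral_proj, zero_mul]
  have p1 : ∫ z, proj μ k z.1 ^ 2 ∂(μ.prod μ) = projSq μ k := by
    rw [integral_prod _ i2]; simp [projSq]
  have p2 : ∫ z, proj μ k z.2 ^ 2 ∂(μ.prod μ) = projSq μ k := by
    rw [integral_prod _ i3]; simp [projSq]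
  have : kernelSq μ k = kernelSq μ (degen μ k) + (projSq μ k + projSq μ k) + 2 * (0 + 0 + 0) := by
    unfold kernelSq
    simp_rw [e]
    rw [integral_add (by fun_prop) (by fun_prop), integral_add (by fun_prop) (by fun_prop),
      integral_add i2 i3, integral_const_mul, integral_add (by fun_prop) j3, integral_add j1 j2,
      z1, z2, z3, p1, p2]
  linarith

/-! ### The iterated kernel -/

theorem gram_eq_kernelOp (hk : HoeffdingKernel μ k) (y z : α) :
    gram μ k y z = kernelOp μ k (k y) z := by
  simp only [gram, kernelOp]
  refine integral_congr_ae (Eventually.of_forall fun x => ?_)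
  simp only [hk.symm x y, hk.symm x z]; ring

theorem measurable_gram (hk : HoeffdingKernel μ k) : Measurable (Function.uncurry (gram μ k)) := by
  have h1 : Measurable fun w : (α × α) × α => (w.2, w.1.1) := by fun_prop
  have h2 : Measurable fun w : (α × α) × α => (w.2, w.1.2) := by fun_prop
  have : Measurable fun w : (α × α) × α => k w.2 w.1.1 * k w.2 w.1.2 :=
    (hk.measurable.comp h1).mul (hk.measurable.comp h2)
  exact (this.stronglyMeasurable.integral_prod_right').measurable

theorem gram_sq_le (hk : HoeffdingKernel μ k) (y z : α) :
    gram μ k y z ^ 2 ≤ gram μ k y y * gram μ k z z := by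
  have := hk.kernelOp_sq_le (hk.memLp_section y) z
  rw [← hk.gram_eq_kernelOp] at this
  refine this.trans (le_of_eq ?_)
  simp only [gram, ← sq]
  rw [mul_comm]
  congr 1 <;> refine integral_congr_ae (Eventually.of_forall fun x => ?_) <;>
    simp only [hk.symm x _]

theorem gram_self (hk : HoeffdingKernel μ k) (y : α) : gram μ k y y = ∫ x, k y x ^ 2 ∂μ := by
  simp only [gram, ← sq, hk.symm _ y]

theorem integrable_gram_self (hk : HoeffdingKernel μ k) : Integrable (fun y => gram μ k y y) μ := by
  simp only [hk.gram_self]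
  exact hk.integrable_sq.integral_prod_left

theorem integral_gram_self (hk : HoeffdingKernel μ k) :
    ∫ y, gram μ k y y ∂μ = kernelSq μ k := by
  simp only [hk.gram_self, kernelSq]
  exact (integral_prod _ hk.integrable_sq).symm

theorem memLp_gram (hk : HoeffdingKernel μ k) :
    MemLp (Function.uncurry (gram μ k)) 2 (μ.prod μ) :=
  memLp_two_of_sq_le hk.measurable_gram.aestronglyMeasurable
    (hk.integrable_gram_self.mul_prod hk.integrable_gram_self)
    (Eventually.of_forall fun z => hk.gram_sq_le z.1 z.2)

theorem memLp_gram_section (hk : HoeffdingKernel μ k) (y : α) : MemLp (gram μ k y) 2 μ :=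
  memLp_two_of_sq_le (hk.measurable_gram.comp measurable_prodMk_left).aestronglyMeasurable
    (hk.integrable_gram_self.const_mul (gram μ k y y))
    (Eventually.of_forall fun z => hk.gram_sq_le y z)

theorem integral_gram_section (hk : HoeffdingKernel μ k) (y : α) :
    ∫ z, gram μ k y z ∂μ = kernelOp μ k (proj μ k) y := by
  have h := hk.integral_mul_kernelOp (f := fun _ => 1) (memLp_const 1) (hk.memLp_section y)
  simp only [one_mul, ← hk.gram_eq_kernelOp, ← proj_eq_kernelOp] at h
  exact h

theorem integral_gram_degen (hk : HoeffdingKernel μ k) (y : α) :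
    ∫ z, gram μ (degen μ k) y z ∂μ = 0 := by
  rw [hk.degenerate.integral_gram_section y]
  simp [kernelOp, proj, hk.integral_degen]

theorem integral_kernelOp_proj (hk : HoeffdingKernel μ k) :
    ∫ y, kernelOp μ k (proj μ k) y ∂μ = projSq μ k := by
  have h := hk.integral_mul_kernelOp (f := fun _ => 1) (memLp_const 1) hk.memLp_proj
  simp only [one_mul, ← proj_eq_kernelOp] at h
  rw [h]; simp only [projSq, sq]

theorem sq_kernelOp_proj_le (hk : HoeffdingKernel μ k) (y : α) :
    kernelOp μ k (proj μ k) y ^ 2 ≤ ∫ z, gram μ k y z ^ 2 ∂μ := by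
  rw [← hk.integral_gram_section]
  exact sq_integral_le (hk.memLp_gram_section y)

theorem integral_sq_kernelOp_proj_le (hk : HoeffdingKernel μ k) :
    ∫ y, kernelOp μ k (proj μ k) y ^ 2 ∂μ ≤ kernelSq μ (gram μ k) := by
  have hi : Integrable (fun z : α × α => gram μ k z.1 z.2 ^ 2) (μ.prod μ) :=
    hk.memLp_gram.integrable_sq
  rw [kernelSq, integral_prod _ hi]
  exact integral_mono (hk.memLp_kernelOp hk.measurable_proj hk.memLp_proj).integrable_sq
    hi.integral_prod_left fun y => hk.sq_kernelOp_proj_le y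

theorem sq_projSq_le (hk : HoeffdingKernel μ k) : projSq μ k ^ 2 ≤ kernelSq μ (gram μ k) := by
  rw [← hk.integral_kernelOp_proj]
  exact (sq_integral_le (hk.memLp_kernelOp hk.measurable_proj hk.memLp_proj)).trans
    hk.integral_sq_kernelOp_proj_le

theorem cross_eq (hk : HoeffdingKernel μ k) (y : α) :
    cross μ k y = kernelOp μ k (proj μ k) y - projSq μ k := by
  have i1 : Integrable (fun x => proj μ k x * k x y) μ :=
    hk.memLp_proj.integrable_mul (hk.memLp_section' y)
  have i2 : Integrable (fun x => proj μ k x ^ 2) μ := hk.memLp_proj.integrable_sq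
  have i3 : Integrable (fun x => proj μ k x * proj μ k y) μ :=
    (hk.memLp_proj.integrable one_le_two).mul_const _
  have e : ∀ x, proj μ k x * degen μ k x y
      = proj μ k x * k x y - proj μ k x ^ 2 - proj μ k x * proj μ k y := fun x => by
    simp only [degen]; ring
  simp only [cross, e]
  rw [integral_sub (by fun_prop) i3, integral_sub i1 i2, integral_mul_const, hk.integral_proj]
  simp only [kernelOp, projSq, mul_zero, sub_zero, hk.symm y, mul_comm]

/-- The iterated kernel of the degenerate part, in terms of the iterated kernel of `k`. -/
theorem gram_degen_eq (hk : HoeffdingKernel μ k) (y z : α) :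
    gram μ (degen μ k) y z = gram μ k y z - kernelOp μ k (proj μ k) y - kernelOp μ k (proj μ k) z
      + projSq μ k - proj μ k y * proj μ k z := by
  have hy := hk.memLp_section' y
  have hz := hk.memLp_section' z
  have hg := hk.memLp_proj
  have hd := hk.degenerate.memLp_section' z
  have i1 : Integrable (fun x => k x y * k x z) μ := hy.integrable_mul hz
  have i2 : Integrable (fun x => proj μ k x * k x y) μ := hg.integrable_mul hy
  have i3 : Integrable (fun x => k x y * proj μ k z) μ :=
    (hy.integrable one_le_two).mul_const _
  have i4 : Integrable (fun x => proj μ k x * degen μ k x z) μ := hg.integrable_mul hd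
  have i5 : Integrable (fun x => proj μ k y * degen μ k x z) μ :=
    (hd.integrable one_le_two).const_mul _
  have e : ∀ x, degen μ k x y * degen μ k x z
      = k x y * k x z - proj μ k x * k x y - k x y * proj μ k z
        - proj μ k x * degen μ k x z - proj μ k y * degen μ k x z := fun x => by
    simp only [degen]; ring
  have e2 : ∫ x, proj μ k x * k x y ∂μ = kernelOp μ k (proj μ k) y := by
    simp only [kernelOp, hk.symm y, mul_comm]
  have e3 : ∫ x, k x y ∂μ = proj μ k y := by simp only [proj, hk.symm y]
  have e4 := hk.cross_eq z
  rw [cross] at e4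
  simp only [gram, e]
  rw [integral_sub (by fun_prop) i5, integral_sub (by fun_prop) i4, integral_sub (by fun_prop) i3,
    integral_sub i1 i2, e2, integral_mul_const, integral_const_mul, hk.integral_degen', e3, e4]
  ring

/-- The Hilbert–Schmidt norm of the iterated kernel of the degenerate part is controlled by that
of the iterated kernel of `k` itself. -/
theorem kernelSq_gram_degen_le (hk : HoeffdingKernel μ k) :
    kernelSq μ (gram μ (degen μ k)) ≤ 25 * kernelSq μ (gram μ k) := by
  have hg := hk.memLp_proj
  have hw := hk.memLp_kernelOp hk.measurable_proj hk.memLp_proj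
  have i1 : Integrable (fun z : α × α => gram μ k z.1 z.2 ^ 2) (μ.prod μ) :=
    hk.memLp_gram.integrable_sq
  have i2 : Integrable (fun z : α × α => kernelOp μ k (proj μ k) z.1 ^ 2) (μ.prod μ) :=
    hw.integrable_sq.comp_fst μ
  have i3 : Integrable (fun z : α × α => kernelOp μ k (proj μ k) z.2 ^ 2) (μ.prod μ) :=
    hw.integrable_sq.comp_snd μ
  have i4 : Integrable (fun z : α × α => proj μ k z.1 ^ 2 * proj μ k z.2 ^ 2) (μ.prod μ) :=
    hg.integrable_sq.mul_prod hg.integrable_sq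
  have hK := hk.sq_projSq_le
  have hW := hk.integral_sq_kernelOp_proj_le
  calc kernelSq μ (gram μ (degen μ k))
      ≤ ∫ z : α × α, 5 * (gram μ k z.1 z.2 ^ 2 + kernelOp μ k (proj μ k) z.1 ^ 2
          + kernelOp μ k (proj μ k) z.2 ^ 2 + projSq μ k ^ 2
          + proj μ k z.1 ^ 2 * proj μ k z.2 ^ 2) ∂(μ.prod μ) := by
        refine integral_mono hk.degenerate.memLp_gram.integrable_sq (by fun_prop) fun z => ?_
        simp only [hk.gram_degen_eq]
        set a := gram μ k z.1 z.2
        set b := kernelOp μ k (proj μ k) z.1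
        set c := kernelOp μ k (proj μ k) z.2
        set d := projSq μ k
        rw [← mul_pow]
        set f := proj μ k z.1 * proj μ k z.2
        nlinarith [sq_nonneg (a + b), sq_nonneg (a + c), sq_nonneg (a - d), sq_nonneg (a + f),
          sq_nonneg (b - c), sq_nonneg (b + d), sq_nonneg (b - f), sq_nonneg (c + d),
          sq_nonneg (c - f), sq_nonneg (d + f)]
    _ = 5 * (kernelSq μ (gram μ k) + ∫ y, kernelOp μ k (proj μ k) y ^ 2 ∂μ
          + ∫ y, kernelOp μ k (proj μ k) y ^ 2 ∂μ + projSq μ k ^ 2 + projSq μ k * projSq μ k) := by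
        rw [integral_const_mul, integral_add (by fun_prop) i4,
          integral_add (by fun_prop) (integrable_const _), integral_add (by fun_prop) i3,
          integral_add i1 i2, integral_prod_mul (fun x => proj μ k x ^ 2) fun x => proj μ k x ^ 2,
          integral_prod _ i2, integral_prod _ i3]
        simp [kernelSq, projSq]
    _ ≤ _ := by nlinarith

theorem measurable_cross (hk : HoeffdingKernel μ k) : Measurable (cross μ k) := by
  have : cross μ k = fun y => kernelOp μ k (proj μ k) y - projSq μ k := funext hk.cross_eq
  rw [this]
  exact (hk.measurable_kernelOp hk.measurable_proj).sub_const _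

theorem memLp_cross (hk : HoeffdingKernel μ k) : MemLp (cross μ k) 2 μ := by
  have : cross μ k = fun y => kernelOp μ k (proj μ k) y - projSq μ k := funext hk.cross_eq
  rw [this]
  exact (hk.memLp_kernelOp hk.measurable_proj hk.memLp_proj).sub (memLp_const _)

theorem integral_cross (hk : HoeffdingKernel μ k) : ∫ y, cross μ k y ∂μ = 0 := by
  simp only [hk.cross_eq]
  rw [integral_sub ((hk.memLp_kernelOp hk.measurable_proj hk.memLp_proj).integrable one_le_two)
    (integrable_const _), hk.integral_kernelOp_proj]
  simp

/-- With `T` the integral operator of `k` and `g = proj k`, the interaction is `T g` minus its mean,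
so the claim is `‖T g‖² = ⟨g, T² g⟩ ≤ ‖T²‖ ‖g‖²` in Hilbert–Schmidt norm. -/
theorem sq_integral_sq_cross_le (hk : HoeffdingKernel μ k) :
    (∫ y, cross μ k y ^ 2 ∂μ) ^ 2 ≤ kernelSq μ (gram μ k) * projSq μ k ^ 2 := by
  have hg := hk.memLp_proj
  have hw := hk.memLp_kernelOp hk.measurable_proj hk.memLp_proj
  have h1 : ∫ y, cross μ k y ^ 2 ∂μ ≤ ∫ y, kernelOp μ k (proj μ k) y ^ 2 ∂μ := by
    simp only [hk.cross_eq]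
    rw [← hk.integral_kernelOp_proj]
    exact integral_sq_sub_le hw
  have h2 : ∀ x, kernelOp μ k (kernelOp μ k (proj μ k)) x = ∫ z, gram μ k x z * proj μ k z ∂μ := by
    intro x
    have := hk.integral_mul_kernelOp (hk.memLp_section x) hg
    simp only [← hk.gram_eq_kernelOp] at this
    rw [kernelOp, this]
    simp only [mul_comm]
  have h3 : ∫ y, kernelOp μ k (proj μ k) y ^ 2 ∂μ
      = ∫ z, gram μ k z.1 z.2 * (proj μ k z.1 * proj μ k z.2) ∂(μ.prod μ) := by
    have hint : Integrable (fun z : α × α =>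
        gram μ k z.1 z.2 * (proj μ k z.1 * proj μ k z.2)) (μ.prod μ) :=
      hk.memLp_gram.integrable_mul (memLp_mul_prod hg hg)
    have := hk.integral_mul_kernelOp hw hg
    simp only [← sq, h2] at this
    rw [this, integral_prod _ hint]
    simp only [← integral_const_mul]
    refine integral_congr_ae (Eventually.of_forall fun x =>
      integral_congr_ae (Eventually.of_forall fun y => ?_))
    simp only; ring
  have h4 := sq_integral_abs_mul_le hk.memLp_gram (memLp_mul_prod hg hg)
  have h5 : ∫ z : α × α, (proj μ k z.1 * proj μ k z.2) ^ 2 ∂(μ.prod μ) = projSq μ k ^ 2 := by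
    simp only [mul_pow]
    rw [integral_prod_mul (fun x => proj μ k x ^ 2) fun x => proj μ k x ^ 2, projSq, sq]
  rw [h5] at h4
  have h0 : 0 ≤ ∫ y, cross μ k y ^ 2 ∂μ := integral_nonneg fun _ => sq_nonneg _
  refine (pow_le_pow_left₀ h0 (h1.trans ?_) 2).trans h4
  rw [h3]
  exact (le_abs_self _).trans abs_integral_le_integral_abs

end HoeffdingKernel

end Kernels

/-! ### A row of vertex and edge variables -/

section Rows

set_option linter.unusedSectionVars false

variable {Ω : Type*} [mΩ : MeasurableSpace Ω]

/-- One row of the array in normal form.  Independent σ-algebras `𝒜` and a family `W` adapted to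
them are indexed by vertices (`Sum.inl i`, the variable `X_i`) and unordered pairs
(`Sum.inr s(i, j)`, the edge indicator `Z_ij`).  Only the laws of the entries with indices in
`{1, …, n}` matter; the edge indicators take the values `0` and `1` everywhere.  The σ-algebras may
be larger than those generated by `W`, so that `W` can be changed on null sets without changing
the conditional expectations considered. -/
structure IsRow (P : Measure Ω) (n : ℕ) (μ : Measure ℝ) (p : ℝ)
    (𝒜 : ℕ ⊕ Sym2 ℕ → MeasurableSpace Ω) (W : ℕ ⊕ Sym2 ℕ → Ω → ℝ) : Prop where
  le : ∀ a, 𝒜 a ≤ mΩ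
  indep_alg : iIndep 𝒜 P
  measurable_alg : ∀ a, Measurable[𝒜 a] (W a)
  map_vertex : ∀ i ∈ Finset.Icc 1 n, P.map (W (Sum.inl i)) = μ
  zero_or_one : ∀ e ω, W (Sum.inr e) ω = 0 ∨ W (Sum.inr e) ω = 1
  integral_edge : ∀ i ∈ Finset.Icc 1 n, ∀ j ∈ Finset.Icc 1 n, i ≠ j →
    ∫ ω, W (Sum.inr s(i, j)) ω ∂P = p
  identDistrib_edge : ∀ i ∈ Finset.Icc 1 n, ∀ j ∈ Finset.Icc 1 n, i ≠ j →
    ∀ i' ∈ Finset.Icc 1 n, ∀ j' ∈ Finset.Icc 1 n, i' ≠ j' →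
      IdentDistrib (W (Sum.inr s(i, j))) (W (Sum.inr s(i', j'))) P P

/-- The variable `X_i` of a row. -/
abbrev vertex (W : ℕ ⊕ Sym2 ℕ → Ω → ℝ) (i : ℕ) : Ω → ℝ := W (Sum.inl i)

/-- The edge indicator `Z_ij` of a row. -/
abbrev edge (W : ℕ ⊕ Sym2 ℕ → Ω → ℝ) (i j : ℕ) : Ω → ℝ := W (Sum.inr s(i, j))

/-- The σ-algebra generated by all entries of the row except `a`. -/
@[reducible] def restAlg {Ω : Type*} (𝒜 : ℕ ⊕ Sym2 ℕ → MeasurableSpace Ω) (a : ℕ ⊕ Sym2 ℕ) :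
    MeasurableSpace Ω :=
  ⨆ b ∈ ({a}ᶜ : Set (ℕ ⊕ Sym2 ℕ)), 𝒜 b

/-- The degree `∑_{j ≠ i} Z_ij` of the vertex `i`. -/
def degree (n : ℕ) (W : ℕ ⊕ Sym2 ℕ → Ω → ℝ) (i : ℕ) (ω : Ω) : ℝ :=
  ∑ j ∈ (Finset.Icc 1 n).erase i, edge W i j ω

theorem memLp_bdd_mul {P : Measure Ω} {f b : Ω → ℝ} (hf : MemLp f 2 P) (hb : Measurable b) {c : ℝ}
    (hc : ∀ ω, |b ω| ≤ c) : MemLp (fun ω => b ω * f ω) 2 P := by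
  refine MemLp.of_le_mul (c := c) hf (hb.aestronglyMeasurable.mul hf.1)
    (Eventually.of_forall fun ω => ?_)
  rw [norm_mul]
  exact mul_le_mul_of_nonneg_right (hc ω) (norm_nonneg _)

namespace IsRow

variable {P : Measure Ω} [IsProbabilityMeasure P] {n : ℕ} {μ : Measure ℝ} {p : ℝ}
  {𝒜 : ℕ ⊕ Sym2 ℕ → MeasurableSpace Ω} {W : ℕ ⊕ Sym2 ℕ → Ω → ℝ} {k : ℝ → ℝ → ℝ}

theorem measurable (hW : IsRow P n μ p 𝒜 W) (a : ℕ ⊕ Sym2 ℕ) : Measurable (W a) :=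
  (hW.measurable_alg a).mono (hW.le a) le_rfl

theorem indep (hW : IsRow P n μ p 𝒜 W) : iIndepFun W P := by
  rw [iIndepFun_iff_iIndep]
  exact iIndep_of_iIndep_of_le hW.indep_alg fun a => (hW.measurable_alg a).comap_le

theorem restAlg_le (hW : IsRow P n μ p 𝒜 W) (a : ℕ ⊕ Sym2 ℕ) : restAlg 𝒜 a ≤ mΩ :=
  iSup₂_le fun b _ => hW.le b

theorem measurable_restAlg (hW : IsRow P n μ p 𝒜 W) {a b : ℕ ⊕ Sym2 ℕ} (h : b ≠ a) :
    Measurable[restAlg 𝒜 a] (W b) :=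
  (hW.measurable_alg b).mono (le_iSup₂_of_le b (by simpa using h) le_rfl) le_rfl

theorem indep_restAlg (hW : IsRow P n μ p 𝒜 W) (a : ℕ ⊕ Sym2 ℕ) :
    Indep (restAlg 𝒜 a) (MeasurableSpace.comap (W a) inferInstance) P := by
  have h := indep_iSup_of_disjoint hW.le hW.indep_alg
    (S := {a}ᶜ) (T := {a}) (Set.disjoint_compl_left_iff_subset.2 le_rfl)
  rw [iSup_singleton] at h
  exact indep_of_indep_of_le_right h (hW.measurable_alg a).comap_le

theorem indepFun_of_measurable (hW : IsRow P n μ p 𝒜 W) {β : Type*} [MeasurableSpace β]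
    {a : ℕ ⊕ Sym2 ℕ} {U : Ω → β} (hU : Measurable[restAlg 𝒜 a] U) : IndepFun U (W a) P :=
  indep_of_indep_of_le_left (hW.indep_restAlg a) hU.comap_le

theorem isProbabilityMeasure (hW : IsRow P n μ p 𝒜 W) (hn : 1 ≤ n) : IsProbabilityMeasure μ := by
  rw [← hW.map_vertex 1 (by simp [hn])]
  exact Measure.isProbabilityMeasure_map (hW.measurable _).aemeasurable

theorem edge_abs_le (hW : IsRow P n μ p 𝒜 W) (e : Sym2 ℕ) (ω : Ω) : |W (Sum.inr e) ω| ≤ 1 := by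
  rcases hW.zero_or_one e ω with h | h <;> simp [h]

theorem edge_nonneg (hW : IsRow P n μ p 𝒜 W) (e : Sym2 ℕ) (ω : Ω) : 0 ≤ W (Sum.inr e) ω := by
  rcases hW.zero_or_one e ω with h | h <;> simp [h]

theorem edge_sq (hW : IsRow P n μ p 𝒜 W) (e : Sym2 ℕ) (ω : Ω) :
    W (Sum.inr e) ω ^ 2 = W (Sum.inr e) ω := by
  rcases hW.zero_or_one e ω with h | h <;> simp [h]

theorem memLp_edge (hW : IsRow P n μ p 𝒜 W) (e : Sym2 ℕ) : MemLp (W (Sum.inr e)) 2 P := by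
  simpa using memLp_bdd_mul (memLp_const (1 : ℝ)) (hW.measurable (Sum.inr e)) (hW.edge_abs_le e)

theorem p_mem (hW : IsRow P n μ p 𝒜 W) (hn : 2 ≤ n) : 0 ≤ p ∧ p ≤ 1 := by
  rw [← hW.integral_edge 1 (by simp; omega) 2 (by simp; omega) (by norm_num)]
  refine ⟨integral_nonneg fun ω => hW.edge_nonneg _ ω, ?_⟩
  calc _ ≤ ∫ _ : Ω, (1 : ℝ) ∂P := integral_mono ((hW.memLp_edge _).integrable one_le_two)
        (integrable_const _) fun ω => le_of_abs_le (hW.edge_abs_le _ ω)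
    _ = 1 := by simp

/-! ### Integrating out one entry of the row -/

theorem integral_edge_mul (hW : IsRow P n μ p 𝒜 W) {i j : ℕ} (hi : i ∈ Finset.Icc 1 n)
    (hj : j ∈ Finset.Icc 1 n) (hij : i ≠ j) {Y : Ω → ℝ}
    (hY : Measurable[restAlg 𝒜 (Sum.inr s(i, j))] Y) :
    ∫ ω, edge W i j ω * Y ω ∂P = p * ∫ ω, Y ω ∂P := by
  have h := (hW.indepFun_of_measurable hY).symm.integral_fun_mul_eq_mul_integral
    (hW.measurable _).aestronglyMeasurable (hY.mono (hW.restAlg_le _) le_rfl).aestronglyMeasurable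
  rw [h, hW.integral_edge i hi j hj hij]

theorem integral_vertex (hW : IsRow P n μ p 𝒜 W) {i : ℕ} (hi : i ∈ Finset.Icc 1 n) {f : ℝ → ℝ}
    (hf : Measurable f) : ∫ ω, f (vertex W i ω) ∂P = ∫ x, f x ∂μ := by
  rw [← hW.map_vertex i hi,
    integral_map (hW.measurable _).aemeasurable hf.aestronglyMeasurable]

theorem memLp_vertex (hW : IsRow P n μ p 𝒜 W) {i : ℕ} (hi : i ∈ Finset.Icc 1 n) {f : ℝ → ℝ}
    (hf : MemLp f 2 μ) : MemLp (fun ω => f (vertex W i ω)) 2 P := by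
  rw [← hW.map_vertex i hi] at hf
  exact hf.comp_of_map (hW.measurable _).aemeasurable

theorem integrable_vertex (hW : IsRow P n μ p 𝒜 W) {i : ℕ} (hi : i ∈ Finset.Icc 1 n) {f : ℝ → ℝ}
    (hf : Integrable f μ) : Integrable (fun ω => f (vertex W i ω)) P := by
  rw [← hW.map_vertex i hi] at hf
  exact hf.comp_measurable (hW.measurable _)

theorem map_vertex_prod (hW : IsRow P n μ p 𝒜 W) {i j : ℕ} (hi : i ∈ Finset.Icc 1 n)
    (hj : j ∈ Finset.Icc 1 n) (hij : i ≠ j) :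
    P.map (fun ω => (vertex W i ω, vertex W j ω)) = μ.prod μ := by
  have h : IndepFun (W (Sum.inl i)) (W (Sum.inl j)) P :=
    hW.indep.indepFun (by simpa using hij)
  rw [(indepFun_iff_map_prod_eq_prod_map_map (hW.measurable _).aemeasurable
    (hW.measurable _).aemeasurable).1 h, hW.map_vertex i hi, hW.map_vertex j hj]

theorem integral_vertex_prod (hW : IsRow P n μ p 𝒜 W) {i j : ℕ} (hi : i ∈ Finset.Icc 1 n)
    (hj : j ∈ Finset.Icc 1 n) (hij : i ≠ j) {f : ℝ × ℝ → ℝ} (hf : Measurable f) :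
    ∫ ω, f (vertex W i ω, vertex W j ω) ∂P = ∫ z, f z ∂(μ.prod μ) := by
  rw [← hW.map_vertex_prod hi hj hij, integral_map
    ((hW.measurable _).prodMk (hW.measurable _)).aemeasurable hf.aestronglyMeasurable]

theorem memLp_vertex_prod (hW : IsRow P n μ p 𝒜 W) {i j : ℕ} (hi : i ∈ Finset.Icc 1 n)
    (hj : j ∈ Finset.Icc 1 n) (hij : i ≠ j) {f : ℝ × ℝ → ℝ} (hf : MemLp f 2 (μ.prod μ)) :
    MemLp (fun ω => f (vertex W i ω, vertex W j ω)) 2 P := by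
  rw [← hW.map_vertex_prod hi hj hij] at hf
  exact hf.comp_of_map ((hW.measurable _).prodMk (hW.measurable _)).aemeasurable

/-- A term with a factor that is degenerate in `X_a` and otherwise does not involve `X_a` has
mean zero. -/
theorem integral_mul_degenerate (hW : IsRow P n μ p 𝒜 W) {a b : ℕ} (ha : a ∈ Finset.Icc 1 n)
    (hab : b ≠ a) {Y : Ω → ℝ} (hY : Measurable[restAlg 𝒜 (Sum.inl a)] Y) {F : ℝ → ℝ → ℝ}
    (hF : Measurable (Function.uncurry F)) (hF0 : ∀ x, ∫ y, F x y ∂μ = 0)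
    (hint : Integrable (fun ω => Y ω * F (vertex W b ω) (vertex W a ω)) P) :
    ∫ ω, Y ω * F (vertex W b ω) (vertex W a ω) ∂P = 0 := by
  have hU : Measurable[restAlg 𝒜 (Sum.inl a)] fun ω => (Y ω, vertex W b ω) :=
    hY.prodMk (hW.measurable_restAlg (by simpa using hab))
  have hf : Measurable fun w : (ℝ × ℝ) × ℝ => w.1.1 * F w.1.2 w.2 := by
    have : Measurable fun w : (ℝ × ℝ) × ℝ => (w.1.2, w.2) := by fun_prop
    exact (measurable_fst.comp measurable_fst).mul (hF.comp this)
  have h := (hW.indepFun_of_measurable hU).integral_comp_prod (hU.mono (hW.restAlg_le _) le_rfl)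
    (hW.measurable _) hf hint
  rw [h, hW.map_vertex a ha]
  simp [integral_const_mul, hF0]

/-! ### Second moments of the building blocks -/

theorem measurable_degree (hW : IsRow P n μ p 𝒜 W) (i : ℕ) : Measurable (degree n W i) :=
  Finset.measurable_sum _ fun _ _ => hW.measurable _

theorem measurable_degree_restAlg (hW : IsRow P n μ p 𝒜 W) (i j : ℕ) :
    Measurable[restAlg 𝒜 (Sum.inl j)] (degree n W i) :=
  Finset.measurable_sum _ fun _ _ => hW.measurable_restAlg (by simp)

theorem degree_nonneg (hW : IsRow P n μ p 𝒜 W) (i : ℕ) (ω : Ω) : 0 ≤ degree n W i ω :=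
  Finset.sum_nonneg fun _ _ => hW.edge_nonneg _ _

theorem abs_degree_le (hW : IsRow P n μ p 𝒜 W) (i : ℕ) (ω : Ω) : |degree n W i ω| ≤ n := by
  rw [abs_of_nonneg (hW.degree_nonneg i ω)]
  refine (Finset.sum_le_card_nsmul _ _ 1 fun j _ => le_of_abs_le (hW.edge_abs_le _ ω)).trans ?_
  rw [nsmul_eq_mul, mul_one]
  exact_mod_cast (Finset.card_le_card (Finset.erase_subset _ _)).trans (by simp)

theorem memLp_degree (hW : IsRow P n μ p 𝒜 W) (i : ℕ) : MemLp (degree n W i) 2 P := by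
  simpa using memLp_bdd_mul (memLp_const (1 : ℝ)) (hW.measurable_degree i) (hW.abs_degree_le i)

theorem integral_edge_sub_sq (hW : IsRow P n μ p 𝒜 W) {i j : ℕ} (hi : i ∈ Finset.Icc 1 n)
    (hj : j ∈ Finset.Icc 1 n) (hij : i ≠ j) {Y : Ω → ℝ} (hYi : Integrable Y P)
    (hY : Measurable[restAlg 𝒜 (Sum.inr s(i, j))] Y) :
    ∫ ω, (edge W i j ω - p) ^ 2 * Y ω ∂P = p * (1 - p) * ∫ ω, Y ω ∂P := by
  have e : ∀ ω, (edge W i j ω - p) ^ 2 * Y ω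
      = (1 - 2 * p) * (edge W i j ω * Y ω) + p ^ 2 * Y ω := fun ω => by
    rw [sub_sq, hW.edge_sq]; ring
  have i1 : Integrable (fun ω => edge W i j ω * Y ω) P :=
    hYi.bdd_mul (c := 1) (hW.measurable _).aestronglyMeasurable
      (Eventually.of_forall (hW.edge_abs_le _))
  simp_rw [e]
  rw [integral_add (i1.const_mul _) (hYi.const_mul _), integral_const_mul, integral_const_mul,
    hW.integral_edge_mul hi hj hij hY]
  ring

theorem integral_edge_sub_mul (hW : IsRow P n μ p 𝒜 W) {i j : ℕ} (hi : i ∈ Finset.Icc 1 n)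
    (hj : j ∈ Finset.Icc 1 n) (hij : i ≠ j) {Y : Ω → ℝ}
    (hY : Measurable[restAlg 𝒜 (Sum.inr s(i, j))] Y) :
    ∫ ω, (edge W i j ω - p) * Y ω ∂P = 0 := by
  have hY' := hY.mono (hW.restAlg_le _) le_rfl
  have hf : Measurable fun x : ℝ => x - p := measurable_id.sub_const p
  have h := ((hW.indepFun_of_measurable hY).symm.comp hf
    measurable_id).integral_fun_mul_eq_mul_integral (hf.comp (hW.measurable _)).aestronglyMeasurable hY'.aestronglyMeasurable
  simp only [Function.comp_def, id] at h
  rw [h, integral_sub ((hW.memLp_edge _).integrable one_le_two) (integrable_const _),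
    hW.integral_edge i hi j hj hij]
  simp

theorem degree_sub_eq (W : ℕ ⊕ Sym2 ℕ → Ω → ℝ) (p : ℝ) {i : ℕ} (hi : i ∈ Finset.Icc 1 n) (ω : Ω) :
    degree n W i ω - (n - 1) * p = ∑ j ∈ (Finset.Icc 1 n).erase i, (edge W i j ω - p) := by
  have hn : 1 ≤ n := (Finset.mem_Icc.1 hi).1.trans (Finset.mem_Icc.1 hi).2
  rw [Finset.sum_sub_distrib, Finset.sum_const, Finset.card_erase_of_mem hi]
  simp [degree, hn]

theorem memLp_edge_sub (hW : IsRow P n μ p 𝒜 W) (i j : ℕ) :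
    MemLp (fun ω => edge W i j ω - p) 2 P := (hW.memLp_edge _).sub (memLp_const _)

theorem edge_ne {i j k : ℕ} (hjk : j ≠ k) : s(i, j) ≠ s(i, k) := fun h => hjk (Sym2.congr_right.1 h)

theorem variance_degree (hW : IsRow P n μ p 𝒜 W) {i : ℕ} (hi : i ∈ Finset.Icc 1 n) :
    ∫ ω, (degree n W i ω - (n - 1) * p) ^ 2 ∂P = (n - 1) * (p * (1 - p)) := by
  have hn : 1 ≤ n := (Finset.mem_Icc.1 hi).1.trans (Finset.mem_Icc.1 hi).2
  have hmem : ∀ j ∈ (Finset.Icc 1 n).erase i, i ≠ j ∧ j ∈ Finset.Icc 1 n := fun j hj =>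
    ⟨(Finset.ne_of_mem_erase hj).symm, Finset.mem_of_mem_erase hj⟩
  simp_rw [degree_sub_eq W p hi]
  rw [integral_sq_sum_of_orthogonal _ fun j _ => hW.memLp_edge_sub i j]
  · have : ∀ j ∈ (Finset.Icc 1 n).erase i, ∫ ω, (edge W i j ω - p) ^ 2 ∂P = p * (1 - p) := by
      intro j hj
      simpa using hW.integral_edge_sub_sq hi (hmem j hj).2 (hmem j hj).1
        (integrable_const (1 : ℝ)) measurable_const
    rw [Finset.sum_congr rfl this, Finset.sum_const, Finset.card_erase_of_mem hi]
    simp [hn]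
  · intro j hj k hk hjk
    refine hW.integral_edge_sub_mul hi (hmem j hj).2 (hmem j hj).1 ?_
    exact (hW.measurable_restAlg (by simpa using edge_ne hjk.symm)).sub_const p

theorem integral_degree (hW : IsRow P n μ p 𝒜 W) {i : ℕ} (hi : i ∈ Finset.Icc 1 n) :
    ∫ ω, (degree n W i ω - (n - 1) * p) ∂P = 0 := by
  simp_rw [degree_sub_eq W p hi]
  rw [integral_finsetSum _ fun j _ => (hW.memLp_edge_sub i j).integrable one_le_two]
  refine Finset.sum_eq_zero fun j hj => ?_
  rw [integral_sub ((hW.memLp_edge _).integrable one_le_two) (integrable_const _),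
    hW.integral_edge i hi j (Finset.mem_of_mem_erase hj) (Finset.ne_of_mem_erase hj).symm]
  simp

theorem integral_degree_sq (hW : IsRow P n μ p 𝒜 W) {i : ℕ} (hi : i ∈ Finset.Icc 1 n) :
    ∫ ω, degree n W i ω ^ 2 ∂P = (n - 1) * (p * (1 - p)) + ((n - 1) * p) ^ 2 := by
  have hL : MemLp (fun ω => degree n W i ω - (n - 1) * p) 2 P :=
    (hW.memLp_degree i).sub (memLp_const _)
  have e : ∀ ω, degree n W i ω ^ 2 = (degree n W i ω - (n - 1) * p) ^ 2
      + (2 * ((n - 1) * p) * (degree n W i ω - (n - 1) * p) + ((n - 1) * p) ^ 2) := fun ω => by ring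
  have i1 := hL.integrable_sq
  have i2 := hL.integrable one_le_two
  simp_rw [e]
  rw [integral_add i1 (by fun_prop), integral_add (by fun_prop) (integrable_const _),
    integral_const_mul, hW.integral_degree hi, hW.variance_degree hi]
  simp

/-- `E|S_i² - E S_i²| ≤ 2 Var S_i + 2 E S_i · sd S_i`. -/
theorem integral_abs_degree_sq_sub_le (hW : IsRow P n μ p 𝒜 W) (hn : 2 ≤ n) {i : ℕ}
    (hi : i ∈ Finset.Icc 1 n) :
    ∫ ω, |degree n W i ω ^ 2 - ∫ ω', degree n W i ω' ^ 2 ∂P| ∂P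
      ≤ 2 * (n * p) + 2 * (n * p) * √(n * p) := by
  obtain ⟨hp0, hp1⟩ := hW.p_mem hn
  have hn' : (2 : ℝ) ≤ n := by exact_mod_cast hn
  have hL : MemLp (fun ω => degree n W i ω - (n - 1) * p) 2 P :=
    (hW.memLp_degree i).sub (memLp_const _)
  have hvar := hW.variance_degree hi
  have hv : (n - 1 : ℝ) * (p * (1 - p)) ≤ n * p := by
    have h1 : 0 ≤ p * (1 - p) := mul_nonneg hp0 (by linarith)
    have h2 : p * (1 - p) ≤ p := by nlinarith [sq_nonneg p]
    exact mul_le_mul (by linarith) h2 h1 (by linarith)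
  have hv0 : 0 ≤ (n - 1 : ℝ) * (p * (1 - p)) :=
    mul_nonneg (by linarith) (mul_nonneg hp0 (by linarith))
  have habs := integral_abs_le_sqrt hL
  rw [hvar] at habs
  have i1 := hL.integrable_sq
  have i2 := (hL.integrable one_le_two).abs
  have hm0 : 0 ≤ (n - 1 : ℝ) * p := mul_nonneg (by linarith) hp0
  have hm : (n - 1 : ℝ) * p ≤ n * p := by nlinarith
  rw [hW.integral_degree_sq hi]
  calc ∫ ω, |degree n W i ω ^ 2 - ((n - 1) * (p * (1 - p)) + ((n - 1) * p) ^ 2)| ∂P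
      ≤ ∫ ω, ((degree n W i ω - (n - 1) * p) ^ 2
          + (2 * ((n - 1) * p) * |degree n W i ω - (n - 1) * p| + (n - 1) * (p * (1 - p)))) ∂P := by
        refine integral_mono_of_nonneg (Eventually.of_forall fun _ => abs_nonneg _) (by fun_prop)
          (Eventually.of_forall fun ω => ?_)
        have e : degree n W i ω ^ 2 - ((n - 1) * (p * (1 - p)) + ((n - 1) * p) ^ 2)
            = (degree n W i ω - (n - 1) * p) ^ 2
              + (2 * ((n - 1) * p) * (degree n W i ω - (n - 1) * p)
              + -((n - 1) * (p * (1 - p)))) := by ring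
        dsimp only
        rw [e]
        refine (abs_add_le _ _).trans (add_le_add (abs_of_nonneg (sq_nonneg _)).le
          ((abs_add_le _ _).trans (add_le_add ?_ ?_)))
        · rw [abs_mul, abs_of_nonneg (by positivity : 0 ≤ 2 * ((n - 1 : ℝ) * p))]
        · rw [abs_neg, abs_of_nonneg hv0]
    _ = (n - 1) * (p * (1 - p)) + (2 * ((n - 1) * p) *
          ∫ ω, |degree n W i ω - (n - 1) * p| ∂P + (n - 1) * (p * (1 - p))) := by
        rw [integral_add i1 (by fun_prop), integral_add (by fun_prop) (integrable_const _),
          integral_const_mul, hvar]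
        simp
    _ ≤ n * p + (2 * (n * p) * √(n * p) + n * p) := by
        have h1 : ∫ ω, |degree n W i ω - (n - 1) * p| ∂P ≤ √(n * p) :=
          habs.trans (Real.sqrt_le_sqrt hv)
        gcongr
    _ = _ := by ring

theorem mem_Icc_of_mem_Ico {i j : ℕ} (hi : i ∈ Finset.Icc 1 n) (hj : j ∈ Finset.Ico 1 i) :
    j ∈ Finset.Icc 1 n ∧ i ≠ j := by
  simp only [Finset.mem_Icc, Finset.mem_Ico] at *
  omega

theorem card_Ico_le {i : ℕ} (hi : i ∈ Finset.Icc 1 n) : ((Finset.Ico 1 i).card : ℝ) ≤ n := by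
  have : (Finset.Ico 1 i).card ≤ n := by
    simp only [Finset.mem_Icc, Nat.card_Ico] at *; omega
  exact_mod_cast this

theorem memLp_edge_mul_vertex (hW : IsRow P n μ p 𝒜 W) {i j : ℕ} (hj : j ∈ Finset.Icc 1 n)
    {f : ℝ → ℝ} (hf : MemLp f 2 μ) : MemLp (fun ω => edge W i j ω * f (vertex W j ω)) 2 P :=
  memLp_bdd_mul (hW.memLp_vertex hj hf) (hW.measurable _) (hW.edge_abs_le _)

/-- The terms `Z_ij f(X_j)`, `j < i`, are orthogonal for centred `f`. -/
theorem integral_sq_sum_edge_mul_le (hW : IsRow P n μ p 𝒜 W) (hn : 2 ≤ n) {i : ℕ}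
    (hi : i ∈ Finset.Icc 1 n) {f : ℝ → ℝ} (hfm : Measurable f) (hf : MemLp f 2 μ)
    (hf0 : ∫ x, f x ∂μ = 0) :
    ∫ ω, (∑ j ∈ Finset.Ico 1 i, edge W i j ω * f (vertex W j ω)) ^ 2 ∂P
      ≤ n * p * ∫ x, f x ^ 2 ∂μ := by
  have hmem := fun j (hj : j ∈ Finset.Ico 1 i) => mem_Icc_of_mem_Ico hi hj
  rw [integral_sq_sum_of_orthogonal _ fun j hj => hW.memLp_edge_mul_vertex (hmem j hj).1 hf]
  · have h1 : ∀ j ∈ Finset.Ico 1 i, ∫ ω, (edge W i j ω * f (vertex W j ω)) ^ 2 ∂P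
        = p * ∫ x, f x ^ 2 ∂μ := fun j hj => by
      simp_rw [mul_pow, hW.edge_sq]
      rw [hW.integral_edge_mul hi (hmem j hj).1 (hmem j hj).2,
        hW.integral_vertex (hmem j hj).1 (hfm.pow_const 2)]
      exact (hfm.comp (hW.measurable_restAlg (by simp))).pow_const 2
    rw [Finset.sum_congr rfl h1, Finset.sum_const, nsmul_eq_mul]
    have h0 : 0 ≤ p * ∫ x, f x ^ 2 ∂μ :=
      mul_nonneg (hW.p_mem hn).1 (integral_nonneg fun _ => sq_nonneg _)
    calc _ ≤ (n : ℝ) * (p * ∫ x, f x ^ 2 ∂μ) := mul_le_mul_of_nonneg_right (card_Ico_le hi) h0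
      _ = _ := by ring
  · intro j hj l hl hjl
    have hL := (hW.memLp_edge_mul_vertex (i := i) (hmem l hl).1 hf).integrable_mul
      (hW.memLp_edge_mul_vertex (i := i) (hmem j hj).1 hf)
    have e : ∀ ω, edge W i j ω * f (vertex W j ω) * (edge W i l ω * f (vertex W l ω))
        = (edge W i j ω * (edge W i l ω * f (vertex W l ω))) * f (vertex W j ω) :=
      fun ω => by ring
    simp_rw [e]
    refine hW.integral_mul_degenerate (F := fun _ y => f y) (b := i) (hmem j hj).1 (hmem j hj).2
      ?_ (hfm.comp measurable_snd) (fun _ => hf0) (hL.congr (Eventually.of_forall fun ω => ?_))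
    · exact (hW.measurable_restAlg (by simp)).mul ((hW.measurable_restAlg (by simp)).mul
        (hfm.comp (hW.measurable_restAlg (by simpa using hjl.symm))))
    · simp only [Pi.mul_apply]; ring

end IsRow

end Rows

/-! ### The conditional variance of an increment -/

section RowVariance

set_option linter.unusedSectionVars false

theorem sum_sum_eq_diag_add_two_mul (s : Finset ℕ) {F : ℕ → ℕ → ℝ} (hF : ∀ j k, F j k = F k j) :
    ∑ j ∈ s, ∑ k ∈ s, F j k
      = ∑ j ∈ s, F j j + 2 * ∑ e ∈ (s ×ˢ s).filter (fun e => e.1 < e.2), F e.1 e.2 := by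
  have e : ∀ j k, F j k = (if j = k then F j k else 0) + ((if j < k then F j k else 0)
      + (if k < j then F j k else 0)) := fun j k => by
    rcases lt_trichotomy j k with h | h | h
    · simp [h, h.ne, h.not_gt]
    · simp [h]
    · simp [h, h.ne', h.not_gt]
  have h1 : ∑ j ∈ s, ∑ k ∈ s, (if j < k then F j k else 0)
      = ∑ e ∈ (s ×ˢ s).filter (fun e => e.1 < e.2), F e.1 e.2 := by
    rw [Finset.sum_filter, Finset.sum_product]
  have h2 : ∑ j ∈ s, ∑ k ∈ s, (if k < j then F j k else 0)
      = ∑ j ∈ s, ∑ k ∈ s, (if j < k then F j k else 0) := by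
    rw [Finset.sum_comm]
    simp only [hF]
  have h3 : ∑ j ∈ s, ∑ k ∈ s, (if j = k then F j k else 0) = ∑ j ∈ s, F j j :=
    Finset.sum_congr rfl fun j hj => by simp [hj]
  calc _ = ∑ j ∈ s, ∑ k ∈ s, ((if j = k then F j k else 0) + ((if j < k then F j k else 0)
      + (if k < j then F j k else 0))) :=
        Finset.sum_congr rfl fun j _ => Finset.sum_congr rfl fun k _ => e j k
    _ = _ := by
        simp only [Finset.sum_add_distrib]
        rw [h2, h3, h1]; ring

variable {Ω : Type*} [mΩ : MeasurableSpace Ω]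

/-- The pairs of distinct vertices preceding `i`, in increasing order. -/
def predPairs (i : ℕ) : Finset (ℕ × ℕ) :=
  (Finset.Ico 1 i ×ˢ Finset.Ico 1 i).filter fun e => e.1 < e.2

/-- The martingale increment of the row, before division by `n θ_n`. -/
noncomputable def increment (n : ℕ) (μ : Measure ℝ) (k : ℝ → ℝ → ℝ) (W : ℕ ⊕ Sym2 ℕ → Ω → ℝ)
    (i : ℕ) (ω : Ω) : ℝ :=
  degree n W i ω * proj μ k (vertex W i ω)
    + ∑ j ∈ Finset.Ico 1 i, edge W i j ω * degen μ k (vertex W i ω) (vertex W j ω)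

/-- The part of the conditional second moment of an increment that does not vanish in the limit. -/
noncomputable def condMain (P : Measure Ω) (n : ℕ) (μ : Measure ℝ) (k : ℝ → ℝ → ℝ)
    (W : ℕ ⊕ Sym2 ℕ → Ω → ℝ) (i : ℕ) (ω : Ω) : ℝ :=
  (∫ ω', degree n W i ω' ^ 2 ∂P) * projSq μ k
    + ∑ j ∈ Finset.Ico 1 i, edge W i j ω * gram μ (degen μ k) (vertex W j ω) (vertex W j ω)

theorem HoeffdingKernel.integral_sq_linear_comb {μ : Measure ℝ} [IsProbabilityMeasure μ]
    {k : ℝ → ℝ → ℝ} (hk : HoeffdingKernel μ k) (s : ℝ) (J : Finset ℕ) (c y : ℕ → ℝ) :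
    ∫ x, (s * proj μ k x + ∑ j ∈ J, c j * degen μ k x (y j)) ^ 2 ∂μ
      = s ^ 2 * projSq μ k + 2 * s * ∑ j ∈ J, c j * cross μ k (y j)
        + ∑ j ∈ J, ∑ l ∈ J, c j * c l * gram μ (degen μ k) (y j) (y l) := by
  have hg := hk.memLp_proj
  have ht := fun j => hk.degenerate.memLp_section' (y j)
  have i1 : Integrable (fun x => proj μ k x ^ 2) μ := hg.integrable_sq
  have i2 : ∀ j, Integrable (fun x => proj μ k x * degen μ k x (y j)) μ :=
    fun j => hg.integrable_mul (ht j)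
  have i3 : ∀ j l, Integrable (fun x => degen μ k x (y j) * degen μ k x (y l)) μ :=
    fun j l => (ht j).integrable_mul (ht l)
  have e : ∀ x, (s * proj μ k x + ∑ j ∈ J, c j * degen μ k x (y j)) ^ 2
      = s ^ 2 * proj μ k x ^ 2 + 2 * s * ∑ j ∈ J, c j * (proj μ k x * degen μ k x (y j))
        + ∑ j ∈ J, ∑ l ∈ J, c j * c l * (degen μ k x (y j) * degen μ k x (y l)) := fun x => by
    rw [add_sq, sq (∑ j ∈ J, c j * degen μ k x (y j)), Finset.sum_mul_sum, mul_pow]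
    congr 1
    · congr 1
      rw [Finset.mul_sum, Finset.mul_sum]
      exact Finset.sum_congr rfl fun j _ => by ring
    · exact Finset.sum_congr rfl fun j _ => Finset.sum_congr rfl fun l _ => by ring
  have j2 : Integrable (fun x => ∑ j ∈ J, c j * (proj μ k x * degen μ k x (y j))) μ :=
    integrable_finsetSum _ fun j _ => (i2 j).const_mul _
  have j3 : ∀ j, Integrable
      (fun x => ∑ l ∈ J, c j * c l * (degen μ k x (y j) * degen μ k x (y l))) μ :=
    fun j => integrable_finsetSum _ fun l _ => (i3 j l).const_mul _
  simp_rw [e]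
  rw [integral_add (by fun_prop) (integrable_finsetSum _ fun j _ => j3 j),
    integral_add (i1.const_mul _) (j2.const_mul _), integral_const_mul, integral_const_mul,
    integral_finsetSum _ fun j _ => (i2 j).const_mul _, integral_finsetSum _ fun j _ => j3 j]
  congr 1
  · simp only [integral_const_mul, cross, projSq]
  · refine Finset.sum_congr rfl fun j _ => ?_
    rw [integral_finsetSum _ fun l _ => (i3 j l).const_mul _]
    simp only [integral_const_mul, gram]

namespace IsRow

variable {P : Measure Ω} [IsProbabilityMeasure P] {n : ℕ} {μ : Measure ℝ} [IsProbabilityMeasure μ]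
  {p : ℝ} {𝒜 : ℕ ⊕ Sym2 ℕ → MeasurableSpace Ω} {W : ℕ ⊕ Sym2 ℕ → Ω → ℝ} {k : ℝ → ℝ → ℝ}

theorem memLp_degree_mul_proj (hW : IsRow P n μ p 𝒜 W) (hk : HoeffdingKernel μ k) {i : ℕ}
    (hi : i ∈ Finset.Icc 1 n) :
    MemLp (fun ω => degree n W i ω * proj μ k (vertex W i ω)) 2 P :=
  memLp_bdd_mul (hW.memLp_vertex hi hk.memLp_proj) (hW.measurable_degree i) (hW.abs_degree_le i)

theorem memLp_edge_mul_degen (hW : IsRow P n μ p 𝒜 W) (hk : HoeffdingKernel μ k) {i j : ℕ}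
    (hi : i ∈ Finset.Icc 1 n) (hj : j ∈ Finset.Icc 1 n) (hij : i ≠ j) :
    MemLp (fun ω => edge W i j ω * degen μ k (vertex W i ω) (vertex W j ω)) 2 P :=
  memLp_bdd_mul (hW.memLp_vertex_prod hi hj hij hk.degenerate.memLp) (hW.measurable _)
    (hW.edge_abs_le _)

theorem memLp_increment (hW : IsRow P n μ p 𝒜 W) (hk : HoeffdingKernel μ k) {i : ℕ}
    (hi : i ∈ Finset.Icc 1 n) : MemLp (increment n μ k W i) 2 P :=
  (hW.memLp_degree_mul_proj hk hi).add (memLp_finsetSum _ fun _ hj =>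
    hW.memLp_edge_mul_degen hk hi (mem_Icc_of_mem_Ico hi hj).1 (mem_Icc_of_mem_Ico hi hj).2)

/-- Conditional second moment of an increment given all entries of the row other than `X_i`. -/
theorem condExp_increment_sq (hW : IsRow P n μ p 𝒜 W) (hk : HoeffdingKernel μ k) {i : ℕ}
    (hi : i ∈ Finset.Icc 1 n) :
    P[fun ω => increment n μ k W i ω ^ 2 | restAlg 𝒜 (Sum.inl i)] =ᵐ[P] fun ω =>
      degree n W i ω ^ 2 * projSq μ k
        + 2 * degree n W i ω * ∑ j ∈ Finset.Ico 1 i, edge W i j ω * cross μ k (vertex W j ω)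
        + ∑ j ∈ Finset.Ico 1 i, ∑ l ∈ Finset.Ico 1 i, edge W i j ω * edge W i l ω
            * gram μ (degen μ k) (vertex W j ω) (vertex W l ω) := by
  let U : Ω → ℝ × (ℕ → ℝ) × (ℕ → ℝ) := fun ω =>
    (degree n W i ω, fun j => edge W i j ω, fun j => if j = i then 0 else vertex W j ω)
  let f : (ℝ × (ℕ → ℝ) × (ℕ → ℝ)) × ℝ → ℝ := fun w =>
    (w.1.1 * proj μ k w.2 + ∑ j ∈ Finset.Ico 1 i, w.1.2.1 j * degen μ k w.2 (w.1.2.2 j)) ^ 2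
  have hU : Measurable[restAlg 𝒜 (Sum.inl i)] U := by
    refine (hW.measurable_degree_restAlg i i).prodMk (Measurable.prodMk ?_ ?_)
    · exact (@measurable_pi_iff _ _ _ (restAlg 𝒜 (Sum.inl i)) _ _).2 fun j =>
        hW.measurable_restAlg (by simp)
    · refine (@measurable_pi_iff _ _ _ (restAlg 𝒜 (Sum.inl i)) _ _).2 fun j => ?_
      by_cases h : j = i
      · simp only [h, if_true]; exact measurable_const
      · simp only [h, if_false]
        exact hW.measurable_restAlg (by simpa using h)
  have hf : Measurable f := by
    refine Measurable.pow_const ((Measurable.mul (by fun_prop)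
      (hk.measurable_proj.comp measurable_snd)).add (Finset.measurable_sum _ fun j _ =>
        Measurable.mul (by fun_prop) ?_)) 2
    have : Measurable fun w : (ℝ × (ℕ → ℝ) × (ℕ → ℝ)) × ℝ => (w.2, w.1.2.2 j) := by fun_prop
    exact hk.measurable_degen.comp this
  have e : ∀ ω, f (U ω, vertex W i ω) = increment n μ k W i ω ^ 2 := fun ω => by
    simp only [f, U, increment]
    congr 2
    refine Finset.sum_congr rfl fun j hj => ?_
    rw [if_neg (mem_Icc_of_mem_Ico hi hj).2.symm]
  have h := condExp_comp_prod_of_indep (hW.restAlg_le _) hU (hW.measurable (Sum.inl i))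
    (hW.indep_restAlg _) hf
    ((hW.memLp_increment hk hi).integrable_sq.congr (Eventually.of_forall fun ω => (e ω).symm))
  have e' : (fun ω => f (U ω, W (Sum.inl i) ω)) = fun ω => increment n μ k W i ω ^ 2 := funext e
  rw [e', hW.map_vertex i hi] at h
  refine h.trans (Eventually.of_forall fun ω => ?_)
  simp only [f]
  rw [hk.integral_sq_linear_comb]
  simp only [U]
  congr 1
  · congr 2
    refine Finset.sum_congr rfl fun j hj => ?_
    rw [if_neg (mem_Icc_of_mem_Ico hi hj).2.symm]
  · refine Finset.sum_congr rfl fun j hj => Finset.sum_congr rfl fun l hl => ?_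
    rw [if_neg (mem_Icc_of_mem_Ico hi hj).2.symm, if_neg (mem_Icc_of_mem_Ico hi hl).2.symm]

theorem memLp_offDiag (hW : IsRow P n μ p 𝒜 W) (hk : HoeffdingKernel μ k) {i j l : ℕ}
    (hj : j ∈ Finset.Icc 1 n) (hl : l ∈ Finset.Icc 1 n) (hjl : j ≠ l) :
    MemLp (fun ω => edge W i j ω * (edge W i l ω
      * gram μ (degen μ k) (vertex W j ω) (vertex W l ω))) 2 P :=
  memLp_bdd_mul (memLp_bdd_mul (hW.memLp_vertex_prod hj hl hjl hk.degenerate.memLp_gram)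
    (hW.measurable _) (hW.edge_abs_le _)) (hW.measurable _) (hW.edge_abs_le _)

/-- Two summands of the off-diagonal part are orthogonal as soon as some vertex `a` belongs to the
first pair only. -/
theorem integral_offDiag_mul_eq_zero (hW : IsRow P n μ p 𝒜 W) (hk : HoeffdingKernel μ k)
    {i a b c d : ℕ} (ha : a ∈ Finset.Icc 1 n) (hb : b ∈ Finset.Icc 1 n) (hc : c ∈ Finset.Icc 1 n)
    (hd : d ∈ Finset.Icc 1 n) (hba : b ≠ a) (hca : c ≠ a) (hda : d ≠ a)
    (hcd : c ≠ d) :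
    ∫ ω, edge W i b ω * (edge W i a ω * gram μ (degen μ k) (vertex W b ω) (vertex W a ω))
      * (edge W i c ω * (edge W i d ω * gram μ (degen μ k) (vertex W c ω) (vertex W d ω))) ∂P
      = 0 := by
  have hL := (hW.memLp_offDiag (i := i) hk hb ha hba).integrable_mul
    (hW.memLp_offDiag (i := i) hk hc hd hcd)
  have e : ∀ ω, edge W i b ω * (edge W i a ω * gram μ (degen μ k) (vertex W b ω) (vertex W a ω))
      * (edge W i c ω * (edge W i d ω * gram μ (degen μ k) (vertex W c ω) (vertex W d ω)))
      = (edge W i b ω * edge W i a ω * (edge W i c ω * edge W i d ω)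
          * gram μ (degen μ k) (vertex W c ω) (vertex W d ω))
        * gram μ (degen μ k) (vertex W b ω) (vertex W a ω) := fun ω => by ring
  simp_rw [e]
  have hE : ∀ j, Measurable[restAlg 𝒜 (Sum.inl a)] (edge W i j) := fun j =>
    hW.measurable_restAlg (by simp)
  refine hW.integral_mul_degenerate ha hba ?_ hk.degenerate.measurable_gram
    (fun x => hk.integral_gram_degen x) (hL.congr (Eventually.of_forall e))
  refine (((hE b).mul (hE a)).mul ((hE c).mul (hE d))).mul ?_
  exact hk.degenerate.measurable_gram.comp ((hW.measurable_restAlg (by simpa using hca)).prodMk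
    (hW.measurable_restAlg (by simpa using hda)))

theorem mem_predPairs {i : ℕ} (hi : i ∈ Finset.Icc 1 n) {e : ℕ × ℕ} (he : e ∈ predPairs i) :
    e.1 ∈ Finset.Icc 1 n ∧ e.2 ∈ Finset.Icc 1 n ∧ e.1 < e.2 ∧ i ≠ e.1 ∧ i ≠ e.2 := by
  simp only [predPairs, Finset.mem_filter, Finset.mem_product, Finset.mem_Ico,
    Finset.mem_Icc] at *
  omega

theorem card_predPairs_le {i : ℕ} (hi : i ∈ Finset.Icc 1 n) :
    ((predPairs i).card : ℝ) ≤ (n : ℝ) ^ 2 := by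
  have h : (predPairs i).card ≤ n * n := by
    refine (Finset.card_filter_le _ _).trans ?_
    rw [Finset.card_product]
    simp only [Finset.mem_Icc, Nat.card_Ico] at *
    exact Nat.mul_le_mul (by omega) (by omega)
  rw [sq]; exact_mod_cast h

theorem integral_sq_sum_offDiag_le (hW : IsRow P n μ p 𝒜 W) (hk : HoeffdingKernel μ k) {i : ℕ}
    (hi : i ∈ Finset.Icc 1 n) :
    ∫ ω, (∑ e ∈ predPairs i, edge W i e.1 ω * (edge W i e.2 ω
      * gram μ (degen μ k) (vertex W e.1 ω) (vertex W e.2 ω))) ^ 2 ∂P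
      ≤ (n * p) ^ 2 * kernelSq μ (gram μ (degen μ k)) := by
  rw [integral_sq_sum_of_orthogonal]
  · have h1 : ∀ e ∈ predPairs i, ∫ ω, (edge W i e.1 ω * (edge W i e.2 ω
        * gram μ (degen μ k) (vertex W e.1 ω) (vertex W e.2 ω))) ^ 2 ∂P
        = p ^ 2 * kernelSq μ (gram μ (degen μ k)) := by
      intro e he
      obtain ⟨h1, h2, h12, hi1, hi2⟩ := mem_predPairs hi he
      have hg := hk.degenerate.measurable_gram
      have hmg : ∀ a : Sym2 ℕ, Measurable[restAlg 𝒜 (Sum.inr a)] fun ω =>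
          gram μ (degen μ k) (vertex W e.1 ω) (vertex W e.2 ω) ^ 2 := fun a =>
        (hg.comp ((hW.measurable_restAlg (by simp)).prodMk
          (hW.measurable_restAlg (by simp)))).pow_const 2
      simp_rw [mul_pow, hW.edge_sq]
      rw [hW.integral_edge_mul hi h1 hi1, hW.integral_edge_mul hi h2 hi2 (hmg _),
        hW.integral_vertex_prod (f := fun z => gram μ (degen μ k) z.1 z.2 ^ 2) h1 h2 h12.ne
          (hg.pow_const 2), kernelSq]
      · ring
      · exact (hW.measurable_restAlg (by simpa using edge_ne h12.ne')).mul (hmg _)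
    rw [Finset.sum_congr rfl h1, Finset.sum_const, nsmul_eq_mul, mul_pow, mul_assoc]
    exact mul_le_mul_of_nonneg_right (card_predPairs_le hi)
      (mul_nonneg (sq_nonneg p) (kernelSq_nonneg _ _))
  · intro e he
    obtain ⟨h1, h2, h12, hi1, hi2⟩ := mem_predPairs hi he
    exact hW.memLp_offDiag hk h1 h2 h12.ne
  · intro e he e' he' hne
    obtain ⟨h1, h2, h12, -, -⟩ := mem_predPairs hi he
    obtain ⟨h1', h2', h12', -, -⟩ := mem_predPairs hi he'
    by_cases hs : e.2 ≠ e'.1 ∧ e.2 ≠ e'.2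
    · exact hW.integral_offDiag_mul_eq_zero hk h2 h1 h1' h2' h12.ne hs.1.symm hs.2.symm h12'.ne
    · have hf : e.1 ≠ e'.1 ∧ e.1 ≠ e'.2 := by
        have : ¬ (e.1 = e'.1 ∧ e.2 = e'.2) := fun h => hne (Prod.ext h.1 h.2)
        omega
      have := hW.integral_offDiag_mul_eq_zero (i := i) hk h1 h2 h1' h2' h12.ne' hf.1.symm
        hf.2.symm h12'.ne
      rw [← this]
      refine integral_congr_ae (Eventually.of_forall fun ω => ?_)
      simp only [gram_symm μ (degen μ k) (vertex W e.2 ω) (vertex W e.1 ω)]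
      ring

/-- Up to an error controlled in `L¹`, the conditional second moment of an increment given any
σ-algebra that does not see `X_i` is its main part. -/
theorem integral_abs_condExp_increment_sub_le {Ω : Type*} {m mΩ : MeasurableSpace Ω}
    {P : Measure Ω} [IsProbabilityMeasure P] {n : ℕ} {μ : Measure ℝ} [IsProbabilityMeasure μ]
    {p : ℝ} {𝒜 : ℕ ⊕ Sym2 ℕ → MeasurableSpace Ω} {W : ℕ ⊕ Sym2 ℕ → Ω → ℝ} {k : ℝ → ℝ → ℝ}
    (hW : IsRow P n μ p 𝒜 W) (hn : 2 ≤ n) (hk : HoeffdingKernel μ k) {i : ℕ} (hi : i ∈ Finset.Icc 1 n)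
    (hm : m ≤ restAlg 𝒜 (Sum.inl i)) (hD : Measurable[m] (condMain P n μ k W i)) :
    ∫ ω, |(P[fun ω => increment n μ k W i ω ^ 2 | m]) ω - condMain P n μ k W i ω| ∂P
      ≤ (2 * (n * p) + 2 * (n * p) * √(n * p)) * projSq μ k
        + 2 * √((n * p + (n * p) ^ 2) * (n * p * ∫ y, cross μ k y ^ 2 ∂μ))
        + 2 * √((n * p) ^ 2 * kernelSq μ (gram μ (degen μ k))) := by
  obtain ⟨hp0, hp1⟩ := hW.p_mem hn
  have hn' : (2 : ℝ) ≤ n := by exact_mod_cast hn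
  set q : Ω → ℝ := fun ω => increment n μ k W i ω ^ 2
  set D : Ω → ℝ := condMain P n μ k W i
  have hle := hW.restAlg_le (Sum.inl i)
  have hmem := fun j (hj : j ∈ Finset.Ico 1 i) => mem_Icc_of_mem_Ico hi hj
  have hV : ∀ j ∈ Finset.Ico 1 i, Integrable (fun ω => edge W i j ω
      * gram μ (degen μ k) (vertex W j ω) (vertex W j ω)) P := fun j hj =>
    (hW.integrable_vertex (hmem j hj).1 hk.degenerate.integrable_gram_self).bdd_mul (c := 1)
      (hW.measurable _).aestronglyMeasurable (Eventually.of_forall (hW.edge_abs_le _))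
  have hDi : Integrable D P :=
    (integrable_const _).add (integrable_finsetSum _ hV)
  have hqD : P[q | m] - D =ᵐ[P] P[P[q | restAlg 𝒜 (Sum.inl i)] - D | m] := by
    have h1 := condExp_condExp_of_le (μ := P) (f := q) hm hle
    have h2 := condExp_sub (m := m) (integrable_condExp (μ := P) (f := q)
      (m := restAlg 𝒜 (Sum.inl i))) hDi
    have h3 : P[D | m] = D :=
      condExp_of_stronglyMeasurable (hm.trans hle) hD.stronglyMeasurable hDi
    rw [h3] at h2
    filter_upwards [h1, h2] with ω h1 h2
    rw [h2, Pi.sub_apply, Pi.sub_apply, h1]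
  have hL1 : ∫ ω, |(P[q | m]) ω - D ω| ∂P
      ≤ ∫ ω, |(P[q | restAlg 𝒜 (Sum.inl i)]) ω - D ω| ∂P := by
    calc ∫ ω, |(P[q | m]) ω - D ω| ∂P
        = ∫ ω, |(P[P[q | restAlg 𝒜 (Sum.inl i)] - D | m]) ω| ∂P := by
          refine integral_congr_ae ?_
          filter_upwards [hqD] with ω hω
          rw [← hω, Pi.sub_apply]
      _ ≤ _ := integral_abs_condExp_le _
  refine hL1.trans ?_
  -- the fluctuation of the squared degree, the mixed terms `B` and the off-diagonal terms `O`
  set B : Ω → ℝ := fun ω => ∑ j ∈ Finset.Ico 1 i, edge W i j ω * cross μ k (vertex W j ω) with hB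
  set O : Ω → ℝ := fun ω => ∑ e ∈ predPairs i, edge W i e.1 ω * (edge W i e.2 ω
      * gram μ (degen μ k) (vertex W e.1 ω) (vertex W e.2 ω)) with hO
  have hBL : MemLp B 2 P := memLp_finsetSum _ fun j hj =>
    hW.memLp_edge_mul_vertex (hmem j hj).1 hk.memLp_cross
  have hOL : MemLp O 2 P := memLp_finsetSum _ fun e he => by
    obtain ⟨h1, h2, h12, -, -⟩ := mem_predPairs hi he
    exact hW.memLp_offDiag hk h1 h2 h12.ne
  have hdL := hW.memLp_degree i
  have hR : ∀ᵐ ω ∂P, |(P[q | restAlg 𝒜 (Sum.inl i)]) ω - D ω|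
      ≤ |degree n W i ω ^ 2 - ∫ ω', degree n W i ω' ^ 2 ∂P| * projSq μ k
        + 2 * |degree n W i ω * B ω| + 2 * |O ω| := by
    filter_upwards [hW.condExp_increment_sq hk hi] with ω hω
    have hsum : ∑ j ∈ Finset.Ico 1 i, ∑ l ∈ Finset.Ico 1 i, edge W i j ω * edge W i l ω
            * gram μ (degen μ k) (vertex W j ω) (vertex W l ω)
        = ∑ j ∈ Finset.Ico 1 i, edge W i j ω * gram μ (degen μ k) (vertex W j ω) (vertex W j ω)
          + 2 * O ω := by
      rw [sum_sum_eq_diag_add_two_mul _ fun j l => by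
        rw [gram_symm μ (degen μ k) (vertex W j ω)]; ring]
      congr 1
      · refine Finset.sum_congr rfl fun j _ => ?_
        rw [← sq, hW.edge_sq]
      · rw [hO, predPairs]
        congr 1
        exact Finset.sum_congr rfl fun e _ => by ring
    rw [hω, hsum]
    have e : degree n W i ω ^ 2 * projSq μ k
        + 2 * degree n W i ω * ∑ j ∈ Finset.Ico 1 i, edge W i j ω * cross μ k (vertex W j ω)
        + (∑ j ∈ Finset.Ico 1 i, edge W i j ω
            * gram μ (degen μ k) (vertex W j ω) (vertex W j ω) + 2 * O ω) - D ω
        = (degree n W i ω ^ 2 - ∫ ω', degree n W i ω' ^ 2 ∂P) * projSq μ k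
          + 2 * (degree n W i ω * B ω) + 2 * O ω := by
      simp only [D, condMain, hB]; ring
    rw [e]
    refine (abs_add_three _ _ _).trans (le_of_eq ?_)
    rw [abs_mul, abs_of_nonneg (projSq_nonneg μ k), abs_mul 2, abs_mul 2, abs_two]
  have i1 : Integrable (fun ω => |degree n W i ω ^ 2 - ∫ ω', degree n W i ω' ^ 2 ∂P|) P :=
    (hdL.integrable_sq.sub (integrable_const _)).abs
  have i2 : Integrable (fun ω => |degree n W i ω * B ω|) P := (hdL.integrable_mul hBL).abs
  have i3 : Integrable (fun ω => |O ω|) P := (hOL.integrable one_le_two).abs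
  have b1 := hW.integral_abs_degree_sq_sub_le hn hi
  have b2 := integral_abs_mul_le_sqrt hdL hBL
  have b3 := integral_abs_le_sqrt hOL
  have hd2 : ∫ ω, degree n W i ω ^ 2 ∂P ≤ n * p + (n * p) ^ 2 := by
    rw [hW.integral_degree_sq hi]
    have h1 : 0 ≤ p * (1 - p) := mul_nonneg hp0 (by linarith)
    have h2 : p * (1 - p) ≤ p := by nlinarith [sq_nonneg p]
    have h3 : (n - 1 : ℝ) * (p * (1 - p)) ≤ n * p := mul_le_mul (by linarith) h2 h1 (by linarith)
    have h4 : ((n - 1 : ℝ) * p) ^ 2 ≤ (n * p) ^ 2 :=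
      pow_le_pow_left₀ (mul_nonneg (by linarith) hp0)
        (mul_le_mul_of_nonneg_right (by linarith) hp0) 2
    linarith
  have hB2 := hW.integral_sq_sum_edge_mul_le hn hi hk.measurable_cross hk.memLp_cross
    hk.integral_cross
  have hO2 := hW.integral_sq_sum_offDiag_le hk hi
  calc ∫ ω, |(P[q | restAlg 𝒜 (Sum.inl i)]) ω - D ω| ∂P
      ≤ ∫ ω, (|degree n W i ω ^ 2 - ∫ ω', degree n W i ω' ^ 2 ∂P| * projSq μ k
        + 2 * |degree n W i ω * B ω| + 2 * |O ω|) ∂P :=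
        integral_mono_of_nonneg (Eventually.of_forall fun _ => abs_nonneg _) (by fun_prop) hR
    _ = (∫ ω, |degree n W i ω ^ 2 - ∫ ω', degree n W i ω' ^ 2 ∂P| ∂P) * projSq μ k
        + 2 * ∫ ω, |degree n W i ω * B ω| ∂P + 2 * ∫ ω, |O ω| ∂P := by
        rw [integral_add (by fun_prop) (by fun_prop), integral_add (by fun_prop) (by fun_prop),
          integral_mul_const, integral_const_mul, integral_const_mul]
    _ ≤ _ := by
        have h0 := projSq_nonneg μ k
        have hb0 : 0 ≤ ∫ ω, B ω ^ 2 ∂P := integral_nonneg fun _ => sq_nonneg _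
        have b2' : ∫ ω, |degree n W i ω * B ω| ∂P
            ≤ √((n * p + (n * p) ^ 2) * (n * p * ∫ y, cross μ k y ^ 2 ∂μ)) :=
          b2.trans (Real.sqrt_le_sqrt (mul_le_mul hd2 hB2 hb0 (by positivity)))
        have b3' := b3.trans (Real.sqrt_le_sqrt hO2)
        gcongr

end IsRow

end RowVariance

/-! ### Truncation along a row -/

section RowTruncation

set_option linter.unusedSectionVars false

variable {Ω : Type*} [mΩ : MeasurableSpace Ω]

/-- Sequential criterion for independence of a family. -/
theorem iIndepFun_of_indepFun_finset {ι : Type*} [DecidableEq ι] {P : Measure Ω}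
    [IsProbabilityMeasure P] {y : ι → Ω → ℝ}
    (h : ∀ (s : Finset ι) (a : ι), a ∉ s → IndepFun (fun ω (j : s) => y j ω) (y a) P) :
    iIndepFun y P := by
  rw [iIndepFun_iff_measure_inter_preimage_eq_mul]
  intro S sets
  induction S using Finset.induction_on with
  | empty => simp
  | insert a s ha ih =>
    intro hsets
    have hset : MeasurableSet (⋂ j : s, (fun v : s → ℝ => v j) ⁻¹' sets j) :=
      MeasurableSet.iInter fun j =>
        measurable_pi_apply j (hsets j (Finset.mem_insert_of_mem j.2))
    have h1 := (h s a ha).measure_inter_preimage_eq_mul _ _ hset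
      (hsets a (Finset.mem_insert_self a s))
    have e : (fun ω (j : s) => y j ω) ⁻¹' (⋂ j : s, (fun v : s → ℝ => v j) ⁻¹' sets j)
        = ⋂ j ∈ s, y j ⁻¹' sets j := by
      ext ω; simp
    rw [e] at h1
    rw [Finset.set_biInter_insert, Finset.prod_insert ha, Set.inter_comm, h1,
      ih fun i hi => hsets i (Finset.mem_insert_of_mem hi), mul_comm]

namespace IsRow

variable {P : Measure Ω} [IsProbabilityMeasure P] {n : ℕ} {μ : Measure ℝ} [IsProbabilityMeasure μ]
  {p : ℝ} {𝒜 : ℕ ⊕ Sym2 ℕ → MeasurableSpace Ω} {W : ℕ ⊕ Sym2 ℕ → Ω → ℝ} {k : ℝ → ℝ → ℝ}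

/-- The variables `Z_ij f(X_j)`, `j ∈ ℕ`, are independent for fixed `i`. -/
theorem iIndepFun_edge_mul (hW : IsRow P n μ p 𝒜 W) (i : ℕ) {f : ℝ → ℝ} (hf : Measurable f) :
    iIndepFun (fun j ω => edge W i j ω * f (vertex W j ω)) P := by
  classical
  refine iIndepFun_of_indepFun_finset fun s a ha => ?_
  let c : Finset ℕ → Finset (ℕ ⊕ Sym2 ℕ) := fun s =>
    s.image Sum.inl ∪ s.image fun j => Sum.inr s(i, j)
  have hcv : ∀ (s : Finset ℕ) (j : s), Sum.inl (j : ℕ) ∈ c s := fun s j =>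
    Finset.mem_union_left _ (Finset.mem_image_of_mem _ j.2)
  have hce : ∀ (s : Finset ℕ) (j : s), Sum.inr s(i, (j : ℕ)) ∈ c s := fun s j =>
    Finset.mem_union_right _ (Finset.mem_image_of_mem (fun j => Sum.inr s(i, j)) j.2)
  have hdisj : Disjoint (c s) (c {a}) := by
    rw [Finset.disjoint_left]
    intro b hb hb'
    simp only [c, Finset.mem_union, Finset.mem_image, Finset.mem_singleton] at hb hb'
    rcases hb with ⟨j, hj, rfl⟩ | ⟨j, hj, rfl⟩
    · simp only [Sum.inl.injEq, exists_eq_left, reduceCtorEq, or_false] at hb'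
      exact ha (hb' ▸ hj)
    · simp only [Sum.inr.injEq, exists_eq_left, reduceCtorEq, false_or, Sym2.congr_right] at hb'
      exact ha (hb' ▸ hj)
  have h := hW.indep.indepFun_finset (c s) (c {a}) hdisj hW.measurable
  refine h.comp (φ := fun v (j : s) => v ⟨_, hce s j⟩ * f (v ⟨_, hcv s j⟩))
    (ψ := fun v => v ⟨_, hce {a} ⟨a, by simp⟩⟩ * f (v ⟨_, hcv {a} ⟨a, by simp⟩⟩)) ?_ ?_
  · exact measurable_pi_lambda _ fun j =>
      (measurable_pi_apply _).mul (hf.comp (measurable_pi_apply _))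
  · exact (measurable_pi_apply _).mul (hf.comp (measurable_pi_apply _))

/-- Truncated second moment of the degenerate part of an increment. -/
theorem integral_indicator_sum_edge_mul_degen_le (hW : IsRow P n μ p 𝒜 W) (hn : 2 ≤ n)
    (hk : HoeffdingKernel μ k) {i : ℕ} (hi : i ∈ Finset.Icc 1 n) {τ σ c : ℝ} (hτ : 0 < τ)
    (hσ : 0 ≤ σ) (hc : 0 < c) :
    ∫ ω, (if 2 * c ≤ |∑ j ∈ Finset.Ico 1 i,
          edge W i j ω * degen μ k (vertex W i ω) (vertex W j ω)|
        then (∑ j ∈ Finset.Ico 1 i,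
          edge W i j ω * degen μ k (vertex W i ω) (vertex W j ω)) ^ 2 else 0) ∂P
      ≤ 4 * ((4 * τ ^ 2 + 3 * n * σ) / c ^ 2 * (n * (p * kernelSq μ (degen μ k)))
        + n * ∫ x, (if σ ≤ p * gram μ (degen μ k) x x then p * gram μ (degen μ k) x x else 0) ∂μ
        + n * (p * ∫ z, (if τ ≤ |degen μ k z.1 z.2| then degen μ k z.1 z.2 ^ 2 else 0)
            ∂(μ.prod μ))) := by
  obtain ⟨hp0, hp1⟩ := hW.p_mem hn
  have hmem := fun j (hj : j ∈ Finset.Ico 1 i) => mem_Icc_of_mem_Ico hi hj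
  have ht := hk.degenerate
  set t := degen μ k with ht_def
  let ψ : ℝ → ℝ := fun y => if τ ≤ |y| then y ^ 2 else 0
  have hψm : Measurable ψ :=
    Measurable.ite (measurableSet_le measurable_const measurable_id.abs)
      (measurable_id.pow_const 2) measurable_const
  have hψ0 : ∀ y, 0 ≤ ψ y := fun y => by simp only [ψ]; split_ifs <;> positivity
  have hψle : ∀ y, ψ y ≤ y ^ 2 := fun y => by
    simp only [ψ]; split_ifs
    · exact le_rfl
    · positivity
  let r : ℝ → ℝ := fun x => p * ∫ y, ψ (t x y) ∂μ
  let v : ℝ → ℝ := fun x => p * gram μ t x x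
  have hv0 : ∀ x, 0 ≤ v x := fun x => mul_nonneg hp0 (gram_self_nonneg μ t x)
  have hψtm : Measurable fun z : ℝ × ℝ => ψ (t z.1 z.2) := hψm.comp ht.measurable
  have hψi : Integrable (fun z : ℝ × ℝ => ψ (t z.1 z.2)) (μ.prod μ) :=
    ht.integrable_sq.mono' hψtm.aestronglyMeasurable (Eventually.of_forall fun z => by
      rw [Real.norm_of_nonneg (hψ0 _)]; exact hψle _)
  have hvi : Integrable v μ := ht.integrable_gram_self.const_mul p
  have hvm : Measurable v :=
    (ht.measurable_gram.comp (measurable_id.prodMk measurable_id)).const_mul p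
  have hv1i : Integrable (fun x => if σ ≤ v x then v x else 0) μ := by
    refine hvi.mono' (Measurable.ite (measurableSet_le measurable_const hvm) hvm
      measurable_const).aestronglyMeasurable (Eventually.of_forall fun x => ?_)
    split_ifs
    · rw [Real.norm_of_nonneg (hv0 x)]
    · simpa using hv0 x
  have hri : Integrable r μ := hψi.integral_prod_left.const_mul p
  -- the bound for a fixed value `x` of `X_i`
  have hfix : ∀ x, ∫ ω, (if 2 * c ≤ |∑ j ∈ Finset.Ico 1 i, edge W i j ω * t x (vertex W j ω)|
        then (∑ j ∈ Finset.Ico 1 i, edge W i j ω * t x (vertex W j ω)) ^ 2 else 0) ∂P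
      ≤ 4 * ((4 * τ ^ 2 + 3 * n * σ) / c ^ 2 * (n * v x) + n * (if σ ≤ v x then v x else 0)
        + n * r x) := by
    intro x
    have hxm := ht.measurable_section x
    have hrest : ∀ (j : ℕ) (f : ℝ → ℝ), Measurable f →
        Measurable[restAlg 𝒜 (Sum.inr s(i, j))] fun ω => f (vertex W j ω) :=
      fun j f hf => hf.comp (hW.measurable_restAlg (by simp))
    refine integral_sq_sum_indicator_le (hW.iIndepFun_edge_mul i hxm)
      (fun j => (hW.measurable _).mul (hxm.comp (hW.measurable _))) _
      (fun j hj => hW.memLp_edge_mul_vertex (hmem j hj).1 (ht.memLp_section x))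
      (fun j hj => ?_) hτ.le hc (card_Ico_le hi) (fun j hj => ?_) (hv0 x)
      (mul_nonneg hp0 (integral_nonneg fun y => hψ0 _)) hσ (fun j hj => ?_)
    · rw [hW.integral_edge_mul hi (hmem j hj).1 (hmem j hj).2 (hrest j _ hxm),
        hW.integral_vertex (hmem j hj).1 hxm, hk.integral_degen, mul_zero]
    · simp_rw [mul_pow, hW.edge_sq]
      rw [hW.integral_edge_mul hi (hmem j hj).1 (hmem j hj).2 (hrest j _ (hxm.pow_const 2)),
        hW.integral_vertex (hmem j hj).1 (hxm.pow_const 2), ← ht.gram_self]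
    · have e : ∀ ω, (if τ ≤ |edge W i j ω * t x (vertex W j ω)|
          then (edge W i j ω * t x (vertex W j ω)) ^ 2 else 0)
          = edge W i j ω * ψ (t x (vertex W j ω)) := fun ω => by
        rcases hW.zero_or_one s(i, j) ω with h | h <;> simp [h, hτ.not_ge, ψ]
      simp_rw [e]
      rw [hW.integral_edge_mul hi (hmem j hj).1 (hmem j hj).2
          (hrest j (fun y => ψ (t x y)) (hψm.comp hxm)),
        hW.integral_vertex (hmem j hj).1 (f := fun y => ψ (t x y)) (hψm.comp hxm)]
  -- integrate over the law of `X_i`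
  let U : Ω → (ℕ → ℝ) × (ℕ → ℝ) := fun ω =>
    (fun j => edge W i j ω, fun j => if j = i then 0 else vertex W j ω)
  let g : ((ℕ → ℝ) × (ℕ → ℝ)) × ℝ → ℝ := fun w =>
    ∑ j ∈ Finset.Ico 1 i, w.1.1 j * t w.2 (w.1.2 j)
  have hU : Measurable[restAlg 𝒜 (Sum.inl i)] U := by
    refine Measurable.prodMk ?_ ?_
    · exact (@measurable_pi_iff _ _ _ (restAlg 𝒜 (Sum.inl i)) _ _).2 fun j =>
        hW.measurable_restAlg (by simp)
    · refine (@measurable_pi_iff _ _ _ (restAlg 𝒜 (Sum.inl i)) _ _).2 fun j => ?_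
      by_cases h : j = i
      · simp only [h, if_true]; exact measurable_const
      · simp only [h, if_false]
        exact hW.measurable_restAlg (by simpa using h)
  have hg : Measurable g := by
    refine Finset.measurable_sum _ fun j _ => Measurable.mul (by fun_prop) ?_
    have : Measurable fun w : ((ℕ → ℝ) × (ℕ → ℝ)) × ℝ => (w.2, w.1.2 j) := by fun_prop
    exact ht.measurable.comp this
  have hgU : ∀ ω x, g (U ω, x) = ∑ j ∈ Finset.Ico 1 i, edge W i j ω * t x (vertex W j ω) :=
    fun ω x => Finset.sum_congr rfl fun j hj => by
      simp only [U]; rw [if_neg (hmem j hj).2.symm]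
  have hf : Measurable fun w => if 2 * c ≤ |g w| then g w ^ 2 else 0 :=
    Measurable.ite (measurableSet_le measurable_const hg.abs) (hg.pow_const 2) measurable_const
  have hbL : MemLp (fun ω => g (U ω, vertex W i ω)) 2 P := by
    simp only [hgU]
    exact memLp_finsetSum _ fun j hj => hW.memLp_edge_mul_degen hk hi (hmem j hj).1 (hmem j hj).2
  have hint : Integrable (fun ω => if 2 * c ≤ |g (U ω, vertex W i ω)|
      then g (U ω, vertex W i ω) ^ 2 else 0) P := by
    refine hbL.integrable_sq.mono' (hf.comp ((hU.mono (hW.restAlg_le _) le_rfl).prodMk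
      (hW.measurable _))).aestronglyMeasurable (Eventually.of_forall fun ω => ?_)
    rw [Real.norm_eq_abs]
    split_ifs
    · rw [abs_of_nonneg (sq_nonneg _)]
    · simpa using sq_nonneg _
  have key := (hW.indepFun_of_measurable hU).integral_comp_prod_symm
    (hU.mono (hW.restAlg_le _) le_rfl) (hW.measurable _) hf hint
  rw [hW.map_vertex i hi] at key
  simp only [hgU] at key
  rw [key]
  have hbound : Integrable (fun x => 4 * ((4 * τ ^ 2 + 3 * n * σ) / c ^ 2 * (n * v x)
      + n * (if σ ≤ v x then v x else 0) + n * r x)) μ :=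
    ((((hvi.const_mul _).const_mul _).add (hv1i.const_mul _)).add (hri.const_mul _)).const_mul _
  calc _ ≤ ∫ x, 4 * ((4 * τ ^ 2 + 3 * n * σ) / c ^ 2 * (n * v x)
        + n * (if σ ≤ v x then v x else 0) + n * r x) ∂μ := by
        refine integral_mono_of_nonneg (Eventually.of_forall fun x =>
          integral_nonneg fun ω => ?_) hbound (Eventually.of_forall hfix)
        dsimp only; split_ifs <;> simp [sq_nonneg]
    _ = _ := by
        rw [integral_const_mul, integral_add (by fun_prop) (by fun_prop),
          integral_add (by fun_prop) (by fun_prop)]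
        simp only [integral_const_mul, v, r, ht.integral_gram_self]
        rw [integral_prod _ hψi]

/-- Law of large numbers for the diagonal part, by truncating the weight `V` at the level `a`. -/
theorem integral_abs_sum_edge_mul_sub_le (hW : IsRow P n μ p 𝒜 W) (hn : 2 ≤ n) {V : ℝ → ℝ}
    (hVm : Measurable V) (hV0 : ∀ x, 0 ≤ V x) (hVi : Integrable V μ) {a : ℝ} (ha : 0 ≤ a) :
    ∫ ω, |∑ i ∈ Finset.Icc 1 n, ∑ j ∈ Finset.Ico 1 i,
        (edge W i j ω * V (vertex W j ω) - p * ∫ x, V x ∂μ)| ∂P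
      ≤ 2 * n ^ 2 * p * ∫ x, (if a ≤ V x then V x else 0) ∂μ
        + √(n ^ 2 * p * (a * ∫ x, V x ∂μ)) + n * p * √(n * (a * ∫ x, V x ∂μ)) := by
  obtain ⟨hp0, hp1⟩ := hW.p_mem hn
  have hmem := fun i (hi : i ∈ Finset.Icc 1 n) j (hj : j ∈ Finset.Ico 1 i) =>
    mem_Icc_of_mem_Ico hi hj
  have hsetV : MeasurableSet {x | a ≤ V x} := measurableSet_le measurable_const hVm
  let w : ℝ → ℝ := fun x => if a ≤ V x then 0 else V x
  let r : ℝ → ℝ := fun x => if a ≤ V x then V x else 0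
  have hwm : Measurable w := Measurable.ite hsetV measurable_const hVm
  have hrm : Measurable r := Measurable.ite hsetV hVm measurable_const
  have hwr : ∀ x, V x = w x + r x := fun x => by by_cases h : a ≤ V x <;> simp [w, r, h]
  have hr0 : ∀ x, 0 ≤ r x := fun x => by by_cases h : a ≤ V x <;> simp [r, h, hV0]
  have hw2 : ∀ x, w x ^ 2 ≤ a * V x := fun x => by
    by_cases h : a ≤ V x
    · simpa [w, h] using mul_nonneg ha (hV0 x)
    · simp only [w, h, if_false, sq]
      exact mul_le_mul_of_nonneg_right (not_le.1 h).le (hV0 x)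
  have hwL : MemLp w 2 μ := memLp_two_of_sq_le hwm.aestronglyMeasurable (hVi.const_mul a)
    (Eventually.of_forall hw2)
  have hri : Integrable r μ := hVi.mono' hrm.aestronglyMeasurable (Eventually.of_forall fun x => by
    by_cases h : a ≤ V x <;> simp [r, h, abs_of_nonneg, hV0])
  have hwi := hwL.integrable one_le_two
  have hEV : ∫ x, V x ∂μ = ∫ x, w x ∂μ + ∫ x, r x ∂μ := by
    rw [← integral_add hwi hri]; simp only [hwr]
  have hr_nonneg : 0 ≤ ∫ x, r x ∂μ := integral_nonneg hr0
  have hw2i : ∫ x, w x ^ 2 ∂μ ≤ a * ∫ x, V x ∂μ := by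
    rw [← integral_const_mul]
    exact integral_mono hwL.integrable_sq (hVi.const_mul a) hw2
  have hw2nn : 0 ≤ ∫ x, w x ^ 2 ∂μ := integral_nonneg fun _ => sq_nonneg _
  have hcard : ∀ i ∈ Finset.Icc 1 n, ((Finset.Ico 1 i).card : ℝ) ≤ n := fun i hi => card_Ico_le hi
  have hcardn : ((Finset.Icc 1 n).card : ℝ) = n := by simp
  -- truncate `V = w + r`; then `T1` collects the centred edges, `T2` the centred vertices, and `T3`
  -- dominates the contribution of the large values `r`
  let E : Finset (Σ _ : ℕ, ℕ) := (Finset.Icc 1 n).sigma fun i => Finset.Ico 1 i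
  have hE : ∀ e ∈ E, e.1 ∈ Finset.Icc 1 n ∧ e.2 ∈ Finset.Ico 1 e.1 := fun e he =>
    Finset.mem_sigma.1 he
  have hEcard : (E.card : ℝ) ≤ n ^ 2 := by
    rw [Finset.card_sigma, Nat.cast_sum]
    refine (Finset.sum_le_card_nsmul _ _ _ hcard).trans ?_
    rw [nsmul_eq_mul, hcardn, sq]
  let T1 : Ω → ℝ := fun ω => ∑ e ∈ E, (edge W e.1 e.2 ω - p) * w (vertex W e.2 ω)
  let T2 : ℕ → Ω → ℝ := fun i ω => ∑ j ∈ Finset.Ico 1 i, (w (vertex W j ω) - ∫ x, w x ∂μ)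
  let T3 : Ω → ℝ := fun ω => ∑ e ∈ E, (edge W e.1 e.2 ω * r (vertex W e.2 ω) + p * ∫ x, r x ∂μ)
  have hb : ∀ e : Sym2 ℕ, ∀ ω, |W (Sum.inr e) ω - p| ≤ 1 := fun e ω => by
    rcases hW.zero_or_one e ω with h | h <;> rw [h, abs_le] <;> constructor <;> linarith
  have hT1t : ∀ e ∈ E, MemLp (fun ω => (edge W e.1 e.2 ω - p) * w (vertex W e.2 ω)) 2 P :=
    fun e he => memLp_bdd_mul (hW.memLp_vertex (hmem _ (hE e he).1 _ (hE e he).2).1 hwL)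
      ((hW.measurable _).sub_const p) (hb _)
  have hT1L : MemLp T1 2 P := memLp_finsetSum _ hT1t
  have hT1 : ∫ ω, |T1 ω| ∂P ≤ √(n ^ 2 * p * (a * ∫ x, V x ∂μ)) := by
    refine (integral_abs_le_sqrt hT1L).trans (Real.sqrt_le_sqrt ?_)
    rw [integral_sq_sum_of_orthogonal E hT1t]
    · have h1 : ∀ e ∈ E, ∫ ω, ((edge W e.1 e.2 ω - p) * w (vertex W e.2 ω)) ^ 2 ∂P
          ≤ p * (a * ∫ x, V x ∂μ) := fun e he => by
        obtain ⟨h1, h2⟩ := hE e he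
        obtain ⟨h3, h4⟩ := hmem _ h1 _ h2
        simp_rw [mul_pow]
        rw [hW.integral_edge_sub_sq h1 h3 h4 (hW.memLp_vertex h3 hwL).integrable_sq
          ((hwm.comp (hW.measurable_restAlg (by simp))).pow_const 2),
          hW.integral_vertex (f := fun x => w x ^ 2) h3 (hwm.pow_const 2)]
        exact mul_le_mul (by nlinarith) hw2i hw2nn hp0
      refine (Finset.sum_le_card_nsmul _ _ _ h1).trans ?_
      rw [nsmul_eq_mul, mul_assoc]
      exact mul_le_mul_of_nonneg_right hEcard
        (mul_nonneg hp0 (mul_nonneg ha (integral_nonneg hV0)))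
    · intro e he e' he' hne
      obtain ⟨h1, h2⟩ := hE e he
      obtain ⟨h1', h2'⟩ := hE e' he'
      obtain ⟨h3, h4⟩ := hmem _ h1 _ h2
      simp_rw [mul_assoc]
      refine hW.integral_edge_sub_mul h1 h3 h4 ?_
      have hne' : s(e'.1, e'.2) ≠ s(e.1, e.2) := by
        intro h
        rcases Sym2.eq_iff.1 h with h | h
        · exact hne (Sigma.ext h.1.symm (heq_of_eq h.2.symm))
        · simp only [Finset.mem_Ico] at h2 h2'
          omega
      refine (hwm.comp (hW.measurable_restAlg (by simp))).mul
        (((hW.measurable_restAlg (by simpa using hne')).sub_const p).mul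
          (hwm.comp (hW.measurable_restAlg (by simp))))
  have hT2t : ∀ i ∈ Finset.Icc 1 n, ∀ j ∈ Finset.Ico 1 i,
      MemLp (fun ω => w (vertex W j ω) - ∫ x, w x ∂μ) 2 P := fun i hi j hj =>
    (hW.memLp_vertex (hmem i hi j hj).1 hwL).sub (memLp_const _)
  have hT2L : ∀ i ∈ Finset.Icc 1 n, MemLp (T2 i) 2 P := fun i hi =>
    memLp_finsetSum _ (hT2t i hi)
  have hT2 : ∀ i ∈ Finset.Icc 1 n, ∫ ω, |T2 i ω| ∂P ≤ √(n * (a * ∫ x, V x ∂μ)) := by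
    intro i hi
    refine (integral_abs_le_sqrt (hT2L i hi)).trans (Real.sqrt_le_sqrt ?_)
    have hc0 : ∀ j ∈ Finset.Ico 1 i, ∫ ω, (w (vertex W j ω) - ∫ x, w x ∂μ) ∂P = 0 := by
      intro j hj
      have hj' := (hmem i hi j hj).1
      rw [integral_sub ((hW.memLp_vertex hj' hwL).integrable one_le_two) (integrable_const _),
        hW.integral_vertex hj' hwm]
      simp
    rw [integral_sq_sum_of_orthogonal _ (hT2t i hi)]
    · have h1 : ∀ j ∈ Finset.Ico 1 i, ∫ ω, (w (vertex W j ω) - ∫ x, w x ∂μ) ^ 2 ∂P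
          ≤ a * ∫ x, V x ∂μ := fun j hj => by
        have hj' := (hmem i hi j hj).1
        have := integral_sq_sub_le (hW.memLp_vertex hj' hwL)
        rw [hW.integral_vertex hj' hwm,
          hW.integral_vertex (f := fun x => w x ^ 2) hj' (hwm.pow_const 2)] at this
        exact this.trans hw2i
      refine (Finset.sum_le_card_nsmul _ _ _ h1).trans ?_
      rw [nsmul_eq_mul]
      exact mul_le_mul_of_nonneg_right (hcard i hi) (mul_nonneg ha (integral_nonneg hV0))
    · intro j hj l hl hjl
      have h : IndepFun (W (Sum.inl j)) (W (Sum.inl l)) P :=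
        hW.indep.indepFun (by simpa using hjl)
      have h2 := (h.comp (hwm.sub_const (∫ x, w x ∂μ))
        (hwm.sub_const (∫ x, w x ∂μ))).integral_fun_mul_eq_mul_integral
        (hT2t i hi j hj).1 (hT2t i hi l hl).1
      simp only [Function.comp_def] at h2
      rw [h2, hc0 j hj, zero_mul]
  have hT3t : ∀ e ∈ E, Integrable (fun ω => edge W e.1 e.2 ω * r (vertex W e.2 ω)) P :=
    fun e he => (hW.integrable_vertex (hmem _ (hE e he).1 _ (hE e he).2).1 hri).bdd_mul (c := 1)
      (hW.measurable _).aestronglyMeasurable (Eventually.of_forall (hW.edge_abs_le _))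
  have hT3i : Integrable T3 P := integrable_finsetSum _ fun e he =>
    (hT3t e he).add (integrable_const _)
  have hT3 : ∫ ω, T3 ω ∂P ≤ 2 * n ^ 2 * p * ∫ x, r x ∂μ := by
    simp only [T3]
    have hi3 : ∀ e ∈ E, Integrable (fun ω => edge W e.1 e.2 ω * r (vertex W e.2 ω)
        + p * ∫ x, r x ∂μ) P := fun e he => (hT3t e he).add (integrable_const _)
    rw [integral_finsetSum _ hi3]
    have h1 : ∀ e ∈ E, ∫ ω, (edge W e.1 e.2 ω * r (vertex W e.2 ω) + p * ∫ x, r x ∂μ) ∂P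
        ≤ 2 * (p * ∫ x, r x ∂μ) := fun e he => by
      obtain ⟨h1, h2⟩ := hE e he
      obtain ⟨h3, h4⟩ := hmem _ h1 _ h2
      rw [integral_add (hT3t e he) (integrable_const _), hW.integral_edge_mul h1 h3 h4
        (Y := fun ω => r (vertex W e.2 ω)) (hrm.comp (hW.measurable_restAlg (by simp))),
        hW.integral_vertex h3 hrm]
      simp only [integral_const, probReal_univ, one_smul]
      linarith
    refine (Finset.sum_le_card_nsmul _ _ _ h1).trans ?_
    rw [nsmul_eq_mul]
    calc _ ≤ (n : ℝ) ^ 2 * (2 * (p * ∫ x, r x ∂μ)) :=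
          mul_le_mul_of_nonneg_right hEcard (by positivity)
      _ = _ := by ring
  have hdecomp : ∀ ω, |∑ i ∈ Finset.Icc 1 n, ∑ j ∈ Finset.Ico 1 i,
      (edge W i j ω * V (vertex W j ω) - p * ∫ x, V x ∂μ)|
      ≤ T3 ω + |T1 ω| + p * ∑ i ∈ Finset.Icc 1 n, |T2 i ω| := by
    intro ω
    have e1 : ∑ i ∈ Finset.Icc 1 n, ∑ j ∈ Finset.Ico 1 i,
        (edge W i j ω * V (vertex W j ω) - p * ∫ x, V x ∂μ)
        = ∑ e ∈ E, (edge W e.1 e.2 ω * r (vertex W e.2 ω) - p * ∫ x, r x ∂μ) + T1 ω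
          + p * ∑ i ∈ Finset.Icc 1 n, T2 i ω := by
      simp only [T1, T2, Finset.mul_sum, E, Finset.sum_sigma, ← Finset.sum_add_distrib]
      refine Finset.sum_congr rfl fun i _ => Finset.sum_congr rfl fun j _ => ?_
      rw [hEV, hwr]; ring
    rw [e1]
    refine (abs_add_three _ _ _).trans (add_le_add (add_le_add ?_ le_rfl) ?_)
    · refine (Finset.abs_sum_le_sum_abs _ _).trans (Finset.sum_le_sum fun e _ => ?_)
      refine (abs_sub _ _).trans (le_of_eq ?_)
      rw [abs_of_nonneg (mul_nonneg (hW.edge_nonneg _ ω) (hr0 _)),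
        abs_of_nonneg (mul_nonneg hp0 hr_nonneg)]
    · rw [abs_mul, abs_of_nonneg hp0]
      exact mul_le_mul_of_nonneg_left (Finset.abs_sum_le_sum_abs _ _) hp0
  have i1 : Integrable (fun ω => |T1 ω|) P := (hT1L.integrable one_le_two).abs
  have i2 : ∀ i ∈ Finset.Icc 1 n, Integrable (fun ω => |T2 i ω|) P := fun i hi =>
    ((hT2L i hi).integrable one_le_two).abs
  have i13 : Integrable (fun ω => T3 ω + |T1 ω|) P := hT3i.add i1
  have i2' : Integrable (fun ω => ∑ i ∈ Finset.Icc 1 n, |T2 i ω|) P := integrable_finsetSum _ i2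
  calc _ ≤ ∫ ω, (T3 ω + |T1 ω| + p * ∑ i ∈ Finset.Icc 1 n, |T2 i ω|) ∂P :=
        integral_mono_of_nonneg (Eventually.of_forall fun _ => abs_nonneg _)
          (i13.add (i2'.const_mul p)) (Eventually.of_forall hdecomp)
    _ = ∫ ω, T3 ω ∂P + ∫ ω, |T1 ω| ∂P + p * ∑ i ∈ Finset.Icc 1 n, ∫ ω, |T2 i ω| ∂P := by
        rw [integral_add i13 (i2'.const_mul p), integral_add hT3i i1, integral_const_mul,
          integral_finsetSum _ i2]
    _ ≤ 2 * n ^ 2 * p * ∫ x, r x ∂μ + √(n ^ 2 * p * (a * ∫ x, V x ∂μ))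
          + p * (n * √(n * (a * ∫ x, V x ∂μ))) := by
        have h := Finset.sum_le_card_nsmul _ _ _ hT2
        rw [nsmul_eq_mul, hcardn] at h
        exact add_le_add (add_le_add hT3 hT1) (mul_le_mul_of_nonneg_left h hp0)
    _ = _ := by ring

/-- The pair `(S_i, X_i)` has the same law for all vertices `i`. -/
theorem identDistrib_degree_mul (hW : IsRow P n μ p 𝒜 W) {i : ℕ} (hi : i ∈ Finset.Icc 1 n)
    {g : ℝ → ℝ} (hg : Measurable g) :
    IdentDistrib (fun ω => degree n W i ω * g (vertex W i ω))
      (fun ω => degree n W 1 ω * g (vertex W 1 ω)) P P := by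
  have hn : 1 ≤ n := (Finset.mem_Icc.1 hi).1.trans (Finset.mem_Icc.1 hi).2
  have h1 : 1 ∈ Finset.Icc 1 n := by simp [hn]
  -- the transposition of `1` and `i` matches the neighbours of `1` with those of `i`
  let τ : Equiv.Perm ℕ := Equiv.swap 1 i
  have hτ : ∀ j ∈ (Finset.Icc 1 n).erase 1, τ j ∈ (Finset.Icc 1 n).erase i := by
    intro j hj
    obtain ⟨hj1, hj⟩ := Finset.mem_erase.1 hj
    refine Finset.mem_erase.2 ⟨fun h => hj1 ?_, ?_⟩
    · have := congrArg τ h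
      simpa [τ] using this
    · by_cases hji : j = i
      · simpa [τ, hji] using hn
      · simpa only [τ, Equiv.swap_apply_of_ne_of_ne hj1 hji] using hj
  have hdeg : ∀ ω, degree n W i ω = ∑ j : (Finset.Icc 1 n).erase 1,
      edge W i (τ j) ω := by
    intro ω
    rw [Finset.univ_eq_attach, Finset.sum_attach _ fun j => edge W i (τ j) ω, degree]
    symm
    refine Finset.sum_bij (fun j _ => τ j) hτ (fun _ _ _ _ h => τ.injective h) ?_ fun _ _ => rfl
    intro b hb
    obtain ⟨hbi, hb⟩ := Finset.mem_erase.1 hb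
    refine ⟨τ b, Finset.mem_erase.2 ⟨fun h => hbi ?_, ?_⟩, by simp [τ]⟩
    · have := congrArg τ h
      simpa [τ] using this
    · by_cases hb1 : b = 1
      · simpa only [τ, hb1, Equiv.swap_apply_left] using hi
      · simpa only [τ, Equiv.swap_apply_of_ne_of_ne hb1 hbi] using hb
  have hdeg1 : ∀ ω, degree n W 1 ω = ∑ j : (Finset.Icc 1 n).erase 1, edge W 1 j ω := by
    intro ω
    rw [Finset.univ_eq_attach, Finset.sum_attach _ fun j => edge W 1 j ω, degree]
  have hinj : Function.Injective fun j : (Finset.Icc 1 n).erase 1 =>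
      (Sum.inr s(i, τ j) : ℕ ⊕ Sym2 ℕ) := fun j l h =>
    Subtype.ext (τ.injective (Sym2.congr_right.1 (Sum.inr.inj h)))
  have hinj1 : Function.Injective fun j : (Finset.Icc 1 n).erase 1 =>
      (Sum.inr s(1, (j : ℕ)) : ℕ ⊕ Sym2 ℕ) :=
    fun j l h => Subtype.ext (Sym2.congr_right.1 (Sum.inr.inj h))
  have hvec := IdentDistrib.pi
    (X := fun j : (Finset.Icc 1 n).erase 1 => edge W i (τ j))
    (Y := fun j : (Finset.Icc 1 n).erase 1 => edge W 1 j)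
    (fun j => hW.identDistrib_edge i hi _ (Finset.mem_of_mem_erase (hτ j j.2))
      (Finset.ne_of_mem_erase (hτ j j.2)).symm 1 h1 _ (Finset.mem_of_mem_erase j.2)
      (Finset.ne_of_mem_erase j.2).symm) (hW.indep.precomp hinj) (hW.indep.precomp hinj1)
  have hsum : IdentDistrib (degree n W i) (degree n W 1) P P := by
    have := hvec.comp (u := fun v : (Finset.Icc 1 n).erase 1 → ℝ => ∑ j, v j)
      (Finset.measurable_sum _ fun j _ => measurable_pi_apply j)
    rw [funext hdeg, funext hdeg1]
    exact this
  have hX : IdentDistrib (vertex W i) (vertex W 1) P P :=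
    ⟨(hW.measurable _).aemeasurable, (hW.measurable _).aemeasurable, by
      rw [hW.map_vertex i hi, hW.map_vertex 1 h1]⟩
  have hpair := hsum.prodMk hX (hW.indepFun_of_measurable (hW.measurable_degree_restAlg i i))
    (hW.indepFun_of_measurable (hW.measurable_degree_restAlg 1 1))
  exact hpair.comp (u := fun z => z.1 * g z.2) (measurable_fst.mul (hg.comp measurable_snd))

end IsRow

end RowTruncation

/-! ### Normal form of the rows of an array -/

theorem edge_comm {Ω : Type*} (W : ℕ ⊕ Sym2 ℕ → Ω → ℝ) (i j : ℕ) : edge W i j = edge W j i := by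
  rw [edge, edge, Sym2.eq_swap]

namespace IncompleteUArray

section Transfer

set_option linter.unusedSectionVars false

variable {Ω : Type*} [mΩ : MeasurableSpace Ω] {P : Measure Ω}

/-- The entries of the `n`-th row of the array as a single family, zero at irrelevant indices. -/
noncomputable def raw (A : IncompleteUArray P) (n : ℕ) : ℕ ⊕ Sym2 ℕ → Ω → ℝ
  | Sum.inl i => if i ∈ Finset.Icc 1 n then A.X n i else fun _ => 0
  | Sum.inr e => if 1 ≤ e.inf ∧ e.inf < e.sup ∧ e.sup ≤ n then A.Z n e.inf e.sup else fun _ => 0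

/-- The σ-algebras generated by the entries of the `n`-th row. -/
@[reducible] noncomputable def rowAlg (A : IncompleteUArray P) (n : ℕ) (a : ℕ ⊕ Sym2 ℕ) :
    MeasurableSpace Ω :=
  MeasurableSpace.comap (A.raw n a) inferInstance

/-- The `n`-th row with every edge variable replaced by the indicator of the value `1`. -/
noncomputable def row (A : IncompleteUArray P) (n : ℕ) : ℕ ⊕ Sym2 ℕ → Ω → ℝ
  | Sum.inl i => A.raw n (Sum.inl i)
  | Sum.inr e => fun ω => if A.raw n (Sum.inr e) ω = 1 then 1 else 0

variable [IsProbabilityMeasure P] (A : IncompleteUArray P) {n : ℕ}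

theorem raw_vertex {i : ℕ} (hi : i ∈ Finset.Icc 1 n) : A.raw n (Sum.inl i) = A.X n i :=
  if_pos hi

theorem raw_edge {i j : ℕ} (hi : i ∈ Finset.Icc 1 n) (hj : j ∈ Finset.Icc 1 n) (hij : i ≠ j) :
    A.raw n (Sum.inr s(i, j)) = A.Z n i j := by
  have hi' := Finset.mem_Icc.1 hi
  have hj' := Finset.mem_Icc.1 hj
  rcases lt_or_gt_of_ne hij with h | h
  · simp only [raw, Sym2.inf_mk, Sym2.sup_mk, inf_eq_left.2 h.le, sup_eq_right.2 h.le]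
    exact if_pos ⟨hi'.1, h, hj'.2⟩
  · simp only [raw, Sym2.inf_mk, Sym2.sup_mk, inf_eq_right.2 h.le, sup_eq_left.2 h.le]
    rw [if_pos ⟨hj'.1, h, hi'.2⟩, A.symm_Z n j hj i hi hij.symm]

theorem row_vertex {i : ℕ} (hi : i ∈ Finset.Icc 1 n) : vertex (A.row n) i = A.X n i :=
  A.raw_vertex hi

theorem row_edge {i j : ℕ} (hi : i ∈ Finset.Icc 1 n) (hj : j ∈ Finset.Icc 1 n) (hij : i ≠ j) :
    edge (A.row n) i j = fun ω => if A.Z n i j ω = 1 then 1 else 0 := by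
  rw [← A.raw_edge hi hj hij]; rfl

theorem rowAlg_vertex {i : ℕ} (hi : i ∈ Finset.Icc 1 n) :
    A.rowAlg n (Sum.inl i) = A.sigmaX n i := by
  rw [rowAlg, A.raw_vertex hi]

theorem rowAlg_edge {i j : ℕ} (hi : i ∈ Finset.Icc 1 n) (hj : j ∈ Finset.Icc 1 n) (hij : i ≠ j) :
    A.rowAlg n (Sum.inr s(i, j)) = A.sigmaZ n i j := by
  rw [rowAlg, A.raw_edge hi hj hij]

theorem measurable_raw (n : ℕ) (a : ℕ ⊕ Sym2 ℕ) : Measurable (A.raw n a) := by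
  rcases a with i | e
  · by_cases hi : i ∈ Finset.Icc 1 n
    · rw [A.raw_vertex hi]; exact A.measurable_X n i hi
    · simp only [raw, if_neg hi]; exact measurable_const
  · by_cases he : 1 ≤ e.inf ∧ e.inf < e.sup ∧ e.sup ≤ n
    · simp only [raw, if_pos he]
      exact A.measurable_Z n _ (Finset.mem_Icc.2 ⟨he.1, he.2.1.le.trans he.2.2⟩) _
        (Finset.mem_Icc.2 ⟨he.1.trans he.2.1.le, he.2.2⟩) he.2.1.ne
    · simp only [raw, if_neg he]; exact measurable_const

theorem iIndepFun_raw (n : ℕ) : iIndepFun (A.raw n) P := by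
  let e : {i : ℕ // i ∈ Finset.Icc 1 n} ⊕ {e : ℕ × ℕ // 1 ≤ e.1 ∧ e.1 < e.2 ∧ e.2 ≤ n} →
      ℕ ⊕ Sym2 ℕ := Sum.map (fun i => i.1) fun e => s(e.1.1, e.1.2)
  have he : Function.Injective e := by
    refine Function.Injective.sumMap Subtype.val_injective ?_
    rintro ⟨⟨a, b⟩, h1, h2, h3⟩ ⟨⟨c, d⟩, h4, h5, h6⟩ h
    simp only [Sym2.eq_iff] at h
    simp only at h1 h2 h3 h4 h5 h6
    simp only [Subtype.mk.injEq, Prod.mk.injEq]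
    omega
  refine iIndepFun_of_const_off_range he ?_ ?_
  · convert! A.indep n using 1
    funext x
    rcases x with i | ⟨⟨a, b⟩, h1, h2, h3⟩
    · exact A.raw_vertex i.2
    · exact A.raw_edge (Finset.mem_Icc.2 ⟨h1, h2.le.trans h3⟩)
        (Finset.mem_Icc.2 ⟨h1.trans h2.le, h3⟩) h2.ne
  · rintro (i | e') hk
    · refine ⟨0, fun ω => ?_⟩
      have hi : i ∉ Finset.Icc 1 n := fun hi => hk ⟨Sum.inl ⟨i, hi⟩, rfl⟩
      simp only [raw, if_neg hi]
    · refine ⟨0, fun ω => ?_⟩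
      have hi : ¬ (1 ≤ e'.inf ∧ e'.inf < e'.sup ∧ e'.sup ≤ n) := fun hi =>
        hk ⟨Sum.inr ⟨(e'.inf, e'.sup), hi⟩, congrArg Sum.inr
          (Sym2.inf_eq_inf_and_sup_eq_sup.1 (by simp [hi.2.1.le]))⟩
      simp only [raw, if_neg hi]

theorem row_edge_ae_eq {i j : ℕ} (hi : i ∈ Finset.Icc 1 n) (hj : j ∈ Finset.Icc 1 n)
    (hij : i ≠ j) : edge (A.row n) i j =ᵐ[P] A.Z n i j := by
  have hlaw := A.law_Z n i hi j hj hij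
  have h : ∀ᵐ x ∂(P.map (A.Z n i j)), x ∈ ({0, 1} : Set ℝ) := by
    rw [hlaw.map_eq, ae_iff]
    exact bernoulliMeasure_apply_of_notMem_of_notMem _
      (((Set.finite_singleton (1 : ℝ)).insert 0).measurableSet.compl) (by simp) (by simp)
  filter_upwards [ae_of_ae_map hlaw.aemeasurable h] with ω hω
  rw [A.row_edge hi hj hij]
  rcases hω with h | h
  · simp [h]
  · simp only [Set.mem_singleton_iff] at h
    simp [h]

theorem isRow (n : ℕ) : IsRow P n (P.map (A.X n 1)) (A.p n) (A.rowAlg n) (A.row n) where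
  le a := (A.measurable_raw n a).comap_le
  indep_alg := (iIndepFun_iff_iIndep _ _ _).1 (A.iIndepFun_raw n)
  measurable_alg a := by
    rcases a with i | e
    · exact comap_measurable _
    · exact Measurable.ite (comap_measurable _ (measurableSet_singleton 1)) measurable_const
        measurable_const
  map_vertex i hi := by
    change P.map (vertex (A.row n) i) = _
    rw [A.row_vertex hi]
    refine (A.identDistrib_X n i hi 1 ?_).map_eq
    rw [Finset.mem_Icc] at hi ⊢; omega
  zero_or_one e ω := by
    change (if _ then _ else _) = _ ∨ (if _ then _ else _) = _
    split_ifs <;> simp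
  integral_edge i hi j hj hij := by
    have hlaw := A.law_Z n i hi j hj hij
    rw [integral_congr_ae (A.row_edge_ae_eq hi hj hij)]
    have := integral_map (f := fun x : ℝ => x) hlaw.aemeasurable (by fun_prop)
    rw [← this, hlaw.map_eq, integral_bernoulliMeasure]
    simp
  identDistrib_edge i hi j hj hij i' hi' j' hj' hij' := by
    have h1 := A.law_Z n i hi j hj hij
    have h2 := A.law_Z n i' hi' j' hj' hij'
    refine ((IdentDistrib.of_ae_eq h1.aemeasurable (A.row_edge_ae_eq hi hj hij).symm).symm).trans
      (IdentDistrib.trans ⟨h1.aemeasurable, h2.aemeasurable, by rw [h1.map_eq, h2.map_eq]⟩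
        (IdentDistrib.of_ae_eq h2.aemeasurable (A.row_edge_ae_eq hi' hj' hij').symm))

theorem rowAlg_le_restAlg (n : ℕ) {a b : ℕ ⊕ Sym2 ℕ} (h : b ≠ a) :
    A.rowAlg n b ≤ restAlg (A.rowAlg n) a :=
  le_iSup₂_of_le (f := fun b (_ : b ∈ ({a}ᶜ : Set (ℕ ⊕ Sym2 ℕ))) => A.rowAlg n b) b
    (by simpa using h) le_rfl

theorem exists_kernel (hn : 2 ≤ n) :
    ∃ k, HoeffdingKernel (P.map (A.X n 1)) k ∧ Function.uncurry k
      =ᵐ[(P.map (A.X n 1)).prod (P.map (A.X n 1))] Function.uncurry (A.h n) := by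
  have h1 : 1 ∈ Finset.Icc 1 n := by simp; omega
  have h2 : 2 ∈ Finset.Icc 1 n := by simp; omega
  have := (A.isRow n).isProbabilityMeasure (by omega)
  have hmap := (A.isRow n).map_vertex_prod h1 h2 (by norm_num)
  have hm : Measurable fun ω => (A.X n 1 ω, A.X n 2 ω) :=
    (A.measurable_X n 1 h1).prodMk (A.measurable_X n 2 h2)
  rw [A.row_vertex h1, A.row_vertex h2] at hmap
  refine exists_hoeffdingKernel_ae_eq (A.measurable_h n) (A.symm_h n) ?_ ?_
  · rw [← hmap, memLp_map_measure_iff (A.measurable_h n).aestronglyMeasurable hm.aemeasurable]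
    exact A.memLp_h n 1 h1 2 h2 (by norm_num)
  · rw [← hmap, integral_map hm.aemeasurable (A.measurable_h n).aestronglyMeasurable]
    exact A.centered_h n 1 h1 2 h2 (by norm_num)

/-! ### The statistics of the array in terms of the normal form -/

theorem hh_ae_eq {k : ℝ → ℝ → ℝ} (hkh : Function.uncurry k
    =ᵐ[(P.map (A.X n 1)).prod (P.map (A.X n 1))] Function.uncurry (A.h n)) {i j : ℕ}
    (hi : i ∈ Finset.Icc 1 n) (hj : j ∈ Finset.Icc 1 n) (hij : i ≠ j) :
    A.hh n i j =ᵐ[P] fun ω => k (vertex (A.row n) i ω) (vertex (A.row n) j ω) := by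
  rw [← (A.isRow n).map_vertex_prod hi hj hij] at hkh
  have := ae_of_ae_map (((A.isRow n).measurable _).prodMk ((A.isRow n).measurable _)).aemeasurable
    hkh
  filter_upwards [this] with ω hω
  simp only [Function.uncurry] at hω
  rw [hω, hh, ← A.row_vertex hi, ← A.row_vertex hj]

theorem Phi_ae_eq {k : ℝ → ℝ → ℝ} (hkh : Function.uncurry k
    =ᵐ[(P.map (A.X n 1)).prod (P.map (A.X n 1))] Function.uncurry (A.h n)) {i j : ℕ}
    (hi : i ∈ Finset.Icc 1 n) (hj : j ∈ Finset.Icc 1 n) (hij : i ≠ j) :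
    A.Phi n i j =ᵐ[P] fun ω => edge (A.row n) i j ω
      * k (vertex (A.row n) i ω) (vertex (A.row n) j ω) := by
  filter_upwards [A.hh_ae_eq hkh hi hj hij, A.row_edge_ae_eq hi hj hij] with ω h1 h2
  rw [Phi, h1, h2]

/-- Conditional expectations given a σ-algebra generated by entries other than `X_j` are computed
by integrating out `X_j`. -/
theorem condExp_row {Ω : Type*} {m mΩ : MeasurableSpace Ω} {P : Measure Ω} [IsProbabilityMeasure P]
    (A : IncompleteUArray P) {n j : ℕ} {α : Type*} [MeasurableSpace α] {U : Ω → α}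
    (hj : j ∈ Finset.Icc 1 n)
    (hm : m ≤ restAlg (A.rowAlg n) (Sum.inl j)) (hU : Measurable[m] U) {f : α × ℝ → ℝ}
    (hf : Measurable f) (hint : Integrable (fun ω => f (U ω, vertex (A.row n) j ω)) P)
    {F : Ω → ℝ} (hF : F =ᵐ[P] fun ω => f (U ω, vertex (A.row n) j ω)) :
    P[F | m] =ᵐ[P] fun ω => ∫ x, f (U ω, x) ∂(P.map (A.X n 1)) := by
  have hW := A.isRow n
  refine (condExp_congr_ae hF).trans ?_
  rw [← hW.map_vertex j hj]
  exact condExp_comp_prod_of_indep (hm.trans (hW.restAlg_le _)) hU (hW.measurable _)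
    (indep_of_indep_of_le_left (hW.indep_restAlg _) hm) hf hint

theorem measurable_row_vertex {i : ℕ} (hi : i ∈ Finset.Icc 1 n) :
    Measurable[A.sigmaX n i] (vertex (A.row n) i) := by
  rw [A.row_vertex hi]; exact comap_measurable _

theorem measurable_row_edge {i j : ℕ} (hi : i ∈ Finset.Icc 1 n) (hj : j ∈ Finset.Icc 1 n)
    (hij : i ≠ j) : Measurable[A.sigmaZ n i j] (edge (A.row n) i j) := by
  rw [← A.rowAlg_edge hi hj hij]; exact (A.isRow n).measurable_alg _

theorem sigmaX_le_restAlg {i : ℕ} (hi : i ∈ Finset.Icc 1 n) {a : ℕ ⊕ Sym2 ℕ}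
    (h : Sum.inl i ≠ a) : A.sigmaX n i ≤ restAlg (A.rowAlg n) a := by
  rw [← A.rowAlg_vertex hi]; exact A.rowAlg_le_restAlg n h

theorem sigmaZ_le_restAlg {i j : ℕ} (hi : i ∈ Finset.Icc 1 n) (hj : j ∈ Finset.Icc 1 n)
    (hij : i ≠ j) {a : ℕ ⊕ Sym2 ℕ} (h : Sum.inr s(i, j) ≠ a) :
    A.sigmaZ n i j ≤ restAlg (A.rowAlg n) a := by
  rw [← A.rowAlg_edge hi hj hij]; exact A.rowAlg_le_restAlg n h

section Identification

variable {k : ℝ → ℝ → ℝ}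

theorem Psi_ae_eq (hk : HoeffdingKernel (P.map (A.X n 1)) k) (hkh : Function.uncurry k
    =ᵐ[(P.map (A.X n 1)).prod (P.map (A.X n 1))] Function.uncurry (A.h n)) {i j : ℕ}
    (hi : i ∈ Finset.Icc 1 n) (hj : j ∈ Finset.Icc 1 n) (hij : i ≠ j) :
    A.Psi n j i =ᵐ[P] fun ω => edge (A.row n) i j ω
      * proj (P.map (A.X n 1)) k (vertex (A.row n) i ω) := by
  have hW := A.isRow n
  have hm : A.sigmaX n i ⊔ A.sigmaZ n i j ≤ restAlg (A.rowAlg n) (Sum.inl j) :=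
    sup_le (A.sigmaX_le_restAlg hi (by simpa using hij))
      (A.sigmaZ_le_restAlg hi hj hij (by simp))
  have hU : Measurable[A.sigmaX n i ⊔ A.sigmaZ n i j]
      fun ω => (edge (A.row n) i j ω, vertex (A.row n) i ω) :=
    ((A.measurable_row_edge hi hj hij).mono le_sup_right le_rfl).prodMk
      ((A.measurable_row_vertex hi).mono le_sup_left le_rfl)
  have hf : Measurable fun w : (ℝ × ℝ) × ℝ => w.1.1 * k w.1.2 w.2 := by
    have : Measurable fun w : (ℝ × ℝ) × ℝ => (w.1.2, w.2) := by fun_prop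
    exact (measurable_fst.comp measurable_fst).mul (hk.measurable.comp this)
  have hL := memLp_bdd_mul (hW.memLp_vertex_prod hi hj hij hk.memLp) (hW.measurable _)
    (hW.edge_abs_le s(i, j))
  refine (A.condExp_row hj hm hU hf (hL.integrable one_le_two)
    (A.Phi_ae_eq hkh hi hj hij)).trans (Eventually.of_forall fun ω => ?_)
  simp only [integral_const_mul, proj]

theorem PhiTilde_ae_eq (hk : HoeffdingKernel (P.map (A.X n 1)) k) (hkh : Function.uncurry k
    =ᵐ[(P.map (A.X n 1)).prod (P.map (A.X n 1))] Function.uncurry (A.h n)) {i j : ℕ}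
    (hi : i ∈ Finset.Icc 1 n) (hj : j ∈ Finset.Icc 1 n) (hij : i ≠ j) :
    A.PhiTilde n i j =ᵐ[P] fun ω => edge (A.row n) i j ω
      * degen (P.map (A.X n 1)) k (vertex (A.row n) i ω) (vertex (A.row n) j ω) := by
  filter_upwards [A.Phi_ae_eq hkh hi hj hij, A.Psi_ae_eq hk hkh hi hj hij,
    A.Psi_ae_eq hk hkh hj hi hij.symm] with ω h1 h2 h3
  rw [PhiTilde, h1, h2, h3, edge_comm (A.row n) j i, degen]
  ring

theorem xi_ae_eq (hk : HoeffdingKernel (P.map (A.X n 1)) k) (hkh : Function.uncurry k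
    =ᵐ[(P.map (A.X n 1)).prod (P.map (A.X n 1))] Function.uncurry (A.h n)) {i : ℕ}
    (hi : i ∈ Finset.Icc 1 n) :
    A.xi n i =ᵐ[P] fun ω => 1 / (n * A.theta n)
      * increment n (P.map (A.X n 1)) k (A.row n) i ω := by
  have h1 : ∀ᵐ ω ∂P, ∀ j ∈ (Finset.Icc 1 n).erase i, A.Psi n j i ω = edge (A.row n) i j ω
      * proj (P.map (A.X n 1)) k (vertex (A.row n) i ω) :=
    (Finset.eventually_all _).2 fun j hj => A.Psi_ae_eq hk hkh hi (Finset.mem_of_mem_erase hj)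
      (Finset.ne_of_mem_erase hj).symm
  have h2 : ∀ᵐ ω ∂P, ∀ j ∈ Finset.Ico 1 i, A.PhiTilde n i j ω = edge (A.row n) i j ω
      * degen (P.map (A.X n 1)) k (vertex (A.row n) i ω) (vertex (A.row n) j ω) :=
    (Finset.eventually_all _).2 fun j hj => A.PhiTilde_ae_eq hk hkh hi
      (IsRow.mem_Icc_of_mem_Ico hi hj).1 (IsRow.mem_Icc_of_mem_Ico hi hj).2
  filter_upwards [h1, h2] with ω h1 h2
  rw [xi, Finset.sum_congr rfl h1, Finset.sum_congr rfl h2, ← Finset.sum_mul, ← mul_add]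
  rfl

theorem hTilde_ae_eq (hk : HoeffdingKernel (P.map (A.X n 1)) k) (hkh : Function.uncurry k
    =ᵐ[(P.map (A.X n 1)).prod (P.map (A.X n 1))] Function.uncurry (A.h n)) {i j : ℕ}
    (hi : i ∈ Finset.Icc 1 n) (hj : j ∈ Finset.Icc 1 n) (hij : i ≠ j) :
    A.hTilde n i j =ᵐ[P] fun ω =>
      degen (P.map (A.X n 1)) k (vertex (A.row n) i ω) (vertex (A.row n) j ω) := by
  have hW := A.isRow n
  have hL := (hW.memLp_vertex_prod hi hj hij hk.memLp).integrable one_le_two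
  have h0 := A.hh_ae_eq hkh hi hj hij
  have h1 := A.condExp_row hj (A.sigmaX_le_restAlg hi (by simpa using hij))
    (A.measurable_row_vertex hi) hk.measurable hL h0
  have e : (fun ω => k (vertex (A.row n) i ω) (vertex (A.row n) j ω))
      = fun ω => Function.uncurry k (vertex (A.row n) j ω, vertex (A.row n) i ω) :=
    funext fun ω => hk.symm _ _
  have h2 := A.condExp_row hi (A.sigmaX_le_restAlg hj (by simpa using hij.symm))
    (A.measurable_row_vertex hj) hk.measurable (hL.congr (Eventually.of_forall (congrFun e)))
    (h0.trans (Eventually.of_forall (congrFun e)))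
  filter_upwards [h0, h1, h2] with ω h0 h1 h2
  rw [hTilde, h0, h1, h2]
  rfl

theorem HTilde_ae_eq (hn : 2 ≤ n) (hk : HoeffdingKernel (P.map (A.X n 1)) k)
    (hkh : Function.uncurry k
      =ᵐ[(P.map (A.X n 1)).prod (P.map (A.X n 1))] Function.uncurry (A.h n)) :
    A.HTilde n 2 1 1 =ᵐ[P] fun ω =>
      gram (P.map (A.X n 1)) (degen (P.map (A.X n 1)) k) (vertex (A.row n) 1 ω)
        (vertex (A.row n) 1 ω) := by
  have h1 : 1 ∈ Finset.Icc 1 n := by simp; omega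
  have h2 : 2 ∈ Finset.Icc 1 n := by simp; omega
  have hW := A.isRow n
  have := hW.isProbabilityMeasure (by omega)
  have ht := hk.degenerate
  have h0 := A.hTilde_ae_eq hk hkh h1 h2 (by norm_num)
  have hm : A.sigmaX n 1 ⊔ A.sigmaX n 1 ≤ restAlg (A.rowAlg n) (Sum.inl 2) :=
    sup_le (A.sigmaX_le_restAlg h1 (by simp)) (A.sigmaX_le_restAlg h1 (by simp))
  have hL := hW.memLp_vertex_prod h1 h2 (by norm_num) ht.memLp
  have h := A.condExp_row (F := fun ω => A.hTilde n 1 2 ω * A.hTilde n 1 2 ω) h2 hm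
    ((A.measurable_row_vertex h1).mono le_sup_left le_rfl)
    (f := fun w => degen (P.map (A.X n 1)) k w.1 w.2 * degen (P.map (A.X n 1)) k w.1 w.2)
    (ht.measurable.mul ht.measurable) (hL.integrable_mul hL) (by
      filter_upwards [h0] with ω h0
      rw [h0])
  refine h.trans (Eventually.of_forall fun ω => ?_)
  simp only [gram, ht.symm _ (vertex (A.row n) 1 ω)]

theorem G_ae_eq (hn : 3 ≤ n) (hk : HoeffdingKernel (P.map (A.X n 1)) k)
    (hkh : Function.uncurry k
      =ᵐ[(P.map (A.X n 1)).prod (P.map (A.X n 1))] Function.uncurry (A.h n)) :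
    A.G n 1 2 3 =ᵐ[P] fun ω => edge (A.row n) 2 1 ω * (edge (A.row n) 3 1 ω
      * gram (P.map (A.X n 1)) k (vertex (A.row n) 2 ω) (vertex (A.row n) 3 ω)) := by
  have h1 : 1 ∈ Finset.Icc 1 n := by simp; omega
  have h2 : 2 ∈ Finset.Icc 1 n := by simp; omega
  have h3 : 3 ∈ Finset.Icc 1 n := by simp; omega
  have h21 : (2 : ℕ) ≠ 1 := by norm_num
  have h31 : (3 : ℕ) ≠ 1 := by norm_num
  have hW := A.isRow n
  have := hW.isProbabilityMeasure (by omega)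
  have hm : A.sigmaX n 2 ⊔ A.sigmaX n 3 ⊔ A.sigmaZ n 2 1 ⊔ A.sigmaZ n 3 1
      ≤ restAlg (A.rowAlg n) (Sum.inl 1) :=
    sup_le (sup_le (sup_le (A.sigmaX_le_restAlg h2 (by simp)) (A.sigmaX_le_restAlg h3 (by simp)))
      (A.sigmaZ_le_restAlg h2 h1 h21 (by simp))) (A.sigmaZ_le_restAlg h3 h1 h31 (by simp))
  have hle2 : A.sigmaX n 2 ≤ A.sigmaX n 2 ⊔ A.sigmaX n 3 ⊔ A.sigmaZ n 2 1 ⊔ A.sigmaZ n 3 1 :=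
    le_sup_left.trans (le_sup_left.trans le_sup_left)
  have hle3 : A.sigmaX n 3 ≤ A.sigmaX n 2 ⊔ A.sigmaX n 3 ⊔ A.sigmaZ n 2 1 ⊔ A.sigmaZ n 3 1 :=
    le_sup_right.trans (le_sup_left.trans le_sup_left)
  have hle21 : A.sigmaZ n 2 1 ≤ A.sigmaX n 2 ⊔ A.sigmaX n 3 ⊔ A.sigmaZ n 2 1 ⊔ A.sigmaZ n 3 1 :=
    le_sup_right.trans le_sup_left
  have hle31 : A.sigmaZ n 3 1 ≤ A.sigmaX n 2 ⊔ A.sigmaX n 3 ⊔ A.sigmaZ n 2 1 ⊔ A.sigmaZ n 3 1 :=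
    le_sup_right
  have hU : Measurable[A.sigmaX n 2 ⊔ A.sigmaX n 3 ⊔ A.sigmaZ n 2 1 ⊔ A.sigmaZ n 3 1]
      fun ω => ((edge (A.row n) 2 1 ω, vertex (A.row n) 2 ω),
        (edge (A.row n) 3 1 ω, vertex (A.row n) 3 ω)) :=
    (((A.measurable_row_edge h2 h1 h21).mono hle21 le_rfl).prodMk
      ((A.measurable_row_vertex h2).mono hle2 le_rfl)).prodMk
    (((A.measurable_row_edge h3 h1 h31).mono hle31 le_rfl).prodMk
      ((A.measurable_row_vertex h3).mono hle3 le_rfl))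
  have hf : Measurable fun w : ((ℝ × ℝ) × (ℝ × ℝ)) × ℝ =>
      (w.1.1.1 * k w.1.1.2 w.2) * (w.1.2.1 * k w.1.2.2 w.2) := by
    have e1 : Measurable fun w : ((ℝ × ℝ) × (ℝ × ℝ)) × ℝ => (w.1.1.2, w.2) := by fun_prop
    have e2 : Measurable fun w : ((ℝ × ℝ) × (ℝ × ℝ)) × ℝ => (w.1.2.2, w.2) := by fun_prop
    exact (Measurable.mul (by fun_prop) (hk.measurable.comp e1)).mul
      (Measurable.mul (by fun_prop) (hk.measurable.comp e2))
  have hL := fun (i : ℕ) (hi : i ∈ Finset.Icc 1 n) (hi1 : i ≠ 1) =>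
    memLp_bdd_mul (hW.memLp_vertex_prod hi h1 hi1 hk.memLp) (hW.measurable _)
      (hW.edge_abs_le s(i, 1))
  have hL2 := hL 2 h2 h21
  have hL3 := hL 3 h3 h31
  have hF : (fun ω => A.Phi n 2 1 ω * A.Phi n 3 1 ω) =ᵐ[P] fun ω =>
      (edge (A.row n) 2 1 ω * k (vertex (A.row n) 2 ω) (vertex (A.row n) 1 ω))
        * (edge (A.row n) 3 1 ω * k (vertex (A.row n) 3 ω) (vertex (A.row n) 1 ω)) := by
    filter_upwards [A.Phi_ae_eq hkh h2 h1 h21, A.Phi_ae_eq hkh h3 h1 h31] with ω e1 e2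
    rw [e1, e2]
  have hcond := A.condExp_row h1 hm hU hf (hL2.integrable_mul hL3) hF
  refine hcond.trans (Eventually.of_forall fun ω => ?_)
  have e : ∀ x, edge (A.row n) 2 1 ω * k (vertex (A.row n) 2 ω) x
      * (edge (A.row n) 3 1 ω * k (vertex (A.row n) 3 ω) x)
      = edge (A.row n) 2 1 ω * (edge (A.row n) 3 1 ω
        * (k x (vertex (A.row n) 2 ω) * k x (vertex (A.row n) 3 ω))) := fun x => by
    rw [hk.symm x, hk.symm x]; ring
  simp only [e, integral_const_mul, gram]

theorem integral_G_sq (hn : 3 ≤ n) (hk : HoeffdingKernel (P.map (A.X n 1)) k)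
    (hkh : Function.uncurry k
      =ᵐ[(P.map (A.X n 1)).prod (P.map (A.X n 1))] Function.uncurry (A.h n)) :
    ∫ ω, A.G n 1 2 3 ω ^ 2 ∂P
      = (A.p n : ℝ) ^ 2 * kernelSq (P.map (A.X n 1)) (gram (P.map (A.X n 1)) k) := by
  have h1 : 1 ∈ Finset.Icc 1 n := by simp; omega
  have h2 : 2 ∈ Finset.Icc 1 n := by simp; omega
  have h3 : 3 ∈ Finset.Icc 1 n := by simp; omega
  have h21 : (2 : ℕ) ≠ 1 := by norm_num
  have h31 : (3 : ℕ) ≠ 1 := by norm_num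
  have hW := A.isRow n
  have := hW.isProbabilityMeasure (by omega)
  have hG := A.G_ae_eq hn hk hkh
  have hg := hk.measurable_gram
  have hmg : ∀ a : Sym2 ℕ, Measurable[restAlg (A.rowAlg n) (Sum.inr a)] fun ω =>
      gram (P.map (A.X n 1)) k (vertex (A.row n) 2 ω) (vertex (A.row n) 3 ω) ^ 2 := fun a =>
    (hg.comp ((hW.measurable_restAlg (b := Sum.inl 2) (by simp)).prodMk
      (hW.measurable_restAlg (b := Sum.inl 3) (by simp)))).pow_const 2
  have hG2 : ∫ ω, A.G n 1 2 3 ω ^ 2 ∂P = ∫ ω, (edge (A.row n) 2 1 ω * (edge (A.row n) 3 1 ω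
      * gram (P.map (A.X n 1)) k (vertex (A.row n) 2 ω) (vertex (A.row n) 3 ω))) ^ 2 ∂P := by
    refine integral_congr_ae ?_
    filter_upwards [hG] with ω hω
    rw [hω]
  have hY : Measurable[restAlg (A.rowAlg n) (Sum.inr s(2, 1))] fun ω => edge (A.row n) 3 1 ω
      * gram (P.map (A.X n 1)) k (vertex (A.row n) 2 ω) (vertex (A.row n) 3 ω) ^ 2 :=
    (hW.measurable_restAlg (b := Sum.inr s(3, 1)) (by simp)).mul (hmg _)
  rw [hG2]
  simp_rw [mul_pow, hW.edge_sq]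
  rw [hW.integral_edge_mul h2 h1 h21 hY, hW.integral_edge_mul h3 h1 h31 (hmg _),
    hW.integral_vertex_prod (f := fun z => gram (P.map (A.X n 1)) k z.1 z.2 ^ 2) h2 h3
      (by norm_num) (hg.pow_const 2), kernelSq]
  ring

theorem betaSq_eq (hn : 2 ≤ n) (hk : HoeffdingKernel (P.map (A.X n 1)) k)
    (hkh : Function.uncurry k
      =ᵐ[(P.map (A.X n 1)).prod (P.map (A.X n 1))] Function.uncurry (A.h n)) :
    A.betaSq n = A.p n * kernelSq (P.map (A.X n 1)) k := by
  have h1 : 1 ∈ Finset.Icc 1 n := by simp; omega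
  have h2 : 2 ∈ Finset.Icc 1 n := by simp; omega
  have h12 : (1 : ℕ) ≠ 2 := by norm_num
  have hW := A.isRow n
  have e : A.betaSq n = ∫ ω, edge (A.row n) 1 2 ω
      * k (vertex (A.row n) 1 ω) (vertex (A.row n) 2 ω) ^ 2 ∂P := by
    refine integral_congr_ae ?_
    filter_upwards [A.Phi_ae_eq hkh h1 h2 h12] with ω hω
    rw [hω, mul_pow, hW.edge_sq]
  have hY : Measurable[restAlg (A.rowAlg n) (Sum.inr s(1, 2))]
      fun ω => k (vertex (A.row n) 1 ω) (vertex (A.row n) 2 ω) ^ 2 :=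
    (hk.measurable.comp ((hW.measurable_restAlg (b := Sum.inl 1) (by simp)).prodMk
      (hW.measurable_restAlg (b := Sum.inl 2) (by simp)))).pow_const 2
  rw [e, hW.integral_edge_mul h1 h2 h12 hY, hW.integral_vertex_prod
    (f := fun z => k z.1 z.2 ^ 2) h1 h2 h12 (hk.measurable.pow_const 2), kernelSq]

theorem gammaSq_eq (hn : 2 ≤ n) (hk : HoeffdingKernel (P.map (A.X n 1)) k)
    (hkh : Function.uncurry k
      =ᵐ[(P.map (A.X n 1)).prod (P.map (A.X n 1))] Function.uncurry (A.h n)) :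
    A.gammaSq n = A.p n * projSq (P.map (A.X n 1)) k := by
  have h1 : 1 ∈ Finset.Icc 1 n := by simp; omega
  have h2 : 2 ∈ Finset.Icc 1 n := by simp; omega
  have h12 : (1 : ℕ) ≠ 2 := by norm_num
  have hW := A.isRow n
  have := hW.isProbabilityMeasure (by omega)
  have e : A.gammaSq n = ∫ ω, edge (A.row n) 1 2 ω
      * proj (P.map (A.X n 1)) k (vertex (A.row n) 1 ω) ^ 2 ∂P := by
    refine integral_congr_ae ?_
    filter_upwards [A.Psi_ae_eq hk hkh h1 h2 h12] with ω hω
    rw [hω, mul_pow, hW.edge_sq]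
  rw [e, hW.integral_edge_mul h1 h2 h12, hW.integral_vertex
    (f := fun x => proj (P.map (A.X n 1)) k x ^ 2) h1 (hk.measurable_proj.pow_const 2), projSq]
  exact (hk.measurable_proj.comp (hW.measurable_restAlg (by simp))).pow_const 2

theorem theta_sq (hn : 2 ≤ n) (hk : HoeffdingKernel (P.map (A.X n 1)) k)
    (hkh : Function.uncurry k
      =ᵐ[(P.map (A.X n 1)).prod (P.map (A.X n 1))] Function.uncurry (A.h n)) :
    A.theta n ^ 2 = n * (A.p n : ℝ) ^ 2 * projSq (P.map (A.X n 1)) k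
      + A.p n * kernelSq (P.map (A.X n 1)) k / 2 := by
  have hp := (A.p n).2.1
  rw [theta, Real.sq_sqrt, A.betaSq_eq hn hk hkh, A.gammaSq_eq hn hk hkh]
  · ring
  · rw [A.betaSq_eq hn hk hkh, A.gammaSq_eq hn hk hkh]
    have h1 := projSq_nonneg (P.map (A.X n 1)) k
    have h2 := kernelSq_nonneg (P.map (A.X n 1)) k
    positivity

/-! ### The hypotheses in terms of the normal form -/

theorem integral_indicator_sum_Psi (hk : HoeffdingKernel (P.map (A.X n 1)) k)
    (hkh : Function.uncurry k
      =ᵐ[(P.map (A.X n 1)).prod (P.map (A.X n 1))] Function.uncurry (A.h n)) (hn : 2 ≤ n)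
    (c : ℝ) :
    ∫ ω, {ω' | c ≤ |∑ j ∈ Finset.Icc 2 n, A.Psi n j 1 ω'|}.indicator
        (fun ω' => (∑ j ∈ Finset.Icc 2 n, A.Psi n j 1 ω') ^ 2) ω ∂P
      = ∫ ω, (if c ≤ |degree n (A.row n) 1 ω
            * proj (P.map (A.X n 1)) k (vertex (A.row n) 1 ω)|
          then (degree n (A.row n) 1 ω
            * proj (P.map (A.X n 1)) k (vertex (A.row n) 1 ω)) ^ 2 else 0) ∂P := by
  have h1 : 1 ∈ Finset.Icc 1 n := by simp; omega
  have hE : Finset.Icc 2 n = (Finset.Icc 1 n).erase 1 := by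
    ext j; simp only [Finset.mem_Icc, Finset.mem_erase]; omega
  have h : ∀ᵐ ω ∂P, ∀ j ∈ (Finset.Icc 1 n).erase 1, A.Psi n j 1 ω = edge (A.row n) 1 j ω
      * proj (P.map (A.X n 1)) k (vertex (A.row n) 1 ω) :=
    (Finset.eventually_all _).2 fun j hj => A.Psi_ae_eq hk hkh h1 (Finset.mem_of_mem_erase hj)
      (Finset.ne_of_mem_erase hj).symm
  refine integral_congr_ae ?_
  filter_upwards [h] with ω h
  have hs : ∑ j ∈ Finset.Icc 2 n, A.Psi n j 1 ω = degree n (A.row n) 1 ω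
      * proj (P.map (A.X n 1)) k (vertex (A.row n) 1 ω) := by
    rw [hE, Finset.sum_congr rfl h, ← Finset.sum_mul]
    rfl
  simp only [Set.indicator_apply, Set.mem_ofPred_eq, hs]

theorem integral_indicator_PhiTilde (hk : HoeffdingKernel (P.map (A.X n 1)) k)
    (hkh : Function.uncurry k
      =ᵐ[(P.map (A.X n 1)).prod (P.map (A.X n 1))] Function.uncurry (A.h n)) (hn : 2 ≤ n)
    {τ : ℝ} (hτ : 0 < τ) :
    ∫ ω, {ω' | τ ≤ |A.PhiTilde n 1 2 ω'|}.indicator (fun ω' => A.PhiTilde n 1 2 ω' ^ 2) ω ∂P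
      = A.p n * ∫ z, (if τ ≤ |degen (P.map (A.X n 1)) k z.1 z.2|
          then degen (P.map (A.X n 1)) k z.1 z.2 ^ 2 else 0)
            ∂((P.map (A.X n 1)).prod (P.map (A.X n 1))) := by
  have h1 : 1 ∈ Finset.Icc 1 n := by simp; omega
  have h2 : 2 ∈ Finset.Icc 1 n := by simp; omega
  have h12 : (1 : ℕ) ≠ 2 := by norm_num
  have hW := A.isRow n
  have := hW.isProbabilityMeasure (by omega)
  have hm := hk.measurable_degen
  have hψ : Measurable fun z : ℝ × ℝ => if τ ≤ |degen (P.map (A.X n 1)) k z.1 z.2|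
      then degen (P.map (A.X n 1)) k z.1 z.2 ^ 2 else 0 :=
    Measurable.ite (measurableSet_le measurable_const hm.abs) (hm.pow_const 2) measurable_const
  have hY : Measurable[restAlg (A.rowAlg n) (Sum.inr s(1, 2))] fun ω =>
      if τ ≤ |degen (P.map (A.X n 1)) k (vertex (A.row n) 1 ω) (vertex (A.row n) 2 ω)|
        then degen (P.map (A.X n 1)) k (vertex (A.row n) 1 ω) (vertex (A.row n) 2 ω) ^ 2
        else 0 :=
    hψ.comp ((hW.measurable_restAlg (b := Sum.inl 1) (by simp)).prodMk
      (hW.measurable_restAlg (b := Sum.inl 2) (by simp)))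
  rw [← hW.integral_vertex_prod h1 h2 h12 hψ, ← hW.integral_edge_mul h1 h2 h12 hY]
  refine integral_congr_ae ?_
  filter_upwards [A.PhiTilde_ae_eq hk hkh h1 h2 h12] with ω hω
  simp only [Set.indicator_apply, Set.mem_ofPred_eq, hω]
  rcases hW.zero_or_one s(1, 2) ω with h | h <;> simp [h, hτ.not_ge]

theorem integral_indicator_HTilde (hk : HoeffdingKernel (P.map (A.X n 1)) k)
    (hkh : Function.uncurry k
      =ᵐ[(P.map (A.X n 1)).prod (P.map (A.X n 1))] Function.uncurry (A.h n)) (hn : 2 ≤ n)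
    (a : ℝ) :
    ∫ ω, {ω' | a ≤ |A.HTilde n 2 1 1 ω'|}.indicator (fun ω' => A.HTilde n 2 1 1 ω') ω ∂P
      = ∫ x, (if a ≤ gram (P.map (A.X n 1)) (degen (P.map (A.X n 1)) k) x x
          then gram (P.map (A.X n 1)) (degen (P.map (A.X n 1)) k) x x else 0)
            ∂(P.map (A.X n 1)) := by
  have h1 : 1 ∈ Finset.Icc 1 n := by simp; omega
  have hW := A.isRow n
  have := hW.isProbabilityMeasure (by omega)
  have hm : Measurable fun x =>
      gram (P.map (A.X n 1)) (degen (P.map (A.X n 1)) k) x x :=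
    hk.degenerate.measurable_gram.comp (measurable_id.prodMk measurable_id)
  have hψ : Measurable fun x => if a ≤ gram (P.map (A.X n 1)) (degen (P.map (A.X n 1)) k) x x
      then gram (P.map (A.X n 1)) (degen (P.map (A.X n 1)) k) x x else 0 :=
    Measurable.ite (measurableSet_le measurable_const hm) hm measurable_const
  rw [← hW.integral_vertex h1 hψ]
  refine integral_congr_ae ?_
  filter_upwards [A.HTilde_ae_eq hn hk hkh] with ω hω
  simp only [Set.indicator_apply, Set.mem_ofPred_eq, hω, abs_of_nonneg (gram_self_nonneg _ _ _)]

theorem filt_le_restAlg {i : ℕ} (hi : i ∈ Finset.Icc 1 n) :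
    A.filt n (i - 1) ≤ restAlg (A.rowAlg n) (Sum.inl i) := by
  have hi' := Finset.mem_Icc.1 hi
  refine sup_le (iSup₂_le fun l hl => ?_) (iSup₂_le fun l hl => iSup₂_le fun m hm => ?_)
  · have hl' := Finset.mem_Icc.1 hl
    refine A.sigmaX_le_restAlg (Finset.mem_Icc.2 ⟨hl'.1, by omega⟩) ?_
    simp only [ne_eq, Sum.inl.injEq]; omega
  · have hl' := Finset.mem_Icc.1 hl
    exact A.sigmaZ_le_restAlg (Finset.mem_Icc.2 ⟨hl'.1, by omega⟩) (Finset.mem_of_mem_erase hm)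
      (Finset.ne_of_mem_erase hm).symm (by simp)

theorem measurable_condMain (hn : 2 ≤ n) (hk : HoeffdingKernel (P.map (A.X n 1)) k) {i : ℕ}
    (hi : i ∈ Finset.Icc 1 n) :
    Measurable[A.filt n (i - 1)] (condMain P n (P.map (A.X n 1)) k (A.row n) i) := by
  have := (A.isRow n).isProbabilityMeasure (by omega)
  have hm : Measurable fun x =>
      gram (P.map (A.X n 1)) (degen (P.map (A.X n 1)) k) x x :=
    hk.degenerate.measurable_gram.comp (measurable_id.prodMk measurable_id)
  refine Measurable.add measurable_const (Finset.measurable_sum _ fun j hj => Measurable.mul ?_ ?_)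
  · obtain ⟨h1, h2⟩ := IsRow.mem_Icc_of_mem_Ico hi hj
    have hj' := Finset.mem_Ico.1 hj
    rw [edge_comm (A.row n) i j]
    refine (A.measurable_row_edge h1 hi h2.symm).mono (le_sup_of_le_right ?_) le_rfl
    exact le_iSup₂_of_le j (Finset.mem_Icc.2 ⟨hj'.1, by omega⟩)
      (le_iSup₂_of_le (f := fun m (_ : m ∈ (Finset.Icc 1 n).erase j) => A.sigmaZ n j m) i
        (Finset.mem_erase.2 ⟨h2, hi⟩) le_rfl)
  · obtain ⟨h1, h2⟩ := IsRow.mem_Icc_of_mem_Ico hi hj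
    have hj' := Finset.mem_Ico.1 hj
    refine hm.comp ((A.measurable_row_vertex h1).mono (le_sup_of_le_left ?_) le_rfl)
    exact le_iSup₂_of_le (f := fun m (_ : m ∈ Finset.Icc 1 (i - 1)) => A.sigmaX n m) j
      (Finset.mem_Icc.2 ⟨hj'.1, by omega⟩) le_rfl

end Identification

end Transfer

end IncompleteUArray

/-! ### Convergence in measure and numerical estimates -/

theorem tendstoInMeasure_of_integral_abs {Ω : Type*} [MeasurableSpace Ω] {P : Measure Ω}
    [IsProbabilityMeasure P] {f : ℕ → Ω → ℝ} {c : ℝ} (hf : ∀ n, Integrable (f n) P)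
    (h : Tendsto (fun n => ∫ ω, |f n ω - c| ∂P) atTop (𝓝 0)) :
    TendstoInMeasure P f atTop fun _ => c := by
  refine tendstoInMeasure_iff_measureReal_norm.2 fun ε hε => ?_
  refine squeeze_zero (fun n => measureReal_nonneg) (fun n => ?_) (by simpa using h.div_const ε)
  rw [le_div_iff₀' hε]
  exact mul_meas_ge_le_integral_of_nonneg (Eventually.of_forall fun ω => abs_nonneg _)
    ((hf n).sub (integrable_const c)).abs ε

/-- A nonnegative sequence tends to zero if it is eventually dominated by sequences whose limits
are arbitrarily small. -/
theorem tendsto_zero_of_forall_eventually_le {f : ℕ → ℝ} (hf : ∀ n, 0 ≤ f n) {b : ℝ → ℝ}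
    (hb : Tendsto b (𝓝[>] 0) (𝓝 0))
    (hfg : ∀ δ, 0 < δ → ∃ g : ℕ → ℝ, Tendsto g atTop (𝓝 (b δ)) ∧ ∀ᶠ n in atTop, f n ≤ g n) :
    Tendsto f atTop (𝓝 0) := by
  rw [tendsto_order]
  refine ⟨fun a ha => Eventually.of_forall fun n => ha.trans_le (hf n), fun a ha => ?_⟩
  obtain ⟨δ, hδa, hδ⟩ := ((hb.eventually_lt_const ha).and self_mem_nhdsWithin).exists
  obtain ⟨g, hg, hfg⟩ := hfg δ hδ
  filter_upwards [hfg, hg.eventually_lt_const hδa] with n h1 h2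
  exact h1.trans_lt h2

/-- The error terms of the conditional variance, divided by the variance, are controlled by the
mean degree `n p` and by the ratio `p² ‖gram‖² / θ⁴`. -/
theorem condVar_error_le {n p θ G H C K D : ℝ} (hn : 0 < n) (hp : 0 < p) (hnp : 1 ≤ n * p)
    (hθ : 0 < θ) (hG : 0 ≤ G) (hH : 0 ≤ H) (hK : 0 ≤ K)
    (hvar : θ ^ 2 = n * p ^ 2 * G + p * H / 2) (hC : C ^ 2 ≤ K * G ^ 2) (hD : D ≤ 25 * K) :
    n * ((2 * (n * p) + 2 * (n * p) * √(n * p)) * G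
        + 2 * √((n * p + (n * p) ^ 2) * (n * p * C)) + 2 * √((n * p) ^ 2 * D))
      ≤ (n * θ) ^ 2 * (4 / √(n * p) + 2 * √(2 * √(1 / θ ^ 4 * (p ^ 2 * K)))
        + 10 * √(1 / θ ^ 4 * (p ^ 2 * K))) := by
  have hκ0 := Real.sqrt_nonneg K
  have hκ := Real.sq_sqrt hK
  set κ := √K
  have hL0 : 0 < n * p := by linarith
  have hρ : √(1 / θ ^ 4 * (p ^ 2 * K)) = p * κ / θ ^ 2 := by
    rw [← hκ, show 1 / θ ^ 4 * (p ^ 2 * κ ^ 2) = (p * κ / θ ^ 2) ^ 2 by field_simp,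
      Real.sqrt_sq (by positivity)]
  have hG1 : n * p ^ 2 * G ≤ θ ^ 2 := by
    have : 0 ≤ p * H / 2 := by positivity
    linarith
  have hC1 : C ≤ κ * G := by
    refine (le_abs_self _).trans (abs_le_of_sq_le_sq ?_ (by positivity))
    rw [mul_pow, hκ]; exact hC
  rw [hρ]
  have hs : √(n * p) ^ 2 = n * p := Real.sq_sqrt hL0.le
  have hs1 : 1 ≤ √(n * p) := Real.one_le_sqrt.2 hnp
  have e1 : n * ((2 * (n * p) + 2 * (n * p) * √(n * p)) * G) ≤ (n * θ) ^ 2 * (4 / √(n * p)) := by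
    rw [mul_div_assoc', le_div_iff₀ (by linarith)]
    have h1 : (2 * (n * p) + 2 * (n * p) * √(n * p)) * √(n * p) ≤ 4 * (n * p) ^ 2 := by
      have h2 : √(n * p) ≤ n * p := by nlinarith
      calc (2 * (n * p) + 2 * (n * p) * √(n * p)) * √(n * p)
          = 2 * (n * p) * (√(n * p) + √(n * p) ^ 2) := by ring
        _ ≤ 2 * (n * p) * (n * p + n * p) := by gcongr; exact hs.le
        _ = 4 * (n * p) ^ 2 := by ring
    calc n * ((2 * (n * p) + 2 * (n * p) * √(n * p)) * G) * √(n * p)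
        = n * G * ((2 * (n * p) + 2 * (n * p) * √(n * p)) * √(n * p)) := by ring
      _ ≤ n * G * (4 * (n * p) ^ 2) := by gcongr
      _ = 4 * n ^ 2 * (n * p ^ 2 * G) := by ring
      _ ≤ 4 * n ^ 2 * θ ^ 2 := by gcongr
      _ = (n * θ) ^ 2 * 4 := by ring
  have e2 : √((n * p + (n * p) ^ 2) * (n * p * C)) ≤ n * θ ^ 2 * √(2 * (p * κ / θ ^ 2)) := by
    refine Real.sqrt_le_iff.2 ⟨by positivity, ?_⟩
    rw [mul_pow (n * θ ^ 2), Real.sq_sqrt (by positivity)]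
    calc (n * p + (n * p) ^ 2) * (n * p * C)
        ≤ (n * p + (n * p) ^ 2) * (n * p * (κ * G)) := by gcongr
      _ ≤ (2 * (n * p) ^ 2) * (n * p * (κ * G)) := by
          gcongr
          nlinarith
      _ = 2 * n ^ 2 * (p * κ) * (n * p ^ 2 * G) := by ring
      _ ≤ 2 * n ^ 2 * (p * κ) * θ ^ 2 := by gcongr
      _ = (n * θ ^ 2) ^ 2 * (2 * (p * κ / θ ^ 2)) := by field_simp
  have e3 : √((n * p) ^ 2 * D) ≤ 5 * (n * p * κ) := by
    refine Real.sqrt_le_iff.2 ⟨by positivity, ?_⟩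
    calc (n * p) ^ 2 * D ≤ (n * p) ^ 2 * (25 * K) := by gcongr
      _ = (5 * (n * p * κ)) ^ 2 := by rw [← hκ]; ring
  calc _ = n * ((2 * (n * p) + 2 * (n * p) * √(n * p)) * G)
        + n * (2 * √((n * p + (n * p) ^ 2) * (n * p * C))) + n * (2 * √((n * p) ^ 2 * D)) := by
        ring
    _ ≤ (n * θ) ^ 2 * (4 / √(n * p)) + n * (2 * (n * θ ^ 2 * √(2 * (p * κ / θ ^ 2))))
        + n * (2 * (5 * (n * p * κ))) := by gcongr
    _ = _ := by field_simp; ring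

/-- The fluctuations in the law of large numbers for the main part of the conditional variance, when
its weights are truncated at the level `δ θ² n / p`. -/
theorem sqrt_truncation_le {n p θ V δ : ℝ} (hn : 0 < n) (hp : 0 < p) (hnp : 1 ≤ n * p)
    (hθ : 0 < θ) (hδ : 0 < δ) (hV : p * V ≤ 2 * θ ^ 2) :
    √(n ^ 2 * p * (δ * θ ^ 2 * n / p * V)) + n * p * √(n * (δ * θ ^ 2 * n / p * V))
      ≤ (n * θ) ^ 2 * (2 * √(2 * δ)) := by
  have hs := Real.sq_sqrt (show 0 ≤ 2 * δ by positivity)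
  have hW : V ≤ 2 * θ ^ 2 / p := by rw [le_div_iff₀' hp]; exact hV
  have e1 : √(n ^ 2 * p * (δ * θ ^ 2 * n / p * V)) ≤ (n * θ) ^ 2 * √(2 * δ) := by
    refine Real.sqrt_le_iff.2 ⟨by positivity, ?_⟩
    rw [mul_pow, hs]
    calc n ^ 2 * p * (δ * θ ^ 2 * n / p * V)
        ≤ n ^ 2 * p * (δ * θ ^ 2 * n / p * (2 * θ ^ 2 / p)) := by gcongr
      _ = 2 * δ * θ ^ 4 * n ^ 3 * (1 / p) := by field_simp
      _ ≤ 2 * δ * θ ^ 4 * n ^ 3 * n := by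
          gcongr
          rw [div_le_iff₀ hp]; exact hnp
      _ = ((n * θ) ^ 2) ^ 2 * (2 * δ) := by ring
  have e2 : √(n * (δ * θ ^ 2 * n / p * V)) ≤ n * θ ^ 2 / p * √(2 * δ) := by
    refine Real.sqrt_le_iff.2 ⟨by positivity, ?_⟩
    rw [mul_pow, hs]
    calc n * (δ * θ ^ 2 * n / p * V)
        ≤ n * (δ * θ ^ 2 * n / p * (2 * θ ^ 2 / p)) := by gcongr
      _ = (n * θ ^ 2 / p) ^ 2 * (2 * δ) := by ring
  calc _ ≤ (n * θ) ^ 2 * √(2 * δ) + n * p * (n * θ ^ 2 / p * √(2 * δ)) := by gcongr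
    _ = _ := by field_simp; ring

/-- The mean of the main part of the summed conditional variances is `(n θ)²`, up to a relative error
of order `1 / n`. -/
theorem abs_mean_condVar_sub_le {n p θ G H : ℝ} (hn : 1 ≤ n) (hp : 0 ≤ p) (hG : 0 ≤ G)
    (hH : 0 ≤ H) (hvar : θ ^ 2 = n * p ^ 2 * G + p * H / 2) :
    |n * (((n - 1) * (p * (1 - p)) + ((n - 1) * p) ^ 2) * G)
        + n * (n - 1) / 2 * (p * (H - 2 * G)) - (n * θ) ^ 2| ≤ 3 * n * θ ^ 2 := by
  have e : n * (((n - 1) * (p * (1 - p)) + ((n - 1) * p) ^ 2) * G)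
        + n * (n - 1) / 2 * (p * (H - 2 * G)) - (n * θ) ^ 2
      = -(n * θ ^ 2 + 2 * (n - 1) * (n * p ^ 2 * G)) := by
    linear_combination (-n ^ 2 + n) * hvar
  have hG0 : 0 ≤ n * p ^ 2 * G := by positivity
  have hG1 : n * p ^ 2 * G ≤ θ ^ 2 := by
    have : 0 ≤ p * H / 2 := by positivity
    linarith
  have h1 : 0 ≤ 2 * (n - 1) * (n * p ^ 2 * G) := mul_nonneg (by linarith) hG0
  have h2 : 0 ≤ θ ^ 2 := sq_nonneg θ
  rw [e, abs_neg, abs_of_nonneg (by positivity)]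
  nlinarith

/-! ### Convergence of the conditional variance -/

namespace IncompleteUArray

section Limits

set_option linter.unusedSectionVars false

variable {Ω : Type*} [mΩ : MeasurableSpace Ω] {P : Measure Ω} [IsProbabilityMeasure P]
  (A : IncompleteUArray P) {n : ℕ} {k : ℝ → ℝ → ℝ}

theorem integrable_eta1 (ε : ℝ) (n : ℕ) : Integrable (A.eta1 ε n) P := by
  have h := integrable_finsetSum (μ := P) (Finset.Icc 1 n) fun i _ =>
    integrable_condExp (m := A.filt n (i - 1)) (μ := P)
      (f := {ω' | ε ≤ |A.xi n i ω'|}.indicator fun ω' => A.xi n i ω' ^ 2)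
  exact h

theorem integrable_eta2 (n : ℕ) : Integrable (A.eta2 n) P := by
  have h := integrable_finsetSum (μ := P) (Finset.Icc 1 n) fun i _ =>
    integrable_condExp (m := A.filt n (i - 1)) (μ := P) (f := fun ω' => A.xi n i ω' ^ 2)
  exact h

theorem eta2_ae_eq (hk : HoeffdingKernel (P.map (A.X n 1)) k) (hkh : Function.uncurry k
    =ᵐ[(P.map (A.X n 1)).prod (P.map (A.X n 1))] Function.uncurry (A.h n)) :
    A.eta2 n =ᵐ[P] fun ω => 1 / (n * A.theta n) ^ 2 * ∑ i ∈ Finset.Icc 1 n,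
      (P[fun ω' => increment n (P.map (A.X n 1)) k (A.row n) i ω' ^ 2 | A.filt n (i - 1)]) ω := by
  have h : ∀ᵐ ω ∂P, ∀ i ∈ Finset.Icc 1 n,
      (P[fun ω' => A.xi n i ω' ^ 2 | A.filt n (i - 1)]) ω = 1 / (n * A.theta n) ^ 2 *
        (P[fun ω' => increment n (P.map (A.X n 1)) k (A.row n) i ω' ^ 2
          | A.filt n (i - 1)]) ω := by
    refine (Finset.eventually_all _).2 fun i hi => ?_
    have h1 : (fun ω' => A.xi n i ω' ^ 2) =ᵐ[P] (1 / (n * A.theta n) ^ 2) •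
        fun ω' => increment n (P.map (A.X n 1)) k (A.row n) i ω' ^ 2 := by
      filter_upwards [A.xi_ae_eq hk hkh hi] with ω hω
      rw [hω, Pi.smul_apply, smul_eq_mul, mul_pow, div_pow, one_pow]
    filter_upwards [condExp_congr_ae (m := A.filt n (i - 1)) h1,
      condExp_smul (μ := P) (1 / (n * A.theta n) ^ 2)
        (fun ω' => increment n (P.map (A.X n 1)) k (A.row n) i ω' ^ 2) (A.filt n (i - 1))]
      with ω e1 e2
    rw [e1, e2, Pi.smul_apply, smul_eq_mul]
  filter_upwards [h] with ω hω
  rw [eta2, Finset.sum_congr rfl hω, ← Finset.mul_sum]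

/-- The error of the conditional variance has three sources: the remainders of the individual
increments, each at most `B` in `L¹`, the fluctuations of the main part `condMain`, and the deviation
of its mean from `(n θ)²`. -/
theorem integral_abs_eta2_sub_one_le (hn : 2 ≤ n)
    (hk : HoeffdingKernel (P.map (A.X n 1)) k) (hkh : Function.uncurry k
      =ᵐ[(P.map (A.X n 1)).prod (P.map (A.X n 1))] Function.uncurry (A.h n))
    (hθ : 0 < A.theta n) {B a : ℝ} (ha : 0 ≤ a)
    (hB : ∀ i ∈ Finset.Icc 1 n, ∫ ω, |(P[fun ω' =>
        increment n (P.map (A.X n 1)) k (A.row n) i ω' ^ 2 | A.filt n (i - 1)]) ω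
      - condMain P n (P.map (A.X n 1)) k (A.row n) i ω| ∂P ≤ B) :
    (n * A.theta n) ^ 2 * ∫ ω, |A.eta2 n ω - 1| ∂P ≤ n * B
      + (2 * (n : ℝ) ^ 2 * A.p n * (∫ x,
          (if a ≤ gram (P.map (A.X n 1)) (degen (P.map (A.X n 1)) k) x x
            then gram (P.map (A.X n 1)) (degen (P.map (A.X n 1)) k) x x else 0)
              ∂(P.map (A.X n 1)))
        + √((n : ℝ) ^ 2 * A.p n * (a * kernelSq (P.map (A.X n 1)) (degen (P.map (A.X n 1)) k)))
        + (n : ℝ) * A.p n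
          * √(n * (a * kernelSq (P.map (A.X n 1)) (degen (P.map (A.X n 1)) k))))
      + 3 * n * A.theta n ^ 2 := by
  have hW := A.isRow n
  have hμ := hW.isProbabilityMeasure (by omega)
  set μ := P.map (A.X n 1) with hμdef
  set V : ℝ → ℝ := fun x => gram μ (degen μ k) x x with hV
  have hVm : Measurable V :=
    hk.degenerate.measurable_gram.comp (measurable_id.prodMk measurable_id)
  have hV0 : ∀ x, 0 ≤ V x := gram_self_nonneg _ _
  have hVi : Integrable V μ := hk.degenerate.integrable_gram_self
  have hVint : ∫ x, V x ∂μ = kernelSq μ (degen μ k) := hk.degenerate.integral_gram_self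
  have hs : 0 < (n * A.theta n) ^ 2 := by
    have : (0 : ℝ) < n := by exact_mod_cast (by omega : 0 < n)
    positivity
  set cE : ℕ → Ω → ℝ := fun i =>
    P[fun ω' => increment n μ k (A.row n) i ω' ^ 2 | A.filt n (i - 1)] with hcE
  have hcEi : ∀ i, Integrable (cE i) P := fun i => integrable_condExp
  have hVj : ∀ i ∈ Finset.Icc 1 n, ∀ j ∈ Finset.Ico 1 i,
      Integrable (fun ω => edge (A.row n) i j ω * V (vertex (A.row n) j ω)) P := by
    intro i hi j hj
    have hj1 := (IsRow.mem_Icc_of_mem_Ico hi hj).1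
    exact (hW.integrable_vertex hj1 hVi).bdd_mul (hW.measurable _).aestronglyMeasurable
      (Eventually.of_forall (hW.edge_abs_le s(i, j)))
  have hMi : ∀ i ∈ Finset.Icc 1 n, Integrable (condMain P n μ k (A.row n) i) P := fun i hi =>
    (integrable_const _).add (integrable_finsetSum _ (hVj i hi))
  have hU := hW.integral_abs_sum_edge_mul_sub_le hn hVm hV0 hVi ha
  rw [hVint] at hU
  set S : Ω → ℝ := fun ω => ∑ i ∈ Finset.Icc 1 n, ∑ j ∈ Finset.Ico 1 i,
    (edge (A.row n) i j ω * V (vertex (A.row n) j ω)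
      - A.p n * kernelSq μ (degen μ k)) with hS
  have hSi : Integrable S P := integrable_finsetSum _ fun i hi => integrable_finsetSum _
    fun j hj => (hVj i hi j hj).sub (integrable_const _)
  have hcard : ∑ i ∈ Finset.Icc 1 n, ((Finset.Ico 1 i).card : ℝ) = n * (n - 1) / 2 := by
    have : ∀ m : ℕ, ∑ i ∈ Finset.Icc 1 m, ((Finset.Ico 1 i).card : ℝ) = m * (m - 1) / 2 := by
      intro m
      induction m with
      | zero => simp
      | succ m ih =>
        rw [Finset.sum_Icc_succ_top (by omega), ih, Nat.card_Ico, Nat.add_sub_cancel]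
        push_cast; ring
    exact this n
  have hdeg : ∀ i ∈ Finset.Icc 1 n, condMain P n μ k (A.row n) i
      = fun ω => (((n : ℝ) - 1) * (A.p n * (1 - A.p n)) + (((n : ℝ) - 1) * A.p n) ^ 2) * projSq μ k
        + ∑ j ∈ Finset.Ico 1 i, edge (A.row n) i j ω * V (vertex (A.row n) j ω) := by
    intro i hi
    funext ω
    rw [condMain, hW.integral_degree_sq hi]
  have hsum : ∀ ω, ∑ i ∈ Finset.Icc 1 n, condMain P n μ k (A.row n) i ω
      = S ω + (n * ((((n : ℝ) - 1) * (A.p n * (1 - A.p n)) + (((n : ℝ) - 1) * A.p n) ^ 2) * projSq μ k)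
        + (n : ℝ) * (n - 1) / 2 * (A.p n * kernelSq μ (degen μ k))) := by
    intro ω
    rw [Finset.sum_congr rfl fun i hi => congrFun (hdeg i hi) ω]
    simp only [hS, Finset.sum_add_distrib, Finset.sum_sub_distrib, Finset.sum_const,
      nsmul_eq_mul, ← Finset.sum_mul, hcard, Nat.card_Icc, Nat.add_sub_cancel]
    ring
  have hmean := abs_mean_condVar_sub_le (n := n) (by exact_mod_cast (by omega : 1 ≤ n))
    (A.p n).2.1 (projSq_nonneg μ k) (kernelSq_nonneg μ k) (A.theta_sq hn hk hkh)
  rw [← hk.kernelSq_degen] at hmean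
  have hpt : ∀ᵐ ω ∂P, (n * A.theta n) ^ 2 * |A.eta2 n ω - 1|
      ≤ ∑ i ∈ Finset.Icc 1 n, |cE i ω - condMain P n μ k (A.row n) i ω| + |S ω|
        + 3 * n * A.theta n ^ 2 := by
    filter_upwards [A.eta2_ae_eq hk hkh] with ω hω
    have e : (n * A.theta n) ^ 2 * (A.eta2 n ω - 1)
        = ∑ i ∈ Finset.Icc 1 n, (cE i ω - condMain P n μ k (A.row n) i ω) + S ω
          + (n * ((((n : ℝ) - 1) * (A.p n * (1 - A.p n)) + (((n : ℝ) - 1) * A.p n) ^ 2) * projSq μ k)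
            + (n : ℝ) * (n - 1) / 2 * (A.p n * kernelSq μ (degen μ k)) - (n * A.theta n) ^ 2) := by
      rw [hω, Finset.sum_sub_distrib, hsum ω, mul_sub, ← mul_assoc, mul_one_div_cancel hs.ne']
      ring
    have e' : (n * A.theta n) ^ 2 * |A.eta2 n ω - 1|
        = |(n * A.theta n) ^ 2 * (A.eta2 n ω - 1)| := by rw [abs_mul, abs_of_pos hs]
    rw [e', e]
    refine (abs_add_le _ _).trans (add_le_add ((abs_add_le _ _).trans
      (add_le_add_left (Finset.abs_sum_le_sum_abs _ _) _)) hmean)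
  have hi0 : ∀ i ∈ Finset.Icc 1 n,
      Integrable (fun ω => |cE i ω - condMain P n μ k (A.row n) i ω|) P := fun i hi =>
    ((hcEi i).sub (hMi i hi)).abs
  have hi1 : Integrable (fun ω => ∑ i ∈ Finset.Icc 1 n,
      |cE i ω - condMain P n μ k (A.row n) i ω|) P :=
    integrable_finsetSum _ hi0
  have hi2 : Integrable (fun ω => |S ω|) P := hSi.abs
  have hi3 : Integrable (fun ω => ∑ i ∈ Finset.Icc 1 n,
      |cE i ω - condMain P n μ k (A.row n) i ω| + |S ω|) P := hi1.add hi2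
  calc (n * A.theta n) ^ 2 * ∫ ω, |A.eta2 n ω - 1| ∂P
      = ∫ ω, (n * A.theta n) ^ 2 * |A.eta2 n ω - 1| ∂P := (integral_const_mul _ _).symm
    _ ≤ ∫ ω, (∑ i ∈ Finset.Icc 1 n, |cE i ω - condMain P n μ k (A.row n) i ω| + |S ω|
        + 3 * n * A.theta n ^ 2) ∂P :=
        integral_mono_ae (((A.integrable_eta2 n).sub (integrable_const 1)).abs.const_mul _)
          (hi3.add (integrable_const _)) hpt
    _ = ∑ i ∈ Finset.Icc 1 n, ∫ ω, |cE i ω - condMain P n μ k (A.row n) i ω| ∂P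
        + ∫ ω, |S ω| ∂P + 3 * n * A.theta n ^ 2 := by
        rw [integral_add hi3 (integrable_const _), integral_add hi1 hi2,
          integral_finsetSum _ hi0]
        simp
    _ ≤ n * B + _ + 3 * n * A.theta n ^ 2 := by
        refine add_le_add_left (add_le_add ((Finset.sum_le_sum hB).trans ?_) hU) _
        simp

theorem p_pos_of_one_le (hp : 1 ≤ n * (A.p n : ℝ)) : (0 : ℝ) < A.p n := by
  by_contra h
  have : (n : ℝ) * A.p n ≤ 0 :=
    mul_nonpos_of_nonneg_of_nonpos (Nat.cast_nonneg n) (not_lt.1 h)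
  linarith

theorem mul_kernelSq_degen_le (hn : 2 ≤ n) (hk : HoeffdingKernel (P.map (A.X n 1)) k)
    (hkh : Function.uncurry k
      =ᵐ[(P.map (A.X n 1)).prod (P.map (A.X n 1))] Function.uncurry (A.h n)) :
    A.p n * kernelSq (P.map (A.X n 1)) (degen (P.map (A.X n 1)) k) ≤ 2 * A.theta n ^ 2 := by
  have hμ := (A.isRow n).isProbabilityMeasure (by omega)
  have hp0 := (A.p n).2.1
  rw [hk.kernelSq_degen, A.theta_sq hn hk hkh]
  have h1 := projSq_nonneg (P.map (A.X n 1)) k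
  have h2 : 0 ≤ n * (A.p n : ℝ) ^ 2 * projSq (P.map (A.X n 1)) k := by positivity
  have h3 : 0 ≤ A.p n * projSq (P.map (A.X n 1)) k := by positivity
  linarith

theorem integral_abs_eta2_sub_one_le_of_truncation (hn : 3 ≤ n) (hθ : 0 < A.theta n)
    (hp : 1 ≤ n * (A.p n : ℝ)) {δ : ℝ} (hδ : 0 < δ) :
    ∫ ω, |A.eta2 n ω - 1| ∂P ≤ 4 / √((n : ℝ) * A.p n)
      + 2 * √(2 * √(1 / A.theta n ^ 4 * ∫ ω, A.G n 1 2 3 ω ^ 2 ∂P))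
      + 10 * √(1 / A.theta n ^ 4 * ∫ ω, A.G n 1 2 3 ω ^ 2 ∂P)
      + 2 * ((A.p n : ℝ) / A.theta n ^ 2 *
        ∫ ω, {ω' | δ * A.theta n ^ 2 * n / (A.p n : ℝ) ≤ |A.HTilde n 2 1 1 ω'|}.indicator
          (fun ω' => A.HTilde n 2 1 1 ω') ω ∂P)
      + 2 * √(2 * δ) + 3 / n := by
  obtain ⟨k, hk, hkh⟩ := A.exists_kernel (n := n) (by omega)
  have hμ := (A.isRow n).isProbabilityMeasure (by omega)
  have hn0 : (0 : ℝ) < n := by exact_mod_cast (by omega : 0 < n)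
  have hp0 := A.p_pos_of_one_le hp
  have hvar := A.theta_sq (by omega) hk hkh
  have hV := A.mul_kernelSq_degen_le (by omega) hk hkh
  have h1 := A.integral_abs_eta2_sub_one_le (by omega) hk hkh hθ
    (a := δ * A.theta n ^ 2 * n / A.p n) (by positivity) fun i hi =>
      (A.isRow n).integral_abs_condExp_increment_sub_le (by omega) hk hi (A.filt_le_restAlg hi)
        (A.measurable_condMain (by omega) hk hi)
  have h2 := condVar_error_le hn0 hp0 hp hθ (projSq_nonneg _ k) (kernelSq_nonneg _ k)
    (kernelSq_nonneg _ _) hvar hk.sq_integral_sq_cross_le hk.kernelSq_gram_degen_le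
  have h3 := sqrt_truncation_le hn0 hp0 hp hθ hδ hV
  rw [A.integral_G_sq hn hk hkh, A.integral_indicator_HTilde hk hkh (by omega)]
  refine le_of_mul_le_mul_left (h1.trans ?_) (show 0 < (n * A.theta n) ^ 2 by positivity)
  set I := ∫ x, (if δ * A.theta n ^ 2 * n / A.p n
      ≤ gram (P.map (A.X n 1)) (degen (P.map (A.X n 1)) k) x x
    then gram (P.map (A.X n 1)) (degen (P.map (A.X n 1)) k) x x else 0) ∂(P.map (A.X n 1))
  have e1 : 2 * (n : ℝ) ^ 2 * A.p n * I
      = ((n : ℝ) * A.theta n) ^ 2 * (2 * ((A.p n : ℝ) / A.theta n ^ 2 * I)) := by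
    field_simp
  have e2 : 3 * n * A.theta n ^ 2 = (n * A.theta n) ^ 2 * (3 / n) := by
    field_simp
  rw [e1, e2]
  linarith

theorem tendstoInMeasure_eta2 (hθ : ∀ᶠ n in atTop, 0 < A.theta n)
    (hC3 : ∀ ε : ℝ, 0 < ε → Tendsto (fun n : ℕ => (A.p n : ℝ) / A.theta n ^ 2 *
      ∫ ω, {ω' | ε * A.theta n ^ 2 * n / (A.p n : ℝ) ≤ |A.HTilde n 2 1 1 ω'|}.indicator
        (fun ω' => A.HTilde n 2 1 1 ω') ω ∂P) atTop (𝓝 0))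
    (hC4 : Tendsto (fun n : ℕ => 1 / A.theta n ^ 4 * ∫ ω, A.G n 1 2 3 ω ^ 2 ∂P)
      atTop (𝓝 0)) :
    TendstoInMeasure P A.eta2 atTop (fun _ => (1 : ℝ)) := by
  refine tendstoInMeasure_of_integral_abs A.integrable_eta2 ?_
  refine tendsto_zero_of_forall_eventually_le
    (fun n => integral_nonneg fun ω => abs_nonneg _) (b := fun δ => 2 * √(2 * δ)) ?_
    fun δ hδ => ?_
  · have : ContinuousAt (fun δ : ℝ => 2 * √(2 * δ)) 0 := by fun_prop
    have h := this.tendsto.mono_left (nhdsWithin_le_nhds (s := Set.Ioi 0))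
    simpa using h
  · have t1 : Tendsto (fun n : ℕ => 4 / √(n * (A.p n : ℝ))) atTop (𝓝 0) :=
      (Real.tendsto_sqrt_atTop.comp A.tendsto_mul_p).const_div_atTop 4
    have t2 := hC4.sqrt
    have t3 := (t2.const_mul 2).sqrt.const_mul 2
    have t4 : Tendsto (fun n : ℕ => 3 / (n : ℝ)) atTop (𝓝 0) :=
      tendsto_natCast_atTop_atTop.const_div_atTop 3
    have t := ((((t1.add t3).add (t2.const_mul 10)).add ((hC3 δ hδ).const_mul 2)).add_const
      (2 * √(2 * δ))).add t4
    refine ⟨_, t.mono_right (le_of_eq (by simp)), ?_⟩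
    filter_upwards [hθ, eventually_ge_atTop 3, A.tendsto_mul_p.eventually_ge_atTop 1]
      with n h1 h2 h3
    exact A.integral_abs_eta2_sub_one_le_of_truncation h2 h1 h3 hδ

end Limits

end IncompleteUArray

/-! ### The conditional Lindeberg condition -/

theorem integrable_ite_sq {Ω : Type*} [MeasurableSpace Ω] {P : Measure Ω} {f : Ω → ℝ}
    (hf : MemLp f 2 P) (hm : Measurable f) (c : ℝ) :
    Integrable (fun ω => if c ≤ |f ω| then f ω ^ 2 else 0) P := by
  refine hf.integrable_sq.mono (Measurable.ite (measurableSet_le measurable_const hm.abs)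
    (hm.pow_const 2) measurable_const).aestronglyMeasurable (Eventually.of_forall fun ω => ?_)
  split_ifs <;> simp [sq_nonneg]

/-- Truncated second moments of an increment, bounded through those of its linear and of its
degenerate part. -/
theorem IsRow.integral_indicator_increment_le {Ω : Type*} [mΩ : MeasurableSpace Ω] {P : Measure Ω}
    [IsProbabilityMeasure P] {n : ℕ} {μ : Measure ℝ} [IsProbabilityMeasure μ] {p : ℝ}
    {𝒜 : ℕ ⊕ Sym2 ℕ → MeasurableSpace Ω} {W : ℕ ⊕ Sym2 ℕ → Ω → ℝ} {k : ℝ → ℝ → ℝ}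
    (hW : IsRow P n μ p 𝒜 W) (hn : 2 ≤ n) (hk : HoeffdingKernel μ k) {i : ℕ}
    (hi : i ∈ Finset.Icc 1 n) {τ σ c : ℝ} (hτ : 0 < τ) (hσ : 0 ≤ σ) (hc : 0 < c) :
    ∫ ω, (if 4 * c ≤ |increment n μ k W i ω| then increment n μ k W i ω ^ 2 else 0) ∂P
      ≤ 4 * (∫ ω, (if 2 * c ≤ |degree n W 1 ω * proj μ k (vertex W 1 ω)|
          then (degree n W 1 ω * proj μ k (vertex W 1 ω)) ^ 2 else 0) ∂P)
        + 16 * ((4 * τ ^ 2 + 3 * n * σ) / c ^ 2 * (n * (p * kernelSq μ (degen μ k)))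
          + n * (∫ x, (if σ ≤ p * gram μ (degen μ k) x x
              then p * gram μ (degen μ k) x x else 0) ∂μ)
          + n * (p * ∫ z, (if τ ≤ |degen μ k z.1 z.2| then degen μ k z.1 z.2 ^ 2 else 0)
              ∂(μ.prod μ))) := by
  set a : Ω → ℝ := fun ω => degree n W i ω * proj μ k (vertex W i ω) with ha
  set b : Ω → ℝ := fun ω =>
    ∑ j ∈ Finset.Ico 1 i, edge W i j ω * degen μ k (vertex W i ω) (vertex W j ω) with hb
  have hm := hk.measurable_degen
  have ham : Measurable a := (Finset.measurable_sum _ fun j _ => hW.measurable _).mul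
    (hk.measurable_proj.comp (hW.measurable _))
  have hbm : Measurable b := Finset.measurable_sum _ fun j _ => (hW.measurable _).mul
    (hm.comp ((hW.measurable (Sum.inl i)).prodMk (hW.measurable (Sum.inl j))))
  have haL : MemLp a 2 P := hW.memLp_degree_mul_proj hk hi
  have hbL : MemLp b 2 P := memLp_finsetSum _ fun j hj =>
    hW.memLp_edge_mul_degen hk hi (IsRow.mem_Icc_of_mem_Ico hi hj).1
      (IsRow.mem_Icc_of_mem_Ico hi hj).2
  have hai := integrable_ite_sq haL ham (2 * c)
  have hbi := integrable_ite_sq hbL hbm (2 * c)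
  have hid := (hW.identDistrib_degree_mul hi hk.measurable_proj).comp
    (u := fun x => if 2 * c ≤ |x| then x ^ 2 else 0)
    (Measurable.ite (measurableSet_le measurable_const (by fun_prop)) (by fun_prop)
      measurable_const)
  have h1 : ∫ ω, (if 2 * c ≤ |a ω| then a ω ^ 2 else 0) ∂P
      = ∫ ω, (if 2 * c ≤ |degree n W 1 ω * proj μ k (vertex W 1 ω)|
          then (degree n W 1 ω * proj μ k (vertex W 1 ω)) ^ 2 else 0) ∂P := hid.integral_eq
  have h2 := hW.integral_indicator_sum_edge_mul_degen_le hn hk hi hτ hσ hc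
  calc ∫ ω, (if 4 * c ≤ |increment n μ k W i ω| then increment n μ k W i ω ^ 2 else 0) ∂P
      ≤ ∫ ω, (4 * (if 2 * c ≤ |a ω| then a ω ^ 2 else 0)
          + 4 * (if 2 * c ≤ |b ω| then b ω ^ 2 else 0)) ∂P := by
        refine integral_mono_of_nonneg (Eventually.of_forall fun ω => ?_)
          ((hai.const_mul 4).add (hbi.const_mul 4)) (Eventually.of_forall fun ω => ?_)
        · simp only [Pi.zero_apply]; positivity
        · have h := sq_indicator_add_le (a ω) (b ω) (2 * c)
          rw [show 2 * (2 * c) = 4 * c by ring] at h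
          exact h
    _ = 4 * (∫ ω, (if 2 * c ≤ |a ω| then a ω ^ 2 else 0) ∂P)
          + 4 * (∫ ω, (if 2 * c ≤ |b ω| then b ω ^ 2 else 0) ∂P) := by
        rw [integral_add (hai.const_mul 4) (hbi.const_mul 4), integral_const_mul,
          integral_const_mul]
    _ ≤ _ := by
        rw [h1]
        linarith

/-- The bound for the truncated increments, with `4 c = ε n θ`, `τ = δ θ n` and `σ = δ θ² n`, in terms
of the quantities that tend to zero by hypothesis. -/
theorem lindeberg_rescaling {n p θ δ ε T I1 I2 I3 : ℝ} (hn : 0 < n) (hθ : 0 < θ)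
    (hδ : 0 < δ) (hε : 0 < ε) (hT : p * T ≤ 2 * θ ^ 2) :
    1 / (n * θ) ^ 2 * (n * (4 * I1 + 16 * ((4 * (δ * θ * n) ^ 2 + 3 * n * (δ * θ ^ 2 * n))
          / (ε * (n * θ) / 4) ^ 2 * (n * (p * T)) + n * (p * I3) + n * (p * I2))))
      ≤ 4 * (1 / (n * θ ^ 2) * I1) + 16 * (1 / θ ^ 2 * (p * I2)) + 16 * (p / θ ^ 2 * I3)
        + 512 / ε ^ 2 * (4 * δ ^ 2 + 3 * δ) := by
  have e : 1 / (n * θ) ^ 2 * (n * (4 * I1 + 16 * ((4 * (δ * θ * n) ^ 2 + 3 * n * (δ * θ ^ 2 * n))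
          / (ε * (n * θ) / 4) ^ 2 * (n * (p * T)) + n * (p * I3) + n * (p * I2))))
      = 4 * (1 / (n * θ ^ 2) * I1) + 16 * (1 / θ ^ 2 * (p * I2)) + 16 * (p / θ ^ 2 * I3)
        + 256 / ε ^ 2 * (4 * δ ^ 2 + 3 * δ) * (p * T / θ ^ 2) := by
    field_simp
    ring
  have h1 : p * T / θ ^ 2 ≤ 2 := by rw [div_le_iff₀ (by positivity)]; exact hT
  have h2 : 256 / ε ^ 2 * (4 * δ ^ 2 + 3 * δ) * (p * T / θ ^ 2)
      ≤ 256 / ε ^ 2 * (4 * δ ^ 2 + 3 * δ) * 2 := by gcongr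
  have h3 : 256 / ε ^ 2 * (4 * δ ^ 2 + 3 * δ) * 2 = 512 / ε ^ 2 * (4 * δ ^ 2 + 3 * δ) := by ring
  linarith

namespace IncompleteUArray

section Lindeberg

set_option linter.unusedSectionVars false

variable {Ω : Type*} [mΩ : MeasurableSpace Ω] {P : Measure Ω} [IsProbabilityMeasure P]
  (A : IncompleteUArray P) {n : ℕ} {k : ℝ → ℝ → ℝ}

/-- The conditional Lindeberg functional is nonnegative, so its `L¹` norm is its mean. -/
theorem integral_abs_eta1_eq (ε : ℝ) (n : ℕ) : ∫ ω, |A.eta1 ε n ω| ∂P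
    = ∑ i ∈ Finset.Icc 1 n, ∫ ω, {ω' | ε ≤ |A.xi n i ω'|}.indicator
      (fun ω' => A.xi n i ω' ^ 2) ω ∂P := by
  have h : ∀ᵐ ω ∂P, ∀ i ∈ Finset.Icc 1 n, 0 ≤ (P[{ω' | ε ≤ |A.xi n i ω'|}.indicator
      (fun ω' => A.xi n i ω' ^ 2) | A.filt n (i - 1)]) ω :=
    (Finset.eventually_all _).2 fun i _ => condExp_nonneg
      (Eventually.of_forall fun ω => Set.indicator_nonneg (fun ω _ => sq_nonneg _) ω)
  have e : (fun ω => |A.eta1 ε n ω|) =ᵐ[P] A.eta1 ε n := by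
    filter_upwards [h] with ω hω
    exact abs_of_nonneg (Finset.sum_nonneg hω)
  rw [integral_congr_ae e]
  simp only [eta1]
  rw [integral_finsetSum _ fun i _ => integrable_condExp]
  refine Finset.sum_congr rfl fun i hi => ?_
  exact integral_condExp ((A.filt_le_restAlg hi).trans ((A.isRow n).restAlg_le _))

theorem integral_indicator_xi (hk : HoeffdingKernel (P.map (A.X n 1)) k)
    (hkh : Function.uncurry k
      =ᵐ[(P.map (A.X n 1)).prod (P.map (A.X n 1))] Function.uncurry (A.h n))
    (hs : 0 < n * A.theta n) (ε : ℝ) {i : ℕ} (hi : i ∈ Finset.Icc 1 n) :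
    ∫ ω, {ω' | ε ≤ |A.xi n i ω'|}.indicator (fun ω' => A.xi n i ω' ^ 2) ω ∂P
      = 1 / (n * A.theta n) ^ 2 * ∫ ω, (if ε * (n * A.theta n)
          ≤ |increment n (P.map (A.X n 1)) k (A.row n) i ω|
        then increment n (P.map (A.X n 1)) k (A.row n) i ω ^ 2 else 0) ∂P := by
  rw [← integral_const_mul]
  refine integral_congr_ae ?_
  filter_upwards [A.xi_ae_eq hk hkh hi] with ω hω
  simp only [Set.indicator_apply, Set.mem_ofPred_eq, hω, one_div_mul_eq_div, abs_div,
    abs_of_pos hs, le_div_iff₀ hs]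
  split_ifs
  · rw [div_pow]
  · simp

theorem integral_abs_eta1_le (hn : 2 ≤ n) (hθ : 0 < A.theta n) (hp : 1 ≤ n * (A.p n : ℝ))
    {ε δ : ℝ} (hε : 0 < ε) (hδ : 0 < δ) :
    ∫ ω, |A.eta1 ε n ω| ∂P ≤ 4 * (1 / (n * A.theta n ^ 2) *
        ∫ ω, {ω' | ε / 2 * A.theta n * n ≤ |∑ j ∈ Finset.Icc 2 n, A.Psi n j 1 ω'|}.indicator
          (fun ω' => (∑ j ∈ Finset.Icc 2 n, A.Psi n j 1 ω') ^ 2) ω ∂P)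
      + 16 * (1 / A.theta n ^ 2 *
        ∫ ω, {ω' | δ * A.theta n * n ≤ |A.PhiTilde n 1 2 ω'|}.indicator
          (fun ω' => A.PhiTilde n 1 2 ω' ^ 2) ω ∂P)
      + 16 * ((A.p n : ℝ) / A.theta n ^ 2 *
        ∫ ω, {ω' | δ * A.theta n ^ 2 * n / (A.p n : ℝ) ≤ |A.HTilde n 2 1 1 ω'|}.indicator
          (fun ω' => A.HTilde n 2 1 1 ω') ω ∂P)
      + 512 / ε ^ 2 * (4 * δ ^ 2 + 3 * δ) := by
  obtain ⟨k, hk, hkh⟩ := A.exists_kernel hn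
  have hμ := (A.isRow n).isProbabilityMeasure (by omega)
  have hn0 : (0 : ℝ) < n := by exact_mod_cast (by omega : 0 < n)
  have hp0 := A.p_pos_of_one_le hp
  have hV := A.mul_kernelSq_degen_le hn hk hkh
  have hs : 0 < n * A.theta n := by positivity
  rw [A.integral_abs_eta1_eq, A.integral_indicator_sum_Psi hk hkh hn,
    A.integral_indicator_PhiTilde hk hkh hn (by positivity),
    A.integral_indicator_HTilde hk hkh hn]
  refine le_trans ?_ (lindeberg_rescaling hn0 hθ hδ hε hV)
  rw [Finset.sum_congr rfl fun i hi => A.integral_indicator_xi hk hkh hs ε hi, ← Finset.mul_sum]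
  refine mul_le_mul_of_nonneg_left ?_ (by positivity)
  refine le_of_le_of_eq (Finset.sum_le_card_nsmul _ _ _ fun i hi => ?_)
    (by rw [nsmul_eq_mul, Nat.card_Icc, Nat.add_sub_cancel])
  · have h := (A.isRow n).integral_indicator_increment_le hn hk hi
      (τ := δ * A.theta n * n) (σ := δ * A.theta n ^ 2 * n) (c := ε * (n * A.theta n) / 4)
      (by positivity) (by positivity) (by positivity)
    have e1 : 4 * (ε * (n * A.theta n) / 4) = ε * (n * A.theta n) := by ring
    have e2 : 2 * (ε * (n * A.theta n) / 4) = ε / 2 * A.theta n * n := by ring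
    have e3 : ∫ x, (if δ * A.theta n ^ 2 * n
          ≤ A.p n * gram (P.map (A.X n 1)) (degen (P.map (A.X n 1)) k) x x
        then A.p n * gram (P.map (A.X n 1)) (degen (P.map (A.X n 1)) k) x x else 0)
          ∂(P.map (A.X n 1))
        = A.p n * ∫ x, (if δ * A.theta n ^ 2 * n / A.p n
          ≤ gram (P.map (A.X n 1)) (degen (P.map (A.X n 1)) k) x x
        then gram (P.map (A.X n 1)) (degen (P.map (A.X n 1)) k) x x else 0)
          ∂(P.map (A.X n 1)) := by
      rw [← integral_const_mul]
      refine integral_congr_ae (Eventually.of_forall fun x => ?_)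
      simp only [div_le_iff₀' hp0, mul_ite, mul_zero]
    rw [e1, e2, e3] at h
    exact h

theorem tendstoInMeasure_eta1 (hθ : ∀ᶠ n in atTop, 0 < A.theta n)
    (hC1 : ∀ ε : ℝ, 0 < ε → Tendsto (fun n : ℕ => 1 / (n * A.theta n ^ 2) *
      ∫ ω, {ω' | ε * A.theta n * n ≤ |∑ j ∈ Finset.Icc 2 n, A.Psi n j 1 ω'|}.indicator
        (fun ω' => (∑ j ∈ Finset.Icc 2 n, A.Psi n j 1 ω') ^ 2) ω ∂P) atTop (𝓝 0))
    (hC2 : ∀ ε : ℝ, 0 < ε → Tendsto (fun n : ℕ => 1 / A.theta n ^ 2 *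
      ∫ ω, {ω' | ε * A.theta n * n ≤ |A.PhiTilde n 1 2 ω'|}.indicator
        (fun ω' => A.PhiTilde n 1 2 ω' ^ 2) ω ∂P) atTop (𝓝 0))
    (hC3 : ∀ ε : ℝ, 0 < ε → Tendsto (fun n : ℕ => (A.p n : ℝ) / A.theta n ^ 2 *
      ∫ ω, {ω' | ε * A.theta n ^ 2 * n / (A.p n : ℝ) ≤ |A.HTilde n 2 1 1 ω'|}.indicator
        (fun ω' => A.HTilde n 2 1 1 ω') ω ∂P) atTop (𝓝 0)) {ε : ℝ} (hε : 0 < ε) :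
    TendstoInMeasure P (A.eta1 ε) atTop (fun _ => (0 : ℝ)) := by
  refine tendstoInMeasure_of_integral_abs (A.integrable_eta1 ε) ?_
  simp only [sub_zero]
  refine tendsto_zero_of_forall_eventually_le
    (fun n => integral_nonneg fun ω => abs_nonneg _)
    (b := fun δ => 512 / ε ^ 2 * (4 * δ ^ 2 + 3 * δ)) ?_ fun δ hδ => ?_
  · have : ContinuousAt (fun δ : ℝ => 512 / ε ^ 2 * (4 * δ ^ 2 + 3 * δ)) 0 := by fun_prop
    have h := this.tendsto.mono_left (nhdsWithin_le_nhds (s := Set.Ioi 0))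
    simpa using h
  · have t := ((((hC1 (ε / 2) (by positivity)).const_mul 4).add
      ((hC2 δ hδ).const_mul 16)).add ((hC3 δ hδ).const_mul 16)).add_const
        (512 / ε ^ 2 * (4 * δ ^ 2 + 3 * δ))
    refine ⟨_, t.mono_right (le_of_eq (by simp)), ?_⟩
    filter_upwards [hθ, eventually_ge_atTop 2, A.tendsto_mul_p.eventually_ge_atTop 1]
      with n h1 h2 h3
    exact A.integral_abs_eta1_le h2 h1 h3 hε hδ

end Lindeberg

end IncompleteUArray

theorem proposition4p1 {Ω : Type*} [MeasurableSpace Ω] (P : Measure Ω) [IsProbabilityMeasure P]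
    (A : IncompleteUArray P)
    (hθ : ∀ᶠ n in atTop, 0 < A.theta n)
    (hC1 : ∀ ε : ℝ, 0 < ε → Tendsto (fun n : ℕ => 1 / (n * A.theta n ^ 2) *
      ∫ ω, {ω' | ε * A.theta n * n ≤ |∑ j ∈ Finset.Icc 2 n, A.Psi n j 1 ω'|}.indicator
        (fun ω' => (∑ j ∈ Finset.Icc 2 n, A.Psi n j 1 ω') ^ 2) ω ∂P) atTop (𝓝 0))
    (hC2 : ∀ ε : ℝ, 0 < ε → Tendsto (fun n : ℕ => 1 / A.theta n ^ 2 *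
      ∫ ω, {ω' | ε * A.theta n * n ≤ |A.PhiTilde n 1 2 ω'|}.indicator
        (fun ω' => A.PhiTilde n 1 2 ω' ^ 2) ω ∂P) atTop (𝓝 0))
    (hC3 : ∀ ε : ℝ, 0 < ε → Tendsto (fun n : ℕ => (A.p n : ℝ) / A.theta n ^ 2 *
      ∫ ω, {ω' | ε * A.theta n ^ 2 * n / (A.p n : ℝ) ≤ |A.HTilde n 2 1 1 ω'|}.indicator
        (fun ω' => A.HTilde n 2 1 1 ω') ω ∂P) atTop (𝓝 0))
    (hC4 : Tendsto (fun n : ℕ => 1 / A.theta n ^ 4 * ∫ ω, A.G n 1 2 3 ω ^ 2 ∂P)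
      atTop (𝓝 0)) :
    (∀ ε : ℝ, 0 < ε → TendstoInMeasure P (A.eta1 ε) atTop (fun _ => (0 : ℝ))) ∧
      TendstoInMeasure P A.eta2 atTop (fun _ => (1 : ℝ)) :=
  ⟨fun _ hε => A.tendstoInMeasure_eta1 hθ hC1 hC2 hC3 hε, A.tendstoInMeasure_eta2 hθ hC3 hC4⟩
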